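/- Let $b>1$, $d\in\{0,1,2,\dots\}$, $m\ge 1$ and $n>0$ (the distinct count), and put $z_u=\exp\!\big(-\tfrac{n(b-1)}{m\,b^{u}}\big)$ for $u\in\mathbb Z$. In the simplified model the states of the $m$ registers are independent and identically distributed; a register state is a pair of an integer $k$ and bits $l_1,\dots,l_d\in\{0,1\}$ (it encodes the register value $k2^d+\langle l_1\dots l_d\rangle_2$), and has probability $$\tilde\rho(k,l\mid n)=z_k^{\frac1{b-1}}(1-z_k)\prod_{j=1}^d z_{k-j}^{1-l_j}(1-z_{k-j})^{l_j}.$$ Let $L(n)$ be the likelihood of the observed register states, $\hat n_{ML}$ the maximizer of $L$ on $(0,\infty)$, $\mathrm{Bias}(T)=\mathbb E(T)-n$ for an estimator $T$, and $$I(n)=\mathbb E\Big(-\tfrac{\partial^2\ln L}{\partial n^2}\Big),\quad J(n)=\mathbb E\Big(\tfrac12\tfrac{\partial^3\ln L}{\partial n^3}+\tfrac{\partial^2\ln L}{\partial n^2}\tfrac{\partial\ln L}{\partial n}\Big),\quad B(n)=\frac{J(n)}{I(n)^2}.$$ Let $\zeta(s,a)=\sum_{k\ge0}(k+a)^{-s}$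 be the Hurwitz zeta function, $\tau=\frac{b^{-d}}{b-1}$, $$c=(\ln b)(1+2\tau)\frac{\zeta(3,1+\tau)}{\zeta(2,1+\tau)^2},\qquad \tilde B(n)=\frac nm\,c,\qquad \hat n=\hat n_{ML}\Big(1+\frac cm\Big)^{-1}.$$ Then the following hold. 1. For every $b>1$, $d$, $m\ge1$ and all register states, the maximum-likelihood estimate $\hat n_{ML}$ exists and is unique. 2. For every $b>1$ and $d$, the expectations $I(n)$ and $J(n)$ are finite, and $B(n)$ is the first-order bias of $\hat n_{ML}$: as $m\to\infty$, uniformly in $n>0$, $\hat n_{ML}$ is integrable and $$\mathrm{Bias}(\hat n_{ML})=B(n)+o(n/m),\qquad \mathrm{Bias}(\hat n)=B(n)-\tilde B(n)+o(n/m).$$ 3. $B(n)\approx\tilde B(n)$ in the following sense. For every $b>1$, $d$ and $m\ge1$, the functions $n^2I(n)$ and $n^3J(n)$ are periodic in $\log_b n$ with period $1$, their means over a period are $\frac{m}{\ln b}\zeta(2,1+\tau)$ and $\frac{m}{\ln b}(1+2\tau)\zeta(3,1+\tau)$, and $\tilde B(n)$ results from $B(n)$ by replacing them by these means. If $1<b\le2$,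 then $|B(n)-\tilde B(n)|\le10^{-3}\,\tilde B(n)$ for all $d$, $m$, $n$. As $b\to1$, the relative error $|B(n)-\tilde B(n)|/\tilde B(n)$ tends to $0$ uniformly in $d$, $m$, $n$. 4. For UltraLogLog ($b=2$, $d=2$) the bias-corrected estimator is $$\hat n=\hat n_{ML}\Big(1+\frac1m\,\frac{3(\ln2)\,\zeta(3,\frac54)}{2\,\zeta(2,\frac54)^2}\Big)^{-1},\qquad \Big|\frac{3(\ln2)\,\zeta(3,\frac54)}{2\,\zeta(2,\frac54)^2}-0.48147\Big|\le 5\cdot10^{-6}.$$ -/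

import Mathlib

open MeasureTheory

noncomputable section

namespace ULL

/-- The state of one register in the simplified model: the maximum update value `k` (any integer)
and the `d` indicator bits, where `l j` (with `j = 0, …, d - 1`) tells whether there was an update
with value `k - (j + 1)`. The pair `(k, l)` stands for the register value
`k * 2 ^ d + ⟨l₁ … l_d⟩₂`, which determines it uniquely. -/
abbrev Register (d : ℕ) : Type := ℤ × (Fin d → Bool)

/-- `z_u = exp (- n (b - 1) / (m b ^ u))`: the probability that a given one of the `m` registers
got no update with value `u`. -/
def z (b : ℝ) (m : ℕ) (n : ℝ) (u : ℤ) : ℝ :=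
  Real.exp (-(n * (b - 1) / (m * b ^ u)))

/-- The simplified probability mass function of a register value. -/
def pmf (b : ℝ) (d m : ℕ) (n : ℝ) (r : Register d) : ℝ :=
  z b m n r.1 ^ (1 / (b - 1)) * (1 - z b m n r.1) *
    ∏ j : Fin d,
      if r.2 j then 1 - z b m n (r.1 - ((j : ℤ) + 1)) else z b m n (r.1 - ((j : ℤ) + 1))

/-- The distribution of a single register. -/
def registerLaw (b : ℝ) (d m : ℕ) (n : ℝ) : Measure (Register d) :=
  Measure.sum fun r => ENNReal.ofReal (pmf b d m n r) • Measure.dirac r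

/-- The joint distribution of the `m` registers, which are independent and identically
distributed. -/
def sketchLaw (b : ℝ) (d m : ℕ) (n : ℝ) : Measure (Fin m → Register d) :=
  Measure.pi fun _ => registerLaw b d m n

/-- The log-likelihood of the distinct count `n`, given the registers `r`. -/
def logLikelihood (b : ℝ) (d m : ℕ) (r : Fin m → Register d) (n : ℝ) : ℝ :=
  ∑ i, Real.log (pmf b d m n (r i))

/-- `x` is a maximum-likelihood estimate of the distinct count, given the registers `r`. -/
def IsMLEstimate (b : ℝ) (d m : ℕ) (r : Fin m → Register d) (x : ℝ) : Prop :=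
  0 < x ∧ ∀ y, 0 < y → logLikelihood b d m r y ≤ logLikelihood b d m r x

open Classical in
/-- The maximum-likelihood estimate of the distinct count (`0` if there is none). -/
def mlEstimate (b : ℝ) (d m : ℕ) (r : Fin m → Register d) : ℝ :=
  if h : ∃ x, IsMLEstimate b d m r x then h.choose else 0

/-- The bias of an estimator `T` of the distinct count, at the true distinct count `n`. -/
def bias (b : ℝ) (d m : ℕ) (n : ℝ) (T : (Fin m → Register d) → ℝ) : ℝ :=
  (∫ r, T r ∂(sketchLaw b d m n)) - n

/-- The random variable `- ∂² ln L / ∂n²`. -/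
def observedInformation (b : ℝ) (d m : ℕ) (n : ℝ) (r : Fin m → Register d) : ℝ :=
  -iteratedDeriv 2 (logLikelihood b d m r) n

/-- The random variable `(1/2) ∂³ ln L / ∂n³ + (∂² ln L / ∂n²) (∂ ln L / ∂n)`. -/
def biasIntegrand (b : ℝ) (d m : ℕ) (n : ℝ) (r : Fin m → Register d) : ℝ :=
  1 / 2 * iteratedDeriv 3 (logLikelihood b d m r) n +
    iteratedDeriv 2 (logLikelihood b d m r) n * deriv (logLikelihood b d m r) n

/-- The Fisher information `I = E (- ∂² ln L / ∂n²)`. -/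
def fisher (b : ℝ) (d m : ℕ) (n : ℝ) : ℝ :=
  ∫ r, observedInformation b d m n r ∂(sketchLaw b d m n)

/-- The expectation `J = E ((1/2) ∂³ ln L / ∂n³ + (∂² ln L / ∂n²) (∂ ln L / ∂n))`. -/
def biasExpectation (b : ℝ) (d m : ℕ) (n : ℝ) : ℝ :=
  ∫ r, biasIntegrand b d m n r ∂(sketchLaw b d m n)

/-- The Cox–Snell expression `J / I²` for the first-order bias of the maximum-likelihood
estimate. -/
def firstOrderBias (b : ℝ) (d m : ℕ) (n : ℝ) : ℝ :=
  1 / fisher b d m n ^ 2 * biasExpectation b d m n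

/-- The Hurwitz zeta function `ζ(s, a) = ∑ (k + a) ^ (-s)`, for real `s > 1` and `a > 0`. -/
def hurwitzZeta (s a : ℝ) : ℝ := ∑' k : ℕ, ((k : ℝ) + a) ^ (-s)

/-- The parameter `b ^ (-d) / (b - 1)`. -/
def tau (b : ℝ) (d : ℕ) : ℝ := (b ^ d)⁻¹ / (b - 1)

/-- `(ln b) (1 + 2 b ^ (-d) / (b - 1)) ζ(3, 1 + b ^ (-d) / (b - 1)) /
ζ(2, 1 + b ^ (-d) / (b - 1))²`. -/
def biasConstant (b : ℝ) (d : ℕ) : ℝ :=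
  Real.log b * (1 + 2 * tau b d) * (hurwitzZeta 3 (1 + tau b d) / hurwitzZeta 2 (1 + tau b d) ^ 2)

/-- The approximation `(n / m) (ln b) (1 + …) ζ(3, …) / ζ(2, …)²` of the first-order bias. -/
def approxBias (b : ℝ) (d m : ℕ) (n : ℝ) : ℝ := n / m * biasConstant b d

/-- The bias-corrected maximum-likelihood estimator. -/
def correctedEstimate (b : ℝ) (d m : ℕ) (r : Fin m → Register d) : ℝ :=
  mlEstimate b d m r * (1 + 1 / m * biasConstant b d)⁻¹

end ULL

end

open MeasureTheory

noncomputable section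

namespace ULL

/-! Put `c = n (b - 1) / m`. A register sees `n` only through the levels `y = c / b ^ k`, and every
expectation becomes a sum over this geometric lattice. With `E y = exp (-y / (b - 1))`, the maximum
update value has mass `rho b y = E y - E (b * y)`, so total mass one, the centering of the score and
the information identity are all telescoping sums. Given the maximum, the bits are independent with
centered scores.

Exact formulas for `I` and `J`. Shifting the index for each bit moves its contribution to the level
of the maximum, and the weights of the `d` bits telescope (`hasSum_levels`). What remains is `E (b ^
(-d) * y) = exp (-τ y)`, the probability that no update lies above the recorded window; this is the
origin of `τ`. It follows that `n ^ 2 * I = m * L₂` and `n ^ 3 * J = m * (1 / 2 + τ) * L₃`, where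
`L_p` is the lattice sum of `y ^ p * exp (-τ y) / (exp y - 1)` (`integral_score_sq`,
`integral_updStat_curv`, `integral_third_order`).

Existence, uniqueness and bias of the estimate. The score is a decreasing function of `n` minus a
positive linear one, so it has exactly one zero. The same structure bounds the relative error `δ` of
the estimate by the score divided by the mean `A` of the linear coefficients. A Taylor expansion of
the score at its zero gives a perturbed quadratic equation for `δ`, hence `δ = S / i + T S / i² + κ
S² / (2 i³)` plus a cubic remainder (`quadratic_expansion`). Here `i = L₂`, `S` is the mean score,
`T` is `i` minus the mean observed information, and `κ` is the expected third-order statistic. The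
mean of the main part is exactly `J / I² / n`. The remainder is `O(m ^ (-3/2))` in expectation,
because the centered means have uniform exponential moments and `1 / A` has a bounded eighth moment
for `m ≥ 16` (`integral_exp_abs_sum_le`, `integral_inv_mean_pow_le`). All constants are uniform in
`n` since lattice sums are invariant under `c ↦ b c`.

The approximation. In the variable `log_b n` the sum `L_p` is a periodization. By Poisson summation
its Fourier coefficients are values of the Mellin transform `Γ(s) ζ(s, 1 + τ)` at `s = p + 2 π i r /
log b`, divided by `log b`. The coefficient `r = 0` is the mean. For the others `|ζ(s, a)| ≤ ζ(p,
a)`, while `|Γ|` is tiny at height at least `2 π / log 2 > 9`. The relative error is therefore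
uniform in `d`, `m`, `n` (`abs_latticeSum_sub_le`, `abs_firstOrderBias_sub_le`). -/

/-! ### Sums over geometric lattices -/

/-- A function that is of order `√y` at zero and of order `1 / √y` at infinity. -/
def damp (y : ℝ) : ℝ := √y / (1 + y)

theorem damp_nonneg {y : ℝ} (hy : 0 < y) : 0 ≤ damp y := by unfold damp; positivity

theorem damp_le_sqrt {y : ℝ} (hy : 0 < y) : damp y ≤ √y := by
  unfold damp
  exact div_le_self (Real.sqrt_nonneg _) (by linarith)

theorem damp_le_inv_sqrt {y : ℝ} (hy : 0 < y) : damp y ≤ (√y)⁻¹ := by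
  have h : 0 < √y := Real.sqrt_pos.2 hy
  unfold damp
  rw [div_le_iff₀ (by positivity), inv_mul_eq_div, le_div_iff₀ h, Real.mul_self_sqrt hy.le]
  linarith

theorem min_le_two_mul_damp {y : ℝ} (hy : 0 < y) : min (√y) (√y)⁻¹ ≤ 2 * damp y := by
  have h : 0 < √y := Real.sqrt_pos.2 hy
  unfold damp
  rcases le_total y 1 with h1 | h1
  · refine (min_le_left _ _).trans ?_
    rw [← mul_div_assoc, le_div_iff₀ (by positivity)]
    nlinarith
  · refine (min_le_right _ _).trans ?_
    rw [← mul_div_assoc, le_div_iff₀ (by positivity), inv_mul_eq_div, div_le_iff₀ h, mul_assoc,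
      Real.mul_self_sqrt hy.le]
    linarith

theorem summable_pow_natAbs {β : ℝ} (h0 : 0 ≤ β) (h1 : β < 1) :
    Summable fun k : ℤ => β ^ k.natAbs := by
  apply Summable.of_nat_of_neg
  · simpa using summable_geometric_of_lt_one h0 h1
  · simpa using summable_geometric_of_lt_one h0 h1

theorem sqrt_pow {b : ℝ} (hb : 0 ≤ b) (n : ℕ) : √(b ^ n) = √b ^ n := by
  rw [← Real.sqrt_sq (pow_nonneg (Real.sqrt_nonneg b) n), ← pow_mul, mul_comm n 2, pow_mul,
    Real.sq_sqrt hb]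

theorem damp_zpow_le {b : ℝ} (hb : 1 < b) {y : ℝ} (h1 : 1 ≤ y) (h2 : y < b) (k : ℤ) :
    damp (y / b ^ k) ≤ √b * (√b)⁻¹ ^ k.natAbs := by
  have hb0 : 0 < b := by linarith
  have hy : 0 < y := by linarith
  have hs : 1 ≤ √b := Real.one_le_sqrt.2 hb.le
  rcases Int.eq_nat_or_neg k with ⟨n, rfl | rfl⟩
  · refine (damp_le_sqrt (by positivity)).trans ?_
    rw [Real.sqrt_div hy.le, zpow_natCast, sqrt_pow hb0.le, Int.natAbs_natCast, inv_pow,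
      div_eq_mul_inv]
    gcongr
  · refine (damp_le_inv_sqrt (by positivity)).trans ?_
    rw [zpow_neg, zpow_natCast, div_inv_eq_mul, Real.sqrt_mul hy.le, Int.natAbs_neg,
      Int.natAbs_natCast, inv_pow, mul_inv, sqrt_pow hb0.le]
    gcongr
    exact (inv_le_one_of_one_le₀ (Real.one_le_sqrt.2 h1)).trans hs

theorem exists_lattice_shift {b : ℝ} (hb : 1 < b) {c : ℝ} (hc : 0 < c) :
    ∃ k₀ : ℤ, ∃ y, 1 ≤ y ∧ y < b ∧ ∀ k : ℤ, c / b ^ (k + k₀) = y / b ^ k := by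
  obtain ⟨k₀, h1, h2⟩ := exists_mem_Ico_zpow hc hb
  have hb0 : 0 < b := by linarith
  refine ⟨k₀, c / b ^ k₀, (one_le_div (by positivity)).2 h1, ?_, fun k => ?_⟩
  · rw [div_lt_iff₀ (by positivity), ← zpow_one_add₀ hb0.ne', add_comm]; exact h2
  · rw [zpow_add₀ hb0.ne', div_div, mul_comm]

/-- Scaling by `b` permutes the lattice, so `c` may be moved into `[1, b)`, where one two-sided
geometric series dominates. That `K` is independent of `c` is the source of all uniformity in `n`.
-/
theorem exists_tsum_damp_le {b : ℝ} (hb : 1 < b) : ∃ K, 0 < K ∧ ∀ c, 0 < c →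
    (Summable fun k : ℤ => damp (c / b ^ k)) ∧ ∑' k : ℤ, damp (c / b ^ k) ≤ K := by
  have hs : 1 < √b := by rw [Real.lt_sqrt (by norm_num)]; simpa using hb
  have hsum := (summable_pow_natAbs (β := (√b)⁻¹) (by positivity)
    (inv_lt_one_of_one_lt₀ hs)).mul_left (√b)
  refine ⟨∑' k : ℤ, √b * (√b)⁻¹ ^ k.natAbs, ?_, fun c hc => ?_⟩
  · exact hsum.tsum_pos (fun k => by positivity) 0 (by positivity)
  obtain ⟨k₀, y, h1, h2, h3⟩ := exists_lattice_shift hb hc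
  have hle := fun k => damp_zpow_le hb h1 h2 k
  have hy : Summable fun k : ℤ => damp (y / b ^ k) :=
    Summable.of_nonneg_of_le (fun k => damp_nonneg (by positivity)) hle hsum
  have e : (fun k : ℤ => damp (y / b ^ k)) =
      (fun k : ℤ => damp (c / b ^ k)) ∘ (Equiv.addRight k₀) := by
    funext k; simp [h3]
  have hy' := hy
  rw [e, Equiv.summable_iff] at hy
  refine ⟨hy, ?_⟩
  rw [← Equiv.tsum_eq (Equiv.addRight k₀)]
  simp only [Equiv.coe_addRight, h3]
  exact Summable.tsum_le_tsum hle hy' hsum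

theorem summable_lattice {b : ℝ} (hb : 1 < b) {F : ℝ → ℝ} {C : ℝ}
    (hF : ∀ y, 0 < y → |F y| ≤ C * damp y) {c : ℝ} (hc : 0 < c) :
    Summable fun k : ℤ => F (c / b ^ k) := by
  obtain ⟨K, -, hK⟩ := exists_tsum_damp_le hb
  exact Summable.of_norm_bounded ((hK c hc).1.mul_left C) fun k => hF _ (by positivity)

theorem exists_tsum_lattice_le {b : ℝ} (hb : 1 < b) {F : ℝ → ℝ} {C : ℝ}
    (hF : ∀ y, 0 < y → |F y| ≤ C * damp y) : ∃ K, 0 < K ∧ ∀ c, 0 < c →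
      |∑' k : ℤ, F (c / b ^ k)| ≤ K := by
  obtain ⟨K, hK0, hK⟩ := exists_tsum_damp_le hb
  refine ⟨|C| * K + 1, by positivity, fun c hc => ?_⟩
  have h1 : ‖∑' k : ℤ, F (c / b ^ k)‖ ≤ ∑' k : ℤ, C * damp (c / b ^ k) :=
    tsum_of_norm_bounded ((hK c hc).1.mul_left C).hasSum fun k => hF _ (by positivity)
  rw [tsum_mul_left] at h1
  have h2 : C * ∑' k : ℤ, damp (c / b ^ k) ≤ |C| * K :=
    (mul_le_mul_of_nonneg_right (le_abs_self C)
      (tsum_nonneg fun k => damp_nonneg (by positivity))).trans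
      (mul_le_mul_of_nonneg_left (hK c hc).2 (abs_nonneg _))
  exact (h1.trans h2).trans (by linarith)

/-- The reindexing behind both the telescoping of expectations and the periodicity in `log_b n`. No
summability is needed, since it is a bijection of the index set. -/
theorem tsum_lattice_shift {b : ℝ} (hb : 1 < b) (F : ℝ → ℝ) (c : ℝ) (j : ℤ) :
    ∑' k : ℤ, F (b ^ j * (c / b ^ k)) = ∑' k : ℤ, F (c / b ^ k) := by
  have hb0 : b ≠ 0 := by positivity
  rw [← Equiv.tsum_eq (Equiv.subRight j) fun k : ℤ => F (c / b ^ k)]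
  congr 1; funext k
  simp only [Equiv.subRight_apply, zpow_sub₀ hb0]
  congr 1; field_simp

theorem summable_lattice_shift {b : ℝ} (hb : 1 < b) {F : ℝ → ℝ} {c : ℝ}
    (h : Summable fun k : ℤ => F (c / b ^ k)) (j : ℤ) :
    Summable fun k : ℤ => F (b ^ j * (c / b ^ k)) := by
  have hb0 : b ≠ 0 := by positivity
  rw [← (Equiv.subRight j).summable_iff] at h
  convert h using 2 with k
  simp only [Function.comp, Equiv.subRight_apply, zpow_sub₀ hb0]
  congr 1; field_simp

/-! ### The Bose function -/

/-- `1 / (e ^ y - 1)`. -/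
def bose (y : ℝ) : ℝ := (Real.exp y - 1)⁻¹

theorem exp_sub_one_pos {y : ℝ} (hy : 0 < y) : 0 < Real.exp y - 1 := by
  linarith [Real.add_one_lt_exp hy.ne']

theorem bose_pos {y : ℝ} (hy : 0 < y) : 0 < bose y := inv_pos.2 (exp_sub_one_pos hy)

/-- The exponential series contains the term `y ^ p / p!`, so `exp y - 1` is at least this term. -/
theorem pow_mul_bose_le {y : ℝ} (hy : 0 < y) {p : ℕ} (hp : 1 ≤ p) :
    y ^ p * bose y ≤ p.factorial := by
  unfold bose
  rw [← div_eq_mul_inv, div_le_iff₀ (exp_sub_one_pos hy)]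
  have h := Real.sum_le_exp_of_nonneg hy.le (p + 1)
  rw [Finset.sum_range_succ, Finset.sum_range_eq_add_Ico _ (by omega)] at h
  have h2 : 0 ≤ ∑ i ∈ Finset.Ico 1 p, y ^ i / (i.factorial : ℝ) :=
    Finset.sum_nonneg fun i _ => by positivity
  have h3 : y ^ p / (p.factorial : ℝ) ≤ Real.exp y - 1 := by simp at h; linarith
  rw [div_le_iff₀ (by positivity)] at h3
  linarith

theorem mul_bose_le {y : ℝ} (hy : 0 < y) : y * bose y ≤ 1 := by
  simpa using pow_mul_bose_le hy (p := 1) le_rfl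

theorem hasDerivAt_bose {y : ℝ} (hy : 0 < y) : HasDerivAt bose (-(bose y + bose y ^ 2)) y := by
  have h := ((Real.hasDerivAt_exp y).sub_const 1).inv (exp_sub_one_pos hy).ne'
  refine h.congr_deriv ?_
  have := (exp_sub_one_pos hy).ne'
  unfold bose
  field_simp; ring

theorem one_sub_exp_neg_pos {y : ℝ} (hy : 0 < y) : 0 < 1 - Real.exp (-y) := by
  rw [sub_pos, Real.exp_lt_one_iff]; linarith

theorem one_sub_exp_neg_mul_bose {y : ℝ} (hy : 0 < y) :
    (1 - Real.exp (-y)) * bose y = Real.exp (-y) := by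
  have h := (exp_sub_one_pos hy).ne'
  unfold bose
  rw [Real.exp_neg]
  have := (Real.exp_pos y).ne'
  field_simp

theorem hasDerivAt_log_one_sub_exp_neg {y : ℝ} (hy : 0 < y) :
    HasDerivAt (fun y => Real.log (1 - Real.exp (-y))) (bose y) y := by
  have h := (((hasDerivAt_neg y).exp).const_sub 1).log (one_sub_exp_neg_pos hy).ne'
  refine h.congr_deriv ?_
  rw [div_eq_iff (one_sub_exp_neg_pos hy).ne', mul_comm (bose y), one_sub_exp_neg_mul_bose hy]
  ring

/-- `y / (e ^ y - 1)` is decreasing. -/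
theorem mul_bose_antitone {x y : ℝ} (hx : 0 < x) (hxy : x ≤ y) : y * bose y ≤ x * bose x := by
  have hy : 0 < y := hx.trans_le hxy
  unfold bose
  rw [← div_eq_mul_inv, ← div_eq_mul_inv,
    div_le_div_iff₀ (exp_sub_one_pos hy) (exp_sub_one_pos hx)]
  -- Convexity: the chord of `exp` over `[0, y]` lies above its value at `x`, so `(exp x - 1) / x`
  -- is at most `(exp y - 1) / y`.
  have h := convexOn_exp.2 (Set.mem_univ (0 : ℝ)) (Set.mem_univ y)
    (show 0 ≤ 1 - x / y by rw [sub_nonneg]; exact div_le_one_of_le₀ hxy hy.le)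
    (show 0 ≤ x / y by positivity) (by ring)
  simp only [smul_eq_mul, mul_zero, zero_add, Real.exp_zero, mul_one] at h
  rw [div_mul_cancel₀ _ hy.ne'] at h
  have h2 := mul_le_mul_of_nonneg_left h hy.le
  have e : y * (1 - x / y + x / y * Real.exp y) = y - x + x * Real.exp y := by
    field_simp
  rw [e] at h2
  linarith

/-- `- y² (log (1 - e ^ (-y)))''` -/
def curv (y : ℝ) : ℝ := y ^ 2 * (bose y + bose y ^ 2)

/-- `y³ (log (1 - e ^ (-y)))'''` -/
def curv₃ (y : ℝ) : ℝ := y ^ 3 * ((bose y + bose y ^ 2) * (1 + 2 * bose y))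

/-- `- y⁴ (log (1 - e ^ (-y)))''''` -/
def curv₄ (y : ℝ) : ℝ :=
  y ^ 4 * ((bose y + bose y ^ 2) * (1 + 2 * bose y) ^ 2 + 2 * (bose y + bose y ^ 2) ^ 2)

theorem curv_nonneg {y : ℝ} (hy : 0 < y) : 0 ≤ curv y := by
  have := bose_pos hy
  unfold curv; positivity

theorem curv₃_nonneg {y : ℝ} (hy : 0 < y) : 0 ≤ curv₃ y := by
  have := bose_pos hy
  unfold curv₃; positivity

theorem curv₄_nonneg {y : ℝ} (hy : 0 < y) : 0 ≤ curv₄ y := by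
  have := bose_pos hy
  unfold curv₄; positivity

theorem curv_le {y : ℝ} (hy : 0 < y) : curv y ≤ 3 := by
  have h0 : 0 ≤ y * bose y := mul_nonneg hy.le (bose_pos hy).le
  have h1 := mul_bose_le hy
  have h2 := pow_mul_bose_le hy (p := 2) (by norm_num)
  have e : curv y = y ^ 2 * bose y + (y * bose y) ^ 2 := by unfold curv; ring
  have := pow_le_one₀ h0 h1 (n := 2)
  norm_num [Nat.factorial] at h2
  linarith

/-- Expanded in powers of `bose y`, the functions `curv₃` and `curv₄` are combinations of such
products. The bounds follow by adding factorials: `6 + 3 * 2 + 2 * 1 = 14` and `24 + 7 * 6 + 12 * 2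
+ 6 * 1 = 96`. -/
theorem pow_mul_bose_mul_le {y : ℝ} (hy : 0 < y) {p : ℕ} (hp : 1 ≤ p) (q : ℕ) :
    y ^ p * bose y * (y * bose y) ^ q ≤ p.factorial := by
  have h0 : 0 ≤ y * bose y := mul_nonneg hy.le (bose_pos hy).le
  have hb := (bose_pos hy).le
  calc _ ≤ y ^ p * bose y * 1 := by
        gcongr
        exact pow_le_one₀ h0 (mul_bose_le hy)
    _ ≤ _ := by rw [mul_one]; exact pow_mul_bose_le hy hp

theorem curv₃_le {y : ℝ} (hy : 0 < y) : curv₃ y ≤ 14 := by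
  have h3 := pow_mul_bose_mul_le hy (p := 3) (by norm_num) 0
  have h2 := pow_mul_bose_mul_le hy (p := 2) (by norm_num) 1
  have h1 := pow_mul_bose_mul_le hy (p := 1) (by norm_num) 2
  norm_num [Nat.factorial] at h1 h2 h3
  have e : curv₃ y = y ^ 3 * bose y + 3 * (y ^ 2 * bose y * (y * bose y)) +
    2 * (y * bose y * (y * bose y) ^ 2) := by unfold curv₃; ring
  linarith

theorem curv₄_le {y : ℝ} (hy : 0 < y) : curv₄ y ≤ 100 := by
  have h4 := pow_mul_bose_mul_le hy (p := 4) (by norm_num) 0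
  have h3 := pow_mul_bose_mul_le hy (p := 3) (by norm_num) 1
  have h2 := pow_mul_bose_mul_le hy (p := 2) (by norm_num) 2
  have h1 := pow_mul_bose_mul_le hy (p := 1) (by norm_num) 3
  norm_num [Nat.factorial] at h1 h2 h3 h4
  have e : curv₄ y = y ^ 4 * bose y + 7 * (y ^ 3 * bose y * (y * bose y)) +
    12 * (y ^ 2 * bose y * (y * bose y) ^ 2) + 6 * (y * bose y * (y * bose y) ^ 3) := by
    unfold curv₄; ring
  linarith

theorem hasDerivAt_mul_bose {y : ℝ} (hy : 0 < y) :
    HasDerivAt (fun y => y * bose y) ((-curv y + y * bose y) / y) y := by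
  refine ((hasDerivAt_id y).mul (hasDerivAt_bose hy)).congr_deriv ?_
  unfold curv; simp; field_simp; ring

/-- For `f y = y ^ p * g y` one has `y * f' = y ^ (p + 1) * g' + p * f`; the derivatives are written
in this shape to fit `hasDerivAt_stat`. -/
theorem hasDerivAt_curv {y : ℝ} (hy : 0 < y) :
    HasDerivAt curv ((-curv₃ y + 2 * curv y) / y) y := by
  have hB := hasDerivAt_bose hy
  refine (((hasDerivAt_id y).pow 2).mul (hB.add (hB.pow 2))).congr_deriv ?_
  unfold curv curv₃; simp; field_simp; ring

theorem hasDerivAt_curv₃ {y : ℝ} (hy : 0 < y) :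
    HasDerivAt curv₃ ((-curv₄ y + 3 * curv₃ y) / y) y := by
  have hB := hasDerivAt_bose hy
  refine (((hasDerivAt_id y).pow 3).mul
    ((hB.add (hB.pow 2)).mul ((hB.const_mul 2).const_add 1))).congr_deriv ?_
  unfold curv₃ curv₄; simp; field_simp; ring

/-! ### Damped functions -/

/-- A function on the positive half-line that is dominated by a multiple of `damp`. -/
def IsDamped (F : ℝ → ℝ) : Prop := ∃ C, ∀ y, 0 < y → |F y| ≤ C * damp y

theorem IsDamped.summable {b : ℝ} (hb : 1 < b) {F : ℝ → ℝ} (hF : IsDamped F) {c : ℝ} (hc : 0 < c) :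
    Summable fun k : ℤ => F (c / b ^ k) :=
  hF.elim fun _ h => summable_lattice hb h hc

theorem IsDamped.exists_tsum_le {b : ℝ} (hb : 1 < b) {F : ℝ → ℝ} (hF : IsDamped F) :
    ∃ K, 0 < K ∧ ∀ c, 0 < c → |∑' k : ℤ, F (c / b ^ k)| ≤ K :=
  hF.elim fun _ h => exists_tsum_lattice_le hb h

theorem IsDamped.mono {F G : ℝ → ℝ} (hG : IsDamped G) (C : ℝ) (hC : 0 ≤ C)
    (h : ∀ y, 0 < y → |F y| ≤ C * |G y|) : IsDamped F := by
  obtain ⟨D, hD⟩ := hG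
  refine ⟨C * D, fun y hy => (h y hy).trans ?_⟩
  rw [mul_assoc]
  exact mul_le_mul_of_nonneg_left (hD y hy) hC

theorem IsDamped.add {F G : ℝ → ℝ} (hF : IsDamped F) (hG : IsDamped G) :
    IsDamped fun y => F y + G y := by
  obtain ⟨C, hC⟩ := hF
  obtain ⟨D, hD⟩ := hG
  refine ⟨C + D, fun y hy => (abs_add_le _ _).trans ?_⟩
  rw [add_mul]
  exact add_le_add (hC y hy) (hD y hy)

theorem IsDamped.mul_bdd {F T : ℝ → ℝ} (hF : IsDamped F) {C : ℝ} (hC : 0 ≤ C)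
    (hT : ∀ y, 0 < y → |T y| ≤ C) : IsDamped fun y => F y * T y := by
  refine hF.mono C hC fun y hy => ?_
  rw [abs_mul, mul_comm]
  exact mul_le_mul_of_nonneg_right (hT y hy) (abs_nonneg _)

theorem one_add_pow_le_exp {κ : ℝ} (hκ : 0 < κ) (N : ℕ) {y : ℝ} (hy : 0 ≤ y) :
    (1 + y) ^ N * Real.exp (-(κ * y)) ≤ N.factorial / κ ^ N * Real.exp κ := by
  have h := Real.pow_div_factorial_le_exp (κ * (1 + y)) (by positivity) N
  rw [div_le_iff₀ (by positivity), mul_pow] at h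
  have e : Real.exp (κ * (1 + y)) = Real.exp κ * Real.exp (κ * y) := by
    rw [← Real.exp_add]; ring_nf
  rw [Real.exp_neg, ← div_eq_mul_inv, div_le_iff₀ (Real.exp_pos _), div_mul_eq_mul_div,
    div_mul_eq_mul_div, le_div_iff₀ (by positivity)]
  rw [e] at h
  linarith

theorem isDamped_of_le_exp {F : ℝ → ℝ} {C κ : ℝ} (hκ : 0 < κ) (hC : 0 ≤ C) (N : ℕ)
    (h : ∀ y, 0 < y → |F y| ≤ C * (y * (1 + y) ^ N * Real.exp (-(κ * y)))) : IsDamped F := by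
  refine ⟨C * ((N + 2).factorial / κ ^ (N + 2) * Real.exp κ), fun y hy => (h y hy).trans ?_⟩
  rw [mul_assoc C]
  refine mul_le_mul_of_nonneg_left ?_ hC
  have h1 := one_add_pow_le_exp hκ (N + 2) hy.le
  have hs : 0 < √y := Real.sqrt_pos.2 hy
  have h2 : √y ≤ 1 + y := by
    rw [Real.sqrt_le_left (by positivity)]; nlinarith
  unfold damp
  rw [← mul_div_assoc, le_div_iff₀ (by positivity)]
  calc _ = (√y * √y) * ((1 + y) ^ (N + 1) * Real.exp (-(κ * y))) := by
        rw [Real.mul_self_sqrt hy.le]; ring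
    _ ≤ (√y * (1 + y)) * ((1 + y) ^ (N + 1) * Real.exp (-(κ * y))) := by gcongr
    _ = ((1 + y) ^ (N + 2) * Real.exp (-(κ * y))) * √y := by ring
    _ ≤ _ := by gcongr

/-- Damping makes both halves separately summable, and they agree after a shift by one level. -/
theorem tsum_lattice_telescope {b : ℝ} (hb : 1 < b) {K : ℝ → ℝ} (hK : IsDamped K) {c : ℝ}
    (hc : 0 < c) : ∑' k : ℤ, (K (c / b ^ k) - K (b * (c / b ^ k))) = 0 := by
  have h1 := hK.summable hb hc
  have h2 := summable_lattice_shift hb h1 1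
  have h3 := tsum_lattice_shift hb K c 1
  simp only [zpow_one] at h2 h3
  rw [h1.tsum_sub h2, h3, sub_self]

theorem sum_fin_telescope {b : ℝ} (hb : 1 < b) (d : ℕ) (K : ℝ → ℝ) (y : ℝ) :
    ∑ j : Fin d, (K (b ^ (-((j : ℤ) + 1)) * y) - K (b * (b ^ (-((j : ℤ) + 1)) * y))) =
      K (b ^ (-(d : ℤ)) * y) - K y := by
  have hb0 : b ≠ 0 := by positivity
  have h : ∀ j : ℕ, K (b ^ (-((j : ℤ) + 1)) * y) - K (b * (b ^ (-((j : ℤ) + 1)) * y)) =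
      K (b ^ (-((j + 1 : ℕ) : ℤ)) * y) - K (b ^ (-(j : ℤ)) * y) := by
    intro j
    rw [← mul_assoc b, ← zpow_one_add₀ hb0]
    push_cast
    congr 4; ring
  simp only [h]
  rw [Fin.sum_univ_eq_sum_range
    (fun j => K (b ^ (-((j + 1 : ℕ) : ℤ)) * y) - K (b ^ (-(j : ℤ)) * y)) d,
    Finset.sum_range_sub (fun j : ℕ => K (b ^ (-(j : ℤ)) * y))]
  simp

/-- Bit `j` is observed `j + 1` levels away from the maximum. Shifting the summation index by `j +
1` evaluates every `T` at the same level, and the weights then telescope over `j`. Only the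
difference `K y - K (b * y)` needs to be damped: in the main application `K = E` tends to `1` at
zero and is not summable itself. -/
theorem hasSum_levels {b : ℝ} (hb : 1 < b) (d : ℕ) {K A T : ℝ → ℝ} (hA : IsDamped A)
    (hR : IsDamped fun y => K y - K (b * y)) {C : ℝ} (hC : 0 ≤ C) (hT : ∀ y, 0 < y → |T y| ≤ C)
    {c : ℝ} (hc : 0 < c) :
    HasSum (fun k : ℤ => A (c / b ^ k) + ∑ j : Fin d, (K (c / b ^ k) - K (b * (c / b ^ k))) *
      T (c / b ^ (k - ((j : ℤ) + 1))))
    (∑' k : ℤ, (A (c / b ^ k) + (K (b ^ (-(d : ℤ)) * (c / b ^ k)) - K (c / b ^ k)) *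
      T (c / b ^ k))) ∧
    Summable fun k : ℤ => A (c / b ^ k) + (K (b ^ (-(d : ℤ)) * (c / b ^ k)) - K (c / b ^ k)) *
      T (c / b ^ k) := by
  have hb0 : b ≠ 0 := by positivity
  have e : ∀ (k : ℤ) (j : Fin d), c / b ^ (k - ((j : ℤ) + 1)) =
      b ^ ((j : ℤ) + 1) * (c / b ^ k) := by
    intro k j; rw [zpow_sub₀ hb0]; field_simp
  have hs1 : ∀ j : Fin d, Summable fun k : ℤ =>
      (K (c / b ^ k) - K (b * (c / b ^ k))) * T (b ^ ((j : ℤ) + 1) * (c / b ^ k)) := fun j =>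
    (hR.mul_bdd (T := fun y => T (b ^ ((j : ℤ) + 1) * y)) hC
      (fun y hy => hT _ (by positivity))).summable hb hc
  have hs2 : ∀ j : Fin d, Summable fun k : ℤ =>
      (K (b ^ (-((j : ℤ) + 1)) * (c / b ^ k)) - K (b * (b ^ (-((j : ℤ) + 1)) * (c / b ^ k)))) *
        T (c / b ^ k) := by
    intro j
    have := summable_lattice_shift hb (F := fun y => (K y - K (b * y)) *
      T (b ^ ((j : ℤ) + 1) * y)) (hs1 j) (-((j : ℤ) + 1))
    refine this.congr fun k => ?_
    congr 2
    rw [← mul_assoc, ← zpow_add₀ hb0]; simp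
  have hj : ∀ j : Fin d, ∑' k : ℤ,
      (K (c / b ^ k) - K (b * (c / b ^ k))) * T (b ^ ((j : ℤ) + 1) * (c / b ^ k)) =
      ∑' k : ℤ, (K (b ^ (-((j : ℤ) + 1)) * (c / b ^ k)) -
        K (b * (b ^ (-((j : ℤ) + 1)) * (c / b ^ k)))) * T (c / b ^ k) := by
    intro j
    rw [← tsum_lattice_shift hb (fun y => (K y - K (b * y)) * T (b ^ ((j : ℤ) + 1) * y)) c
      (-((j : ℤ) + 1))]
    refine tsum_congr fun k => ?_
    congr 2
    rw [← mul_assoc (b ^ ((j : ℤ) + 1)), ← zpow_add₀ hb0]; simp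
  simp only [e]
  have hs0 := hA.summable hb hc
  have hr : ∀ k : ℤ, A (c / b ^ k) + (K (b ^ (-(d : ℤ)) * (c / b ^ k)) - K (c / b ^ k)) *
      T (c / b ^ k) = A (c / b ^ k) + ∑ j : Fin d, (K (b ^ (-((j : ℤ) + 1)) * (c / b ^ k)) -
        K (b * (b ^ (-((j : ℤ) + 1)) * (c / b ^ k)))) * T (c / b ^ k) := by
    intro k
    rw [← Finset.sum_mul, sum_fin_telescope hb]
  simp only [hr]
  refine ⟨?_, hs0.add (summable_sum fun j _ => hs2 j)⟩
  rw [hs0.tsum_add (summable_sum fun j _ => hs2 j), Summable.tsum_finsetSum fun j _ => hs2 j,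
    ← Finset.sum_congr rfl fun j _ => hj j, ← Summable.tsum_finsetSum fun j _ => hs1 j,
    ← hs0.tsum_add (summable_sum fun j _ => hs1 j)]
  exact (hs0.add (summable_sum fun j _ => hs1 j)).hasSum

/-! ### Expectations over the indicator bits -/

/-- The probability of a bit `l` at level `y`. -/
def bitWeight (y : ℝ) (l : Bool) : ℝ := if l then 1 - Real.exp (-y) else Real.exp (-y)

/-- The expectation of a function of a bit at level `y`. -/
def bitMean (y : ℝ) (u : Bool → ℝ) : ℝ := (1 - Real.exp (-y)) * u true + Real.exp (-y) * u false

/-- The expectation of a function of independent bits. -/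
def bitsMean {d : ℕ} (y : Fin d → ℝ) (g : (Fin d → Bool) → ℝ) : ℝ :=
  ∑ l, (∏ j, bitWeight (y j) (l j)) * g l

theorem bitWeight_nonneg {y : ℝ} (hy : 0 < y) (l : Bool) : 0 ≤ bitWeight y l := by
  unfold bitWeight
  split_ifs
  · exact (one_sub_exp_neg_pos hy).le
  · positivity

/-- Distributivity of products over sums, which is independence of the bits. The means of functions
of one or two bits follow by setting the other factors to `1`. -/
theorem bitsMean_prod {d : ℕ} (y : Fin d → ℝ) (u : Fin d → Bool → ℝ) :
    bitsMean y (fun l => ∏ j, u j (l j)) = ∏ j, bitMean (y j) (u j) := by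
  have h := Finset.prod_univ_sum (fun _ : Fin d => (Finset.univ : Finset Bool))
    (fun j l => bitWeight (y j) l * u j l)
  rw [Fintype.piFinset_univ] at h
  simp only [bitsMean, ← Finset.prod_mul_distrib]
  rw [← h]
  simp [bitMean, bitWeight]

theorem bitsMean_const {d : ℕ} (y : Fin d → ℝ) (a : ℝ) : bitsMean y (fun _ => a) = a := by
  have h := bitsMean_prod y (fun _ _ => 1)
  have e : ∀ j, bitMean (y j) (fun _ => 1) = 1 := fun j => by simp [bitMean]
  simp only [Finset.prod_const_one, e, bitsMean, mul_one] at h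
  simp [bitsMean, ← Finset.sum_mul, h]

theorem bitsMean_add {d : ℕ} (y : Fin d → ℝ) (g h : (Fin d → Bool) → ℝ) :
    bitsMean y (fun l => g l + h l) = bitsMean y g + bitsMean y h := by
  simp [bitsMean, mul_add, Finset.sum_add_distrib]

theorem bitsMean_const_mul {d : ℕ} (y : Fin d → ℝ) (a : ℝ) (g : (Fin d → Bool) → ℝ) :
    bitsMean y (fun l => a * g l) = a * bitsMean y g := by
  simp only [bitsMean, Finset.mul_sum]
  exact Finset.sum_congr rfl fun l _ => by ring

theorem bitsMean_sum {d : ℕ} {ι : Type*} (s : Finset ι) (y : Fin d → ℝ)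
    (g : ι → (Fin d → Bool) → ℝ) :
    bitsMean y (fun l => ∑ i ∈ s, g i l) = ∑ i ∈ s, bitsMean y (g i) := by
  simp only [bitsMean, Finset.mul_sum]
  exact Finset.sum_comm

theorem bitMean_one (y : ℝ) : bitMean y (fun _ => 1) = 1 := by simp [bitMean]

theorem bitsMean_single {d : ℕ} (y : Fin d → ℝ) (i : Fin d) (u : Bool → ℝ) :
    bitsMean y (fun l => u (l i)) = bitMean (y i) u := by
  have h := bitsMean_prod y (fun j l => if j = i then u l else 1)
  simp only [Finset.prod_ite_eq', Finset.mem_univ, if_true] at h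
  rw [h, Finset.prod_eq_single i]
  · simp
  · intro j _ hj; simp [hj, bitMean_one]
  · simp

theorem bitsMean_pair {d : ℕ} (y : Fin d → ℝ) {i j : Fin d} (hij : i ≠ j) (u v : Bool → ℝ) :
    bitsMean y (fun l => u (l i) * v (l j)) = bitMean (y i) u * bitMean (y j) v := by
  have h := bitsMean_prod y
    (fun k l => (if k = i then u l else 1) * (if k = j then v l else 1))
  simp only [Finset.prod_mul_distrib, Finset.prod_ite_eq', Finset.mem_univ, if_true] at h
  rw [h, ← Finset.mul_prod_erase _ _ (Finset.mem_univ i),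
    ← Finset.mul_prod_erase _ _ (Finset.mem_erase.2 ⟨hij.symm, Finset.mem_univ j⟩),
    Finset.prod_eq_one]
  · simp [hij, hij.symm]
  · intro k hk
    simp only [Finset.mem_erase, Finset.mem_univ, and_true] at hk
    simp [hk.1, hk.2, bitMean_one]

theorem bitsMean_affine {d : ℕ} (y : Fin d → ℝ) (a : ℝ) (u : Fin d → Bool → ℝ) :
    bitsMean y (fun l => a + ∑ j, u j (l j)) = a + ∑ j, bitMean (y j) (u j) := by
  rw [bitsMean_add, bitsMean_const, bitsMean_sum]
  simp only [bitsMean_single]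

/-- As the bit terms of the second factor are centered, they survive only against the term of the
same bit. -/
theorem bitsMean_mul {d : ℕ} (y : Fin d → ℝ) (a a' : ℝ) (u v : Fin d → Bool → ℝ)
    (hv : ∀ j, bitMean (y j) (v j) = 0) :
    bitsMean y (fun l => (a + ∑ j, u j (l j)) * (a' + ∑ j, v j (l j))) =
      (a + ∑ j, bitMean (y j) (u j)) * a' + ∑ j, bitMean (y j) (fun l => u j l * v j l) := by
  have e : (fun l : Fin d → Bool => (a + ∑ j, u j (l j)) * (a' + ∑ j, v j (l j))) =
      fun l => a' * (a + ∑ j, u j (l j)) + (a * ∑ j, v j (l j) +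
        ∑ i, ∑ j, u i (l i) * v j (l j)) := by
    funext l
    have := Finset.sum_mul_sum Finset.univ Finset.univ (fun i => u i (l i)) (fun j => v j (l j))
    rw [← this]; ring
  have hp : ∀ i j, bitsMean y (fun l => u i (l i) * v j (l j)) =
      if i = j then bitMean (y j) (fun l => u j l * v j l) else 0 := by
    intro i j
    split_ifs with h
    · subst h; exact bitsMean_single y i (fun l => u i l * v i l)
    · rw [bitsMean_pair y h, hv, mul_zero]
  rw [e, bitsMean_add, bitsMean_add, bitsMean_const_mul, bitsMean_const_mul, bitsMean_affine,
    bitsMean_sum, bitsMean_sum]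
  simp only [bitsMean_single, hv, bitsMean_sum, hp, Finset.sum_ite_eq, Finset.mem_univ, if_true]
  simp; ring

/-! ### The law of a register -/

/-- The scale of the levels of the registers. -/
def scale (b : ℝ) (m : ℕ) (n : ℝ) : ℝ := n * (b - 1) / m

theorem scale_pos {b : ℝ} (hb : 1 < b) {m : ℕ} (hm : 1 ≤ m) {n : ℝ} (hn : 0 < n) :
    0 < scale b m n := by
  have : 0 < b - 1 := by linarith
  have : (0 : ℝ) < m := by exact_mod_cast hm
  unfold scale; positivity

theorem z_eq (b : ℝ) (m : ℕ) (n : ℝ) (u : ℤ) : z b m n u = Real.exp (-(scale b m n / b ^ u)) := by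
  rw [z, scale, div_div]

/-- The probability mass of the maximum update value at level `y`. -/
def rho (b y : ℝ) : ℝ := Real.exp (-(y / (b - 1))) * (1 - Real.exp (-y))

theorem rho_pos {b y : ℝ} (hy : 0 < y) : 0 < rho b y :=
  mul_pos (Real.exp_pos _) (one_sub_exp_neg_pos hy)

/-- Because `y / (b - 1) + y = b * y / (b - 1)`, the mass is the difference of the distribution
function of the maximum at consecutive levels. -/
theorem rho_eq {b : ℝ} (hb : 1 < b) (y : ℝ) :
    rho b y = Real.exp (-(y / (b - 1))) - Real.exp (-(b * y / (b - 1))) := by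
  have : b - 1 ≠ 0 := by linarith
  rw [rho, mul_sub, mul_one, ← Real.exp_add]
  congr 2
  field_simp; ring

theorem rho_le {b : ℝ} {y : ℝ} : rho b y ≤ y * Real.exp (-((b - 1)⁻¹ * y)) := by
  rw [rho, mul_comm, ← div_eq_inv_mul]
  have := Real.add_one_le_exp (-y)
  gcongr
  linarith

/-- The levels of the indicator bits. -/
def level (b : ℝ) (d : ℕ) (c : ℝ) (k : ℤ) (j : Fin d) : ℝ := c / b ^ (k - ((j : ℤ) + 1))

theorem pmf_eq (b : ℝ) (d m : ℕ) (n : ℝ) (k : ℤ) (l : Fin d → Bool) :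
    pmf b d m n (k, l) = rho b (scale b m n / b ^ k) *
      ∏ j, bitWeight (level b d (scale b m n) k j) (l j) := by
  simp only [pmf, z_eq, rho, ← Real.exp_mul, bitWeight, level]
  congr 3
  ring

theorem level_pos {b : ℝ} (hb : 1 < b) (d : ℕ) {c : ℝ} (hc : 0 < c) (k : ℤ) (j : Fin d) :
    0 < level b d c k j := by unfold level; positivity

theorem pmf_nonneg {b : ℝ} (hb : 1 < b) (d : ℕ) {m : ℕ} (hm : 1 ≤ m) {n : ℝ} (hn : 0 < n)
    (r : Register d) : 0 ≤ pmf b d m n r := by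
  obtain ⟨k, l⟩ := r
  have := scale_pos hb hm hn
  rw [pmf_eq]
  exact mul_nonneg (rho_pos (by positivity)).le
    (Finset.prod_nonneg fun j _ => bitWeight_nonneg (level_pos hb d this k j) _)

theorem integrable_registerLaw {b : ℝ} (hb : 1 < b) (d : ℕ) {m : ℕ} (hm : 1 ≤ m) {n : ℝ}
    (hn : 0 < n) {f : Register d → ℝ} (hf : Summable fun r => pmf b d m n r * f r) :
    Integrable f (registerLaw b d m n) ∧
      ∫ r, f r ∂(registerLaw b d m n) = ∑' r, pmf b d m n r * f r := by
  have hp := pmf_nonneg hb d hm hn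
  have hmass : ∀ r, registerLaw b d m n {r} = ENNReal.ofReal (pmf b d m n r) := by
    intro r
    rw [registerLaw, Measure.sum_apply _ (measurableSet_singleton r), tsum_eq_single r]
    · simp
    · intro r' hr'; simp [hr']
  have hi : Integrable f (registerLaw b d m n) := by
    refine ⟨(measurable_of_countable f).aestronglyMeasurable, ?_⟩
    rw [HasFiniteIntegral, lintegral_countable']
    have e : ∀ r, ‖f r‖ₑ * registerLaw b d m n {r} = ENNReal.ofReal ‖pmf b d m n r * f r‖ := by
      intro r
      rw [hmass, norm_mul, Real.norm_of_nonneg (hp r), ENNReal.ofReal_mul (hp r), ofReal_norm,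
        mul_comm]
    simp only [e]
    exact hf.norm.tsum_ofReal_lt_top
  refine ⟨hi, ?_⟩
  rw [integral_countable hi]
  refine tsum_congr fun r => ?_
  rw [measureReal_def, hmass, ENNReal.toReal_ofReal (hp r), smul_eq_mul]

/-- The majorant depends on the maximum level only, so the finitely many bit patterns integrate out
and integrability reduces to a lattice sum. -/
theorem integral_registerLaw {b : ℝ} (hb : 1 < b) (d : ℕ) {m : ℕ} (hm : 1 ≤ m) {n : ℝ}
    (hn : 0 < n) {f : Register d → ℝ} {G : ℝ → ℝ} (hG : IsDamped fun y => rho b y * G y)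
    (hf : ∀ r, |f r| ≤ G (scale b m n / b ^ r.1)) :
    Integrable f (registerLaw b d m n) ∧
      ∫ r, f r ∂(registerLaw b d m n) = ∑' k : ℤ, rho b (scale b m n / b ^ k) *
        bitsMean (level b d (scale b m n) k) (fun l => f (k, l)) := by
  have hc := scale_pos hb hm hn
  have hp := pmf_nonneg hb d hm hn
  have hG0 : ∀ r : Register d, 0 ≤ G (scale b m n / b ^ r.1) :=
    fun r => (abs_nonneg _).trans (hf r)
  have h1 : Summable fun r : Register d => pmf b d m n r * G (scale b m n / b ^ r.1) := by
    rw [summable_prod_of_nonneg fun r => mul_nonneg (hp r) (hG0 r)]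
    refine ⟨fun k => Summable.of_finite, (hG.summable hb hc).congr fun k => ?_⟩
    have := bitsMean_const (level b d (scale b m n) k)
      (rho b (scale b m n / b ^ k) * G (scale b m n / b ^ k))
    rw [← this, tsum_fintype]
    simp only [bitsMean, pmf_eq]
    exact Finset.sum_congr rfl fun l _ => by ring
  have h2 : Summable fun r : Register d => pmf b d m n r * f r := by
    refine Summable.of_norm_bounded h1 fun r => ?_
    rw [norm_mul, Real.norm_of_nonneg (hp r)]
    exact mul_le_mul_of_nonneg_left (hf r) (hp r)
  obtain ⟨hi, he⟩ := integrable_registerLaw hb d hm hn h2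
  refine ⟨hi, ?_⟩
  rw [he, h2.tsum_prod]
  refine tsum_congr fun k => ?_
  rw [tsum_fintype, bitsMean, Finset.mul_sum]
  exact Finset.sum_congr rfl fun l _ => by rw [pmf_eq]; ring

theorem isDamped_rho_mul_pow {b : ℝ} (hb : 1 < b) {C : ℝ} (hC : 0 ≤ C) (N : ℕ) :
    IsDamped fun y => rho b y * (C * (1 + y) ^ N) := by
  refine isDamped_of_le_exp (κ := (b - 1)⁻¹) (by simpa using hb) hC N fun y hy => ?_
  have h1 := (rho_pos (b := b) hy).le
  rw [abs_of_nonneg (by positivity)]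
  have h2 := mul_le_mul_of_nonneg_right (rho_le (b := b) (y := y))
    (show 0 ≤ C * (1 + y) ^ N by positivity)
  linarith

/-- Here `E` itself is not damped, so `tsum_lattice_telescope` does not apply; the limits `1` at
`+∞` and `0` at `-∞` supply the value. -/
theorem tsum_rho {b : ℝ} (hb : 1 < b) {c : ℝ} (hc : 0 < c) :
    ∑' k : ℤ, rho b (c / b ^ k) = 1 := by
  have hb0 : 0 < b := by linarith
  have ha : 0 < b - 1 := by linarith
  have hs : Summable fun k : ℤ => rho b (c / b ^ k) := by
    simpa using (isDamped_rho_mul_pow hb zero_le_one 0).summable hb hc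
  set E : ℤ → ℝ := fun k => Real.exp (-(c / b ^ k / (b - 1))) with hE
  have he : ∀ k, rho b (c / b ^ k) = E k - E (k - 1) := by
    intro k
    rw [rho_eq hb, hE]
    simp only [zpow_sub_one₀ hb0.ne']
    congr 4
    field_simp
  have hpow : Filter.Tendsto (fun N : ℕ => b ^ N) Filter.atTop Filter.atTop :=
    tendsto_pow_atTop_atTop_of_one_lt hb
  have hT : Filter.Tendsto (fun N : ℕ => E N) Filter.atTop (nhds 1) := by
    rw [← Real.exp_zero]
    refine (Real.continuous_exp.tendsto _).comp ?_
    have := ((hpow.const_div_atTop c).div_const (b - 1)).neg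
    simpa using this
  have hB : Filter.Tendsto (fun N : ℕ => E (-(N : ℤ))) Filter.atTop (nhds 0) := by
    refine Real.tendsto_exp_atBot.comp (Filter.tendsto_neg_atTop_atBot.comp ?_)
    refine Filter.Tendsto.atTop_div_const ha ?_
    refine (hpow.const_mul_atTop hc).congr fun N => ?_
    simp
  have h1 : Summable fun N : ℕ => rho b (c / b ^ ((N : ℤ) + 1)) :=
    hs.comp_injective (i := fun N : ℕ => (N : ℤ) + 1) fun x y h => by simpa using h
  have h2 : Summable fun N : ℕ => rho b (c / b ^ (-(N : ℤ))) :=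
    hs.comp_injective (i := fun N : ℕ => -(N : ℤ)) fun x y h => by simpa using h
  have s1 : HasSum (fun N : ℕ => rho b (c / b ^ ((N : ℤ) + 1))) (1 - E 0) := by
    rw [h1.hasSum_iff_tendsto_nat]
    refine (hT.sub_const (E 0)).congr fun N => ?_
    simp only [he, add_sub_cancel_right]
    simpa using (Finset.sum_range_sub (fun i : ℕ => E i) N).symm
  have s2 : HasSum (fun N : ℕ => rho b (c / b ^ (-(N : ℤ)))) (E 0 - 0) := by
    rw [h2.hasSum_iff_tendsto_nat]
    refine (hB.const_sub (E 0)).congr fun N => ?_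
    simp only [he]
    have := Finset.sum_range_sub' (fun i : ℕ => E (-(i : ℤ))) N
    push_cast at this
    simp only [neg_add, ← sub_eq_add_neg] at this
    simpa using this.symm
  have s1' : HasSum (fun N : ℕ => rho b (c / b ^ (-(-((N : ℤ) + 1))))) (1 - E 0) := by
    simpa only [neg_neg] using s1
  have := HasSum.of_nat_of_neg_add_one (f := fun k : ℤ => rho b (c / b ^ (-k))) s2 s1'
  have e2 := (Equiv.neg ℤ).tsum_eq fun k : ℤ => rho b (c / b ^ k)
  simp only [Equiv.neg_apply] at e2
  rw [← e2, this.tsum_eq]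
  ring

theorem isProbabilityMeasure_registerLaw {b : ℝ} (hb : 1 < b) (d : ℕ) {m : ℕ} (hm : 1 ≤ m) {n : ℝ}
    (hn : 0 < n) : IsProbabilityMeasure (registerLaw b d m n) := by
  have h := integral_registerLaw hb d hm hn (f := fun _ => 1) (G := fun y => 1 * (1 + y) ^ 0)
    (isDamped_rho_mul_pow hb zero_le_one 0) (by simp)
  have h2 := h.2
  simp only [bitsMean_const, mul_one, tsum_rho hb (scale_pos hb hm hn)] at h2
  have hfin : IsFiniteMeasure (registerLaw b d m n) := by
    have := h.1
    rw [integrable_const_iff] at this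
    simpa using this
  rw [integral_const, smul_eq_mul, mul_one, measureReal_def] at h2
  exact ⟨by rwa [← ENNReal.toReal_eq_one_iff]⟩

/-! ### Additive statistics of a register -/

/-- The statistic of a register that adds `f₀` of the level of the maximum update value and, for
every indicator bit, `f₁` or `f₂` of its level. -/
def stat (b : ℝ) (d : ℕ) (f₀ f₁ f₂ : ℝ → ℝ) (c : ℝ) (r : Register d) : ℝ :=
  f₀ (c / b ^ r.1) + ∑ j, if r.2 j then f₁ (level b d c r.1 j) else f₂ (level b d c r.1 j)

/-- The statistic that adds `f` of the levels with an update. -/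
def updStat (b : ℝ) (d : ℕ) (f : ℝ → ℝ) (c : ℝ) (r : Register d) : ℝ :=
  stat b d f f (fun _ => 0) c r

/-- The score of a register, with respect to the logarithm of the distinct count. -/
def score (b : ℝ) (d : ℕ) (c : ℝ) (r : Register d) : ℝ :=
  stat b d (fun y => -(y / (b - 1)) + y * bose y) (fun y => y * bose y) (fun y => -y) c r

theorem level_eq {b : ℝ} (hb : 1 < b) (d : ℕ) (c : ℝ) (k : ℤ) (j : Fin d) :
    level b d c k j = b ^ ((j : ℕ) + 1) * (c / b ^ k) := by
  have hb0 : b ≠ 0 := by positivity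
  rw [level, zpow_sub₀ hb0]
  norm_cast
  field_simp

theorem level_le {b : ℝ} (hb : 1 < b) (d : ℕ) {c : ℝ} (hc : 0 < c) (k : ℤ) (j : Fin d) :
    level b d c k j ≤ b ^ d * (c / b ^ k) := by
  rw [level_eq hb]
  gcongr
  · exact hb.le
  · exact j.2

theorem abs_stat_le {b : ℝ} (hb : 1 < b) (d : ℕ) {f₀ f₁ f₂ : ℝ → ℝ} {C : ℝ} (N : ℕ)
    (hC : 0 ≤ C) (h₀ : ∀ y, 0 < y → |f₀ y| ≤ C * (1 + y) ^ N)
    (h₁ : ∀ y, 0 < y → |f₁ y| ≤ C * (1 + y) ^ N) (h₂ : ∀ y, 0 < y → |f₂ y| ≤ C * (1 + y) ^ N)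
    {c : ℝ} (hc : 0 < c) (r : Register d) :
    |stat b d f₀ f₁ f₂ c r| ≤ C * (1 + d) * (b ^ d) ^ N * (1 + c / b ^ r.1) ^ N := by
  have hy : 0 < c / b ^ r.1 := by positivity
  have hbd : 1 ≤ b ^ d := one_le_pow₀ hb.le
  have key : ∀ y, 0 < y → y ≤ b ^ d * (c / b ^ r.1) →
      C * (1 + y) ^ N ≤ C * (b ^ d) ^ N * (1 + c / b ^ r.1) ^ N := by
    intro y hy0 hy1
    rw [mul_assoc, ← mul_pow]
    gcongr
    nlinarith
  have h3 : |∑ j, if r.2 j then f₁ (level b d c r.1 j) else f₂ (level b d c r.1 j)| ≤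
      ∑ _j : Fin d, C * (b ^ d) ^ N * (1 + c / b ^ r.1) ^ N := by
    refine (Finset.abs_sum_le_sum_abs _ _).trans (Finset.sum_le_sum fun j _ => ?_)
    have hl := level_pos hb d hc r.1 j
    have hk := key _ hl (level_le hb d hc r.1 j)
    split_ifs
    · exact (h₁ _ hl).trans hk
    · exact (h₂ _ hl).trans hk
  have h4 := (h₀ _ hy).trans (key _ hy (le_mul_of_one_le_left hy.le hbd))
  simp only [Finset.sum_const, Finset.card_univ, Fintype.card_fin, nsmul_eq_mul] at h3
  refine (abs_add_le _ _).trans ((add_le_add h4 h3).trans_eq ?_)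
  ring

theorem abs_updStat_le {b : ℝ} (hb : 1 < b) (d : ℕ) {f : ℝ → ℝ} {C : ℝ}
    (hC : 0 ≤ C) (hf : ∀ y, 0 < y → |f y| ≤ C) {c : ℝ} (hc : 0 < c) (r : Register d) :
    |updStat b d f c r| ≤ C * (1 + d) := by
  simpa [updStat] using abs_stat_le hb d 0 hC (by simpa using hf) (by simpa using hf)
    (f₂ := fun _ => 0) (by simpa using fun _ _ => hC) hc r

theorem exists_abs_score_le {b : ℝ} (hb : 1 < b) (d : ℕ) : ∃ C, 0 < C ∧ ∀ c, 0 < c →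
    ∀ r : Register d, |score b d c r| ≤ C * (1 + c / b ^ r.1) := by
  have ha : 0 < b - 1 := by linarith
  have hi : 0 < (b - 1)⁻¹ := by positivity
  refine ⟨(1 + (b - 1)⁻¹) * (1 + d) * (b ^ d) ^ 1, by positivity, fun c hc r => ?_⟩
  rw [← pow_one (1 + c / b ^ r.1)]
  have hB : ∀ y, 0 < y → |y * bose y| ≤ 1 := fun y hy => by
    rw [abs_of_nonneg (mul_nonneg hy.le (bose_pos hy).le)]; exact mul_bose_le hy
  refine abs_stat_le hb d 1 (by positivity) (fun y hy => ?_) (fun y hy => ?_) (fun y hy => ?_) hc r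
  · refine (abs_add_le _ _).trans ?_
    have h1 := hB y hy
    rw [abs_neg, abs_of_nonneg (by positivity), div_eq_mul_inv]
    nlinarith
  · refine (hB y hy).trans ?_
    nlinarith [mul_pos hi hy]
  · rw [abs_neg, abs_of_pos hy]
    nlinarith [mul_pos hi hy]

theorem bitsMean_stat (b : ℝ) (d : ℕ) (f₀ f₁ f₂ : ℝ → ℝ) (c : ℝ) (k : ℤ) :
    bitsMean (level b d c k) (fun l => stat b d f₀ f₁ f₂ c (k, l)) = f₀ (c / b ^ k) +
      ∑ j, ((1 - Real.exp (-level b d c k j)) * f₁ (level b d c k j) +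
        Real.exp (-level b d c k j) * f₂ (level b d c k j)) := by
  have := bitsMean_affine (level b d c k) (f₀ (c / b ^ k))
    (fun j l => if l then f₁ (level b d c k j) else f₂ (level b d c k j))
  simpa [stat, bitMean] using this

theorem score_bit_mean {y : ℝ} (hy : 0 < y) :
    (1 - Real.exp (-y)) * (y * bose y) + Real.exp (-y) * -y = 0 := by
  have := one_sub_exp_neg_mul_bose hy
  linear_combination y * this

/-- The score of a bit is centered, so a bit term correlates with its own score only. That
covariance simplifies because `(1 - exp (-y)) * bose y = exp (-y)`. -/
theorem bitsMean_stat_mul_score {b : ℝ} (hb : 1 < b) (d : ℕ) (f₀ f₁ f₂ : ℝ → ℝ) {c : ℝ}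
    (hc : 0 < c) (k : ℤ) :
    bitsMean (level b d c k) (fun l => stat b d f₀ f₁ f₂ c (k, l) * score b d c (k, l)) =
      (f₀ (c / b ^ k) + ∑ j, ((1 - Real.exp (-level b d c k j)) * f₁ (level b d c k j) +
        Real.exp (-level b d c k j) * f₂ (level b d c k j))) *
          (-(c / b ^ k / (b - 1)) + c / b ^ k * bose (c / b ^ k)) +
      ∑ j, Real.exp (-level b d c k j) * level b d c k j *
        (f₁ (level b d c k j) - f₂ (level b d c k j)) := by
  have := bitsMean_mul (level b d c k) (f₀ (c / b ^ k))
    (-(c / b ^ k / (b - 1)) + c / b ^ k * bose (c / b ^ k))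
    (fun j l => if l then f₁ (level b d c k j) else f₂ (level b d c k j))
    (fun j l => if l then level b d c k j * bose (level b d c k j) else -level b d c k j)
    (fun j => by simpa [bitMean] using score_bit_mean (level_pos hb d hc k j))
  refine Eq.trans ?_ (this.trans ?_)
  · rfl
  · congr 1
    refine Finset.sum_congr rfl fun j _ => ?_
    have h := one_sub_exp_neg_mul_bose (level_pos hb d hc k j)
    simp only [bitMean, if_true, Bool.false_eq_true, if_false]
    linear_combination (level b d c k j * f₁ (level b d c k j)) * h

/-! ### Expectations of additive statistics: score, information and third-order term -/

theorem exp_level_eq (b : ℝ) (d : ℕ) (y : ℝ) :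
    b ^ (-(d : ℤ)) * y / (b - 1) = tau b d * y := by
  rw [tau, zpow_neg, zpow_natCast]; ring

/-- The weights of the maximum and of the `d` bits merge: `rho b y = E y * (1 - exp (-y))` cancels
the subtracted `E y`. -/
theorem rho_add_eq (b : ℝ) (d : ℕ) (y t : ℝ) :
    rho b y * t + (Real.exp (-(b ^ (-(d : ℤ)) * y / (b - 1))) - Real.exp (-(y / (b - 1)))) *
      ((1 - Real.exp (-y)) * t) = Real.exp (-(tau b d * y)) * (1 - Real.exp (-y)) * t := by
  rw [exp_level_eq, rho]; ring

theorem isDamped_rho {b : ℝ} (hb : 1 < b) : IsDamped (rho b) := by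
  simpa using isDamped_rho_mul_pow hb zero_le_one 0

theorem isDamped_rho_diff {b : ℝ} (hb : 1 < b) :
    IsDamped fun y => Real.exp (-(y / (b - 1))) - Real.exp (-(b * y / (b - 1))) := by
  simpa only [← rho_eq hb] using isDamped_rho hb

theorem abs_one_sub_exp_neg_le {y : ℝ} (hy : 0 < y) : |1 - Real.exp (-y)| ≤ 1 := by
  rw [abs_of_pos (one_sub_exp_neg_pos hy)]
  linarith [Real.exp_pos (-y)]

theorem tsum_rho_updates {b : ℝ} (hb : 1 < b) (d : ℕ) {f₀ T : ℝ → ℝ} {C : ℝ}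
    (hC : 0 ≤ C) (hf : IsDamped fun y => rho b y * f₀ y)
    (hT : ∀ y, 0 < y → |T y| ≤ C) {c : ℝ} (hc : 0 < c) :
    ∑' k : ℤ, rho b (c / b ^ k) * (f₀ (c / b ^ k) + ∑ j, T (level b d c k j)) =
      ∑' k : ℤ, (rho b (c / b ^ k) * f₀ (c / b ^ k) +
        (Real.exp (-(b ^ (-(d : ℤ)) * (c / b ^ k) / (b - 1))) -
          Real.exp (-(c / b ^ k / (b - 1)))) * T (c / b ^ k)) := by
  rw [← (hasSum_levels hb d (K := fun y => Real.exp (-(y / (b - 1)))) hf (isDamped_rho_diff hb) hC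
    hT hc).1.tsum_eq]
  refine tsum_congr fun k => ?_
  rw [mul_add, Finset.mul_sum]
  simp only [rho_eq hb, level]

/-- The weight is the probability that a level is recorded as updated: there is an update with this
value (`1 - exp (-y)`) and none more than `d` values higher (`exp (-τ y)`). -/
theorem integral_updStat {b : ℝ} (hb : 1 < b) (d : ℕ) {m : ℕ} (hm : 1 ≤ m) {n : ℝ}
    (hn : 0 < n) {f : ℝ → ℝ} {C : ℝ} (hC : 0 ≤ C) (hf : ∀ y, 0 < y → |f y| ≤ C) :
    Integrable (updStat b d f (scale b m n)) (registerLaw b d m n) ∧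
      ∫ r, updStat b d f (scale b m n) r ∂(registerLaw b d m n) =
        ∑' k : ℤ, Real.exp (-(tau b d * (scale b m n / b ^ k))) *
          (1 - Real.exp (-(scale b m n / b ^ k))) * f (scale b m n / b ^ k) := by
  have hc := scale_pos hb hm hn
  have h := integral_registerLaw hb d hm hn (f := updStat b d f (scale b m n))
    (G := fun y => C * (1 + d) * (1 + y) ^ 0) (isDamped_rho_mul_pow hb (by positivity) 0)
    (fun r => by simpa using abs_updStat_le hb d hC hf hc r)
  refine ⟨h.1, h.2.trans ?_⟩
  simp only [updStat, bitsMean_stat, mul_zero, add_zero]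
  rw [tsum_rho_updates hb d (T := fun y => (1 - Real.exp (-y)) * f y) hC
    ((isDamped_rho hb).mul_bdd hC hf) (fun y hy => ?_) hc]
  · exact tsum_congr fun k => rho_add_eq b d _ _
  · rw [abs_mul]
    exact (mul_le_mul (abs_one_sub_exp_neg_le hy) (hf y hy) (abs_nonneg _) zero_le_one).trans_eq
      (one_mul C)

theorem isDamped_mul_exp {κ : ℝ} (hκ : 0 < κ) (C : ℝ) :
    IsDamped fun y => C * (y * Real.exp (-(κ * y))) := by
  refine isDamped_of_le_exp (C := |C|) hκ (abs_nonneg C) 0 fun y hy => ?_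
  rw [abs_mul, abs_of_nonneg (a := y * _) (by positivity)]
  simp

/-- `rho` times the score of the maximum update value telescopes. -/
theorem rho_mul_score_eq {b : ℝ} (hb : 1 < b) {y : ℝ} (hy : 0 < y) :
    rho b y * (-(y / (b - 1)) + y * bose y) =
      -(b - 1)⁻¹ * (y * Real.exp (-((b - 1)⁻¹ * y))) -
        -(b - 1)⁻¹ * ((b * y) * Real.exp (-((b - 1)⁻¹ * (b * y)))) := by
  have ha : b - 1 ≠ 0 := by linarith
  have h := one_sub_exp_neg_mul_bose hy
  have e : Real.exp (-((b - 1)⁻¹ * (b * y))) =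
      Real.exp (-((b - 1)⁻¹ * y)) * Real.exp (-y) := by
    rw [← Real.exp_add]; congr 1; field_simp; ring
  have e2 : (b - 1)⁻¹ * b = 1 + (b - 1)⁻¹ := by field_simp; ring
  rw [rho, e, div_eq_inv_mul]
  linear_combination (Real.exp (-((b - 1)⁻¹ * y)) * y) * h -
    (y * Real.exp (-((b - 1)⁻¹ * y)) * Real.exp (-y)) * e2

theorem isDamped_rho_mul_score {b : ℝ} (hb : 1 < b) :
    IsDamped fun y => rho b y * (-(y / (b - 1)) + y * bose y) := by
  have hi : 0 < (b - 1)⁻¹ := by simpa using hb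
  refine (isDamped_rho_mul_pow hb (C := 1 + (b - 1)⁻¹) (by positivity) 1).mono 1 zero_le_one
    fun y hy => ?_
  rw [one_mul, abs_mul, abs_mul (rho b y)]
  refine mul_le_mul_of_nonneg_left ?_ (abs_nonneg _)
  refine ((abs_add_le _ _).trans ?_).trans (le_abs_self _)
  have h1 := mul_bose_le hy
  have h2 : 0 ≤ y * bose y := mul_nonneg hy.le (bose_pos hy).le
  have ha : 0 < b - 1 := by linarith
  rw [abs_neg, abs_of_nonneg (by positivity), abs_of_nonneg h2, div_eq_mul_inv]
  nlinarith

/-- The bits contribute zero. For the maximum, `rho` times its score is `y * rho'`, which telescopes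
with the kernel `y * E'`. -/
theorem integral_score {b : ℝ} (hb : 1 < b) (d : ℕ) {m : ℕ} (hm : 1 ≤ m) {n : ℝ}
    (hn : 0 < n) :
    Integrable (score b d (scale b m n)) (registerLaw b d m n) ∧
      ∫ r, score b d (scale b m n) r ∂(registerLaw b d m n) = 0 := by
  have hc := scale_pos hb hm hn
  have hi : 0 < (b - 1)⁻¹ := by simpa using hb
  obtain ⟨C, hC, hs⟩ := exists_abs_score_le hb d
  have h := integral_registerLaw hb d hm hn (f := score b d (scale b m n))
    (G := fun y => C * (1 + y) ^ 1) (isDamped_rho_mul_pow hb hC.le 1)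
    (fun r => by simpa using hs _ hc r)
  refine ⟨h.1, h.2.trans ?_⟩
  rw [← tsum_lattice_telescope hb (isDamped_mul_exp hi (-(b - 1)⁻¹)) hc]
  refine tsum_congr fun k => ?_
  have hy : 0 < scale b m n / b ^ k := by positivity
  rw [← rho_mul_score_eq hb hy]
  simp only [score, bitsMean_stat, score_bit_mean (level_pos hb d hc k _), Finset.sum_const_zero,
    add_zero]

theorem exp_mul_curv {y : ℝ} (hy : 0 < y) : Real.exp (-y) * y * (y * bose y - -y) =
    (1 - Real.exp (-y)) * curv y := by
  have h := one_sub_exp_neg_mul_bose hy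
  unfold curv
  linear_combination (-(1 + bose y) * y ^ 2) * h

/-- `rho` times the second-order score of the maximum update value telescopes. -/
theorem rho_mul_score_sq_eq {b : ℝ} (hb : 1 < b) {y : ℝ} (hy : 0 < y) :
    rho b y * (-(y / (b - 1)) + y * bose y) ^ 2 - rho b y * curv y =
      ((b - 1)⁻¹ * y) ^ 2 * Real.exp (-((b - 1)⁻¹ * y)) -
        ((b - 1)⁻¹ * (b * y)) ^ 2 * Real.exp (-((b - 1)⁻¹ * (b * y))) := by
  have ha : b - 1 ≠ 0 := by linarith
  have h := one_sub_exp_neg_mul_bose hy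
  have e : Real.exp (-((b - 1)⁻¹ * (b * y))) =
      Real.exp (-((b - 1)⁻¹ * y)) * Real.exp (-y) := by
    rw [← Real.exp_add]; congr 1; field_simp; ring
  have e2 : (b - 1)⁻¹ * b = 1 + (b - 1)⁻¹ := by field_simp; ring
  rw [rho, e, div_eq_inv_mul, ← mul_assoc ((b - 1)⁻¹) b y, e2, curv]
  linear_combination
    (Real.exp (-((b - 1)⁻¹ * y)) * y ^ 2 * (-1 - 2 * (b - 1)⁻¹)) * h

theorem tau_pos {b : ℝ} (hb : 1 < b) (d : ℕ) : 0 < tau b d := by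
  have : 0 < b - 1 := by linarith
  unfold tau; positivity

theorem mul_bose_le_exp {y : ℝ} (hy : 0 < y) : y * bose y ≤ (1 + y) * Real.exp (-y) := by
  have h := one_sub_exp_neg_mul_bose hy
  have h1 := one_sub_exp_neg_pos hy
  have h2 : y ≤ (1 + y) * (1 - Real.exp (-y)) := by
    have h3 := Real.add_one_le_exp y
    have h4 : (1 + y) * Real.exp (-y) ≤ 1 := by
      rw [Real.exp_neg, ← div_eq_mul_inv, div_le_one (Real.exp_pos y)]; linarith
    linarith
  calc y * bose y ≤ ((1 + y) * (1 - Real.exp (-y))) * bose y := by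
        have := bose_pos hy
        gcongr
    _ = _ := by rw [mul_assoc, h]

theorem one_sub_exp_neg_mul_curv {y : ℝ} (hy : 0 < y) :
    (1 - Real.exp (-y)) * curv y = y ^ 2 * bose y := by
  have h := one_sub_exp_neg_mul_bose hy
  unfold curv
  linear_combination y ^ 2 * bose y * h

theorem one_sub_exp_neg_mul_curv₃ {y : ℝ} (hy : 0 < y) :
    (1 - Real.exp (-y)) * curv₃ y = y ^ 3 * bose y * (1 + 2 * bose y) := by
  have h := one_sub_exp_neg_mul_bose hy
  unfold curv₃
  linear_combination y ^ 3 * bose y * (1 + 2 * bose y) * h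

/-- The function `y ^ p * e ^ (-τ y) / (e ^ y - 1)`. -/
def kern (p : ℕ) (τ y : ℝ) : ℝ := y ^ p * bose y * Real.exp (-(τ * y))

theorem kern_pos (p : ℕ) (τ : ℝ) {y : ℝ} (hy : 0 < y) : 0 < kern p τ y := by
  have := bose_pos hy
  unfold kern; positivity

theorem kern_le {p : ℕ} (hp : 2 ≤ p) {τ : ℝ} (hτ : 0 ≤ τ) {y : ℝ} (hy : 0 < y) :
    kern p τ y ≤ y * (1 + y) ^ (p - 1) * Real.exp (-y) := by
  obtain ⟨q, rfl⟩ := Nat.exists_eq_add_of_le hp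
  have h1 : Real.exp (-(τ * y)) ≤ 1 := Real.exp_le_one_iff.2 (by nlinarith)
  have h2 := mul_bose_le_exp hy
  have hB := bose_pos hy
  have h3 : y ^ q ≤ (1 + y) ^ q := by gcongr; linarith
  calc kern (2 + q) τ y = y * y ^ q * (y * bose y) * Real.exp (-(τ * y)) := by unfold kern; ring
    _ ≤ y * (1 + y) ^ q * ((1 + y) * Real.exp (-y)) * 1 := by gcongr
    _ = _ := by rw [show 2 + q - 1 = q + 1 by omega]; ring

theorem isDamped_kern {p : ℕ} (hp : 2 ≤ p) {τ : ℝ} (hτ : 0 ≤ τ) : IsDamped (kern p τ) := by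
  refine isDamped_of_le_exp (C := 1) (κ := 1) one_pos zero_le_one (p - 1) fun y hy => ?_
  rw [abs_of_pos (kern_pos p τ hy), one_mul, one_mul]
  exact kern_le hp hτ hy

/-- The sum of `kern p τ` over the levels of a given scale. -/
def latticeSum (b : ℝ) (p : ℕ) (τ c : ℝ) : ℝ := ∑' k : ℤ, kern p τ (c / b ^ k)

theorem abs_curv_le {y : ℝ} (hy : 0 < y) : |curv y| ≤ 3 := by
  rw [abs_of_nonneg (curv_nonneg hy)]; exact curv_le hy

theorem abs_curv₃_le {y : ℝ} (hy : 0 < y) : |curv₃ y| ≤ 14 := by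
  rw [abs_of_nonneg (curv₃_nonneg hy)]; exact curv₃_le hy

theorem abs_curv₄_le {y : ℝ} (hy : 0 < y) : |curv₄ y| ≤ 100 := by
  rw [abs_of_nonneg (curv₄_nonneg hy)]; exact curv₄_le hy

theorem abs_one_sub_exp_neg_mul_curv_le {y : ℝ} (hy : 0 < y) :
    |(1 - Real.exp (-y)) * curv y| ≤ 3 := by
  rw [abs_mul]
  exact (mul_le_mul (abs_one_sub_exp_neg_le hy) (abs_curv_le hy) (abs_nonneg _)
    zero_le_one).trans_eq (one_mul _)

theorem integral_updStat_curv {b : ℝ} (hb : 1 < b) (d : ℕ) {m : ℕ} (hm : 1 ≤ m) {n : ℝ}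
    (hn : 0 < n) : ∫ r, updStat b d curv (scale b m n) r ∂(registerLaw b d m n) =
      latticeSum b 2 (tau b d) (scale b m n) := by
  have hc := scale_pos hb hm hn
  rw [(integral_updStat hb d hm hn (by norm_num) fun y hy => abs_curv_le hy).2]
  refine tsum_congr fun k => ?_
  have h := one_sub_exp_neg_mul_curv (show 0 < scale b m n / b ^ k by positivity)
  unfold kern
  rw [mul_assoc, h, mul_comm]

theorem isDamped_score_kernel {b : ℝ} (hb : 1 < b) :
    IsDamped fun y => -(b - 1)⁻¹ * (y * Real.exp (-((b - 1)⁻¹ * y))) :=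
  isDamped_mul_exp (by simpa using hb) _

theorem isDamped_rho_mul_score_sq {b : ℝ} (hb : 1 < b) :
    IsDamped fun y => rho b y * (-(y / (b - 1)) + y * bose y) ^ 2 := by
  have hi : 0 < (b - 1)⁻¹ := by simpa using hb
  have ha : 0 < b - 1 := by linarith
  refine (isDamped_rho_mul_pow hb (C := (1 + (b - 1)⁻¹) ^ 2) (by positivity) 2).mono 1 zero_le_one
    fun y hy => ?_
  rw [one_mul, abs_mul, abs_mul (rho b y), ← mul_pow, abs_of_nonneg (a := _ ^ 2) (sq_nonneg _),
    abs_of_nonneg (a := (_ * _) ^ 2) (sq_nonneg _)]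
  refine mul_le_mul_of_nonneg_left (sq_le_sq' ?_ ?_) (abs_nonneg _)
  all_goals
    have h1 := mul_bose_le hy
    have h2 : 0 ≤ y * bose y := mul_nonneg hy.le (bose_pos hy).le
    have h3 : 0 ≤ y * (b - 1)⁻¹ := by positivity
    rw [div_eq_mul_inv]
    nlinarith

/-- The information identity: the variance of the score equals the expected curvature. For a bit
this is `exp_mul_curv`. For the maximum the discrepancy is `y ^ 2 * rho''`, which telescopes with `K
= y ^ 2 * E''`. -/
theorem integral_score_sq {b : ℝ} (hb : 1 < b) (d : ℕ) {m : ℕ} (hm : 1 ≤ m) {n : ℝ}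
    (hn : 0 < n) :
    Integrable (fun r => score b d (scale b m n) r * score b d (scale b m n) r)
      (registerLaw b d m n) ∧
    ∫ r, score b d (scale b m n) r * score b d (scale b m n) r ∂(registerLaw b d m n) =
      latticeSum b 2 (tau b d) (scale b m n) := by
  have hc := scale_pos hb hm hn
  have hi : 0 < (b - 1)⁻¹ := by simpa using hb
  obtain ⟨C, hC, hs⟩ := exists_abs_score_le hb d
  have h := integral_registerLaw hb d hm hn
    (f := fun r => score b d (scale b m n) r * score b d (scale b m n) r)
    (G := fun y => C ^ 2 * (1 + y) ^ 2) (isDamped_rho_mul_pow hb (by positivity) 2)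
    (fun r => by
      rw [abs_mul, ← mul_pow, ← sq]
      exact pow_le_pow_left₀ (abs_nonneg _) (hs _ hc r) 2)
  refine ⟨h.1, h.2.trans ?_⟩
  set K : ℝ → ℝ := fun y => ((b - 1)⁻¹ * y) ^ 2 * Real.exp (-((b - 1)⁻¹ * y)) with hK
  have hKd : IsDamped K := by
    refine isDamped_of_le_exp (C := ((b - 1)⁻¹) ^ 2) hi (by positivity) 1 fun y hy => ?_
    simp only [hK]
    rw [abs_of_nonneg (by positivity), mul_pow, mul_assoc]
    gcongr
    nlinarith
  have e1 : ∀ k : ℤ, rho b (scale b m n / b ^ k) * bitsMean (level b d (scale b m n) k)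
      (fun l => score b d (scale b m n) (k, l) * score b d (scale b m n) (k, l)) =
      rho b (scale b m n / b ^ k) * ((fun y => (-(y / (b - 1)) + y * bose y) ^ 2)
        (scale b m n / b ^ k) + ∑ j, (fun y => (1 - Real.exp (-y)) * curv y)
          (level b d (scale b m n) k j)) := by
    intro k
    have := bitsMean_stat_mul_score hb d (fun y => -(y / (b - 1)) + y * bose y)
      (fun y => y * bose y) (fun y => -y) hc k
    simp only [score_bit_mean (level_pos hb d hc k _), Finset.sum_const_zero, add_zero,
      exp_mul_curv (level_pos hb d hc k _)] at this
    congr 1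
    simp only [sq]
    exact this
  rw [tsum_congr e1, tsum_rho_updates hb d (by norm_num) (isDamped_rho_mul_score_sq hb)
    (fun y hy => abs_one_sub_exp_neg_mul_curv_le hy) hc]
  have e2 : ∀ k : ℤ, (rho b (scale b m n / b ^ k) *
        (-(scale b m n / b ^ k / (b - 1)) + scale b m n / b ^ k * bose (scale b m n / b ^ k)) ^ 2 +
      (Real.exp (-(b ^ (-(d : ℤ)) * (scale b m n / b ^ k) / (b - 1))) -
        Real.exp (-(scale b m n / b ^ k / (b - 1)))) *
          ((1 - Real.exp (-(scale b m n / b ^ k))) * curv (scale b m n / b ^ k))) =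
      kern 2 (tau b d) (scale b m n / b ^ k) +
      (K (scale b m n / b ^ k) - K (b * (scale b m n / b ^ k))) := by
    intro k
    have hy : 0 < scale b m n / b ^ k := by positivity
    have h1 := rho_mul_score_sq_eq hb hy
    have h2 := rho_add_eq b d (scale b m n / b ^ k) (curv (scale b m n / b ^ k))
    have h3 := one_sub_exp_neg_mul_curv hy
    simp only [hK, kern]
    linear_combination h1 + h2 + Real.exp (-(tau b d * (scale b m n / b ^ k))) * h3
  have h1 := hKd.summable hb hc
  have h2 := summable_lattice_shift hb h1 1
  simp only [zpow_one] at h2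
  rw [tsum_congr e2, ((isDamped_kern le_rfl (tau_pos hb d).le).summable hb hc).tsum_add (h1.sub h2),
    tsum_lattice_telescope hb hKd hc, add_zero, latticeSum]

/-- The two sources of correlation are the score of the maximum, which meets every term of the
statistic, and the score of a bit, which meets only its own term. The factor `τ` appears when the
kernel `y * E'` is evaluated at `b ^ (-d) * y`. -/
theorem integral_updStat_mul_score {b : ℝ} (hb : 1 < b) (d : ℕ) {m : ℕ} (hm : 1 ≤ m) {n : ℝ}
    (hn : 0 < n) :
    Integrable (fun r => updStat b d curv (scale b m n) r * score b d (scale b m n) r)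
      (registerLaw b d m n) ∧
    ∫ r, updStat b d curv (scale b m n) r * score b d (scale b m n) r ∂(registerLaw b d m n) =
      ∑' k : ℤ, curv (scale b m n / b ^ k) * (scale b m n / b ^ k) *
        Real.exp (-(tau b d * (scale b m n / b ^ k))) * (Real.exp (-(scale b m n / b ^ k)) -
          tau b d * (1 - Real.exp (-(scale b m n / b ^ k)))) := by
  have hc := scale_pos hb hm hn
  obtain ⟨C, hC, hs⟩ := exists_abs_score_le hb d
  have h := integral_registerLaw hb d hm hn
    (f := fun r => updStat b d curv (scale b m n) r * score b d (scale b m n) r)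
    (G := fun y => (3 * (1 + d) * C) * (1 + y) ^ 1) (isDamped_rho_mul_pow hb (by positivity) 1)
    (fun r => by
      rw [abs_mul, pow_one, mul_assoc]
      exact mul_le_mul (abs_updStat_le hb d (by norm_num) (fun y hy => abs_curv_le hy) hc r)
        (hs _ hc r) (abs_nonneg _) (by positivity))
  refine ⟨h.1, h.2.trans ?_⟩
  have hKd := isDamped_score_kernel hb
  have hT2 : ∀ y, 0 < y → |Real.exp (-y) * y * curv y| ≤ 3 := fun y hy => by
    have h1 : Real.exp (-y) * y ≤ 1 := by
      rw [Real.exp_neg, inv_mul_eq_div, div_le_one (Real.exp_pos y)]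
      linarith [Real.add_one_le_exp y]
    rw [abs_mul, abs_of_nonneg (a := _ * y) (by positivity)]
    exact (mul_le_mul h1 (abs_curv_le hy) (abs_nonneg _) zero_le_one).trans_eq (one_mul _)
  have hR1 : IsDamped fun y => -(b - 1)⁻¹ * (y * Real.exp (-((b - 1)⁻¹ * y))) -
      -(b - 1)⁻¹ * ((b * y) * Real.exp (-((b - 1)⁻¹ * (b * y)))) := by
    refine (isDamped_rho_mul_score hb).mono 1 zero_le_one fun y hy => ?_
    rw [rho_mul_score_eq hb hy, one_mul]
  -- First the terms with the score of the maximum (kernel `y * E'`), then the terms of a bit with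
  -- its own score (kernel `E`).
  obtain ⟨g1, g2⟩ := hasSum_levels hb d
    (K := fun y => -(b - 1)⁻¹ * (y * Real.exp (-((b - 1)⁻¹ * y))))
    (A := fun y => rho b y * (-(y / (b - 1)) + y * bose y) * curv y)
    (T := fun y => (1 - Real.exp (-y)) * curv y)
    ((isDamped_rho_mul_score hb).mul_bdd (by norm_num) fun y hy => abs_curv_le hy) hR1
    (by norm_num) (fun y hy => abs_one_sub_exp_neg_mul_curv_le hy) hc
  obtain ⟨g3, g4⟩ := hasSum_levels hb d (A := fun _ => 0) (T := fun y => Real.exp (-y) * y * curv y)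
    (K := fun y => Real.exp (-(y / (b - 1)))) ⟨0, by simp⟩ (isDamped_rho_diff hb) (by norm_num)
    hT2 hc
  have g5 := (g1.add g3).tsum_eq
  rw [← g2.tsum_add g4] at g5
  refine Eq.trans (tsum_congr fun k => ?_) (g5.trans (tsum_congr fun k => ?_))
  · have hy : 0 < scale b m n / b ^ k := by positivity
    have := bitsMean_stat_mul_score hb d curv curv (fun _ => 0) hc k
    simp only [updStat]
    rw [this]
    simp only [mul_zero, add_zero, sub_zero, zero_add, ← rho_eq hb, ← rho_mul_score_eq hb hy]
    simp only [← Finset.mul_sum, level]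
    ring
  · have hy : 0 < scale b m n / b ^ k := by positivity
    generalize scale b m n / b ^ k = y at *
    have e1 : Real.exp (-((b - 1)⁻¹ * (b ^ (-(d : ℤ)) * y))) = Real.exp (-(tau b d * y)) := by
      rw [← exp_level_eq]; congr 1; ring
    have e2 : Real.exp (-(b ^ (-(d : ℤ)) * y / (b - 1))) = Real.exp (-(tau b d * y)) := by
      rw [← exp_level_eq]
    have e3 : (b - 1)⁻¹ * (b ^ (-(d : ℤ)) * y) = tau b d * y := by
      rw [← exp_level_eq]; ring
    have e4 : Real.exp (-((b - 1)⁻¹ * y)) = Real.exp (-(y / (b - 1))) := by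
      congr 1; ring
    have h := one_sub_exp_neg_mul_bose hy
    simp only [e1, e2, e4, rho]
    linear_combination (Real.exp (-(y / (b - 1))) * curv y * y) * h -
      (Real.exp (-(tau b d * y)) * (1 - Real.exp (-y)) * curv y) * e3

/-- Term by term: `(1 - exp (-y)) * curv₃ y = y³ (B + 2 B²)`, `y * exp (-y) * curv y = y³ B²` and `y
* (1 - exp (-y)) * curv y = y³ B` with `B = bose y`. The `B²` terms cancel and `(1 / 2 + τ) y³ B` is
left. -/
theorem integral_third_order {b : ℝ} (hb : 1 < b) (d : ℕ) {m : ℕ} (hm : 1 ≤ m) {n : ℝ}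
    (hn : 0 < n) :
    1 / 2 * ∫ r, updStat b d curv₃ (scale b m n) r ∂(registerLaw b d m n) -
      ∫ r, updStat b d curv (scale b m n) r * score b d (scale b m n) r ∂(registerLaw b d m n) =
        (1 / 2 + tau b d) * latticeSum b 3 (tau b d) (scale b m n) := by
  have hc := scale_pos hb hm hn
  have ht := (tau_pos hb d).le
  rw [(integral_updStat hb d hm hn (by norm_num) fun y hy => abs_curv₃_le hy).2,
    (integral_updStat_mul_score hb d hm hn).2, latticeSum, ← tsum_mul_left, ← tsum_mul_left]
  have s2 : IsDamped fun y => curv y * y * Real.exp (-(tau b d * y)) * (Real.exp (-y) -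
      tau b d * (1 - Real.exp (-y))) := by
    refine ((isDamped_kern (p := 2) le_rfl ht).add (isDamped_kern (p := 3) (by norm_num) ht)).mono
      (1 + tau b d) (by positivity) fun y hy => ?_
    have h := one_sub_exp_neg_mul_bose hy
    have h0 := mul_bose_le hy
    have hB := bose_pos hy
    have e : curv y * y * Real.exp (-(tau b d * y)) * (Real.exp (-y) -
      tau b d * (1 - Real.exp (-y))) = y * bose y * kern 2 (tau b d) y - 
        tau b d * kern 3 (tau b d) y := by
      unfold kern curv
      linear_combination (-(y ^ 3 * Real.exp (-(tau b d * y)) * (bose y + tau b d * bose y))) * h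
    have k2 := kern_pos 2 (tau b d) hy
    have k3 := kern_pos 3 (tau b d) hy
    rw [e, abs_of_pos (add_pos k2 k3)]
    refine (abs_sub _ _).trans ?_
    rw [abs_of_nonneg (by positivity), abs_of_nonneg (by positivity)]
    nlinarith
  have s1 : IsDamped fun y => Real.exp (-(tau b d * y)) * (1 - Real.exp (-y)) * curv₃ y := by
    refine ((isDamped_kern (p := 2) le_rfl ht).add (isDamped_kern (p := 3) (by norm_num) ht)).mono
      2 (by positivity) fun y hy => ?_
    have h := one_sub_exp_neg_mul_curv₃ hy
    have h0 := mul_bose_le hy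
    have hB := bose_pos hy
    have e : Real.exp (-(tau b d * y)) * (1 - Real.exp (-y)) * curv₃ y =
        kern 3 (tau b d) y + 2 * ((y * bose y) * kern 2 (tau b d) y) := by
      unfold kern
      linear_combination Real.exp (-(tau b d * y)) * h
    have k2 := kern_pos 2 (tau b d) hy
    have k3 := kern_pos 3 (tau b d) hy
    rw [e, abs_of_pos (add_pos k2 k3), abs_of_pos (by positivity)]
    nlinarith
  rw [← ((s1.summable hb hc).mul_left _).tsum_sub (s2.summable hb hc)]
  refine tsum_congr fun k => ?_
  have hy : 0 < scale b m n / b ^ k := by positivity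
  generalize scale b m n / b ^ k = y at *
  have h := one_sub_exp_neg_mul_bose hy
  have h3 := one_sub_exp_neg_mul_curv₃ hy
  unfold kern curv
  linear_combination (1 / 2 * Real.exp (-(tau b d * y))) * h3 +
    (y ^ 3 * Real.exp (-(tau b d * y)) * (bose y + tau b d * bose y)) * h

/-! ### Derivatives of the log-likelihood -/

/-- Each level is a fixed multiple `t * n` of `n`. If `f y = y ^ p * g y`, then `f (t * n) / n ^ p =
t ^ p * g (t * n)`, so a derivative in `n` replaces `g` by `g'` and raises the power by one. -/
theorem hasDerivAt_stat {b : ℝ} (hb : 1 < b) (d : ℕ) {m : ℕ} (hm : 1 ≤ m) (p : ℕ)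
    {f₀ f₁ f₂ h₀ h₁ h₂ : ℝ → ℝ}
    (H₀ : ∀ y, 0 < y → HasDerivAt f₀ ((h₀ y + p * f₀ y) / y) y)
    (H₁ : ∀ y, 0 < y → HasDerivAt f₁ ((h₁ y + p * f₁ y) / y) y)
    (H₂ : ∀ y, 0 < y → HasDerivAt f₂ ((h₂ y + p * f₂ y) / y) y) {n : ℝ} (hn : 0 < n)
    (r : Register d) :
    HasDerivAt (fun n => stat b d f₀ f₁ f₂ (scale b m n) r / n ^ p)
      (stat b d h₀ h₁ h₂ (scale b m n) r / n ^ (p + 1)) n := by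
  have hm0 : (0 : ℝ) < m := by exact_mod_cast hm
  have ha : 0 < b - 1 := by linarith
  have key : ∀ (f h : ℝ → ℝ), (∀ y, 0 < y → HasDerivAt f ((h y + p * f y) / y) y) → ∀ u : ℤ,
      HasDerivAt (fun n => f (scale b m n / b ^ u) / n ^ p)
        (h (scale b m n / b ^ u) / n ^ (p + 1)) n := by
    intro f h H u
    have hc : 0 < scale b m n := scale_pos hb hm hn
    have h1 : HasDerivAt (fun n => scale b m n / b ^ u) (1 * (b - 1) / m / b ^ u) n :=
      (((hasDerivAt_id n).mul_const (b - 1)).div_const (m : ℝ)).div_const (b ^ u)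
    have h2 := (H (scale b m n / b ^ u) (by positivity)).comp n h1
    have h3 := h2.div (hasDerivAt_pow p n) (pow_ne_zero p hn.ne')
    refine h3.congr_deriv ?_
    have e : scale b m n / b ^ u = n * (1 * (b - 1) / m / b ^ u) := by unfold scale; ring
    have hk : 1 * (b - 1) / m / b ^ u ≠ 0 := by positivity
    simp only [Function.comp]
    rw [e]
    generalize 1 * (b - 1) / m / b ^ u = t at *
    rcases p with _ | q
    · field_simp; simp [mul_comm]
    · simp only [Nat.add_sub_cancel]
      field_simp; ring
  unfold stat
  simp only [add_div, Finset.sum_div]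
  refine (key f₀ h₀ H₀ r.1).fun_add (HasDerivAt.fun_sum fun j _ => ?_)
  split_ifs
  · exact key f₁ h₁ H₁ _
  · exact key f₂ h₂ H₂ _

/-- The logarithm of the probability mass function, as a statistic. -/
def logPmfStat (b : ℝ) (d : ℕ) (c : ℝ) (r : Register d) : ℝ :=
  stat b d (fun y => -(y / (b - 1)) + Real.log (1 - Real.exp (-y)))
    (fun y => Real.log (1 - Real.exp (-y))) (fun y => -y) c r

theorem log_pmf_eq {b : ℝ} (hb : 1 < b) (d : ℕ) {m : ℕ} (hm : 1 ≤ m) {n : ℝ} (hn : 0 < n)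
    (r : Register d) : Real.log (pmf b d m n r) = logPmfStat b d (scale b m n) r := by
  obtain ⟨k, l⟩ := r
  have hc := scale_pos hb hm hn
  have hy : 0 < scale b m n / b ^ k := by positivity
  have hw : ∀ j, bitWeight (level b d (scale b m n) k j) (l j) ≠ 0 := fun j => by
    unfold bitWeight
    split_ifs
    · exact (one_sub_exp_neg_pos (level_pos hb d hc k j)).ne'
    · exact (Real.exp_pos _).ne'
  rw [pmf_eq, Real.log_mul (rho_pos hy).ne' (Finset.prod_ne_zero_iff.2 fun j _ => hw j), rho,
    Real.log_mul (Real.exp_pos _).ne' (one_sub_exp_neg_pos hy).ne', Real.log_exp,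
    Real.log_prod fun j _ => hw j]
  unfold logPmfStat stat bitWeight
  congr 1
  refine Finset.sum_congr rfl fun j _ => ?_
  dsimp only
  split_ifs <;> simp

theorem hasDerivAt_logPmfStat {b : ℝ} (hb : 1 < b) (d : ℕ) {m : ℕ} (hm : 1 ≤ m) {n : ℝ}
    (hn : 0 < n) (r : Register d) :
    HasDerivAt (fun n => logPmfStat b d (scale b m n) r) (score b d (scale b m n) r / n) n := by
  have hlog : ∀ y, 0 < y → HasDerivAt (fun y => Real.log (1 - Real.exp (-y)))
      ((y * bose y + (0 : ℕ) * Real.log (1 - Real.exp (-y))) / y) y := fun y hy =>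
    (hasDerivAt_log_one_sub_exp_neg hy).congr_deriv (by field_simp; simp)
  have := hasDerivAt_stat hb d hm 0 (h₀ := fun y => -(y / (b - 1)) + y * bose y)
    (h₁ := fun y => y * bose y) (h₂ := fun y => -y)
    (f₀ := fun y => -(y / (b - 1)) + Real.log (1 - Real.exp (-y)))
    (f₂ := fun y => -y) (fun y hy => ?_) hlog (fun y hy => ?_) hn r
  · simpa only [pow_zero, div_one, zero_add, pow_one, logPmfStat, score] using this
  · refine (((hasDerivAt_id y).div_const (b - 1)).fun_neg.fun_add (hlog y hy)).congr_deriv ?_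
    simp; field_simp
  · refine (hasDerivAt_neg y).congr_deriv ?_
    field_simp; simp

theorem hasDerivAt_score {b : ℝ} (hb : 1 < b) (d : ℕ) {m : ℕ} (hm : 1 ≤ m) {n : ℝ}
    (hn : 0 < n) (r : Register d) :
    HasDerivAt (fun n => score b d (scale b m n) r / n)
      (-updStat b d curv (scale b m n) r / n ^ 2) n := by
  have hB : ∀ y, 0 < y → HasDerivAt (fun y => y * bose y)
      ((-curv y + (1 : ℕ) * (y * bose y)) / y) y := fun y hy =>
    (hasDerivAt_mul_bose hy).congr_deriv (by simp)
  have hl : ∀ a y : ℝ, 0 < y → HasDerivAt (fun y => -(y / a))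
      ((0 + (1 : ℕ) * (-(y / a))) / y) y := fun a y hy => by
    refine ((hasDerivAt_id y).div_const a).fun_neg.congr_deriv ?_
    simp; field_simp
  have := hasDerivAt_stat hb d hm 1 (f₀ := fun y => -(y / (b - 1)) + y * bose y)
    (f₁ := fun y => y * bose y) (f₂ := fun y => -y) (h₀ := fun y => -curv y)
    (h₁ := fun y => -curv y) (h₂ := fun _ => 0) (fun y hy => ?_) hB (fun y hy => ?_) hn r
  · simp only [pow_one] at this
    refine this.congr_deriv ?_
    congr 1
    simp only [updStat, stat, neg_add, ← Finset.sum_neg_distrib]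
    congr 1
    exact Finset.sum_congr rfl fun j _ => by split_ifs <;> simp
  · refine ((hl (b - 1) y hy).add (hB y hy)).congr_deriv ?_
    ring
  · simpa using hl 1 y hy

theorem hasDerivAt_updStat {b : ℝ} (hb : 1 < b) (d : ℕ) {m : ℕ} (hm : 1 ≤ m) (p : ℕ)
    {f h : ℝ → ℝ} (H : ∀ y, 0 < y → HasDerivAt f ((-h y + p * f y) / y) y) {n : ℝ} (hn : 0 < n)
    (r : Register d) :
    HasDerivAt (fun n => updStat b d f (scale b m n) r / n ^ p)
      (-updStat b d h (scale b m n) r / n ^ (p + 1)) n := by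
  have := hasDerivAt_stat hb d hm p (f₀ := f) (f₁ := f) (f₂ := fun _ => 0) (h₀ := fun y => -h y)
    (h₁ := fun y => -h y) (h₂ := fun _ => 0) H H
    (fun y _ => (hasDerivAt_const y (0 : ℝ)).congr_deriv (by simp)) hn r
  refine this.congr_deriv ?_
  congr 1
  simp only [updStat, stat, neg_add, ← Finset.sum_neg_distrib]
  congr 1
  exact Finset.sum_congr rfl fun j _ => by split_ifs <;> simp

theorem logLikelihood_eq {b : ℝ} (hb : 1 < b) (d : ℕ) {m : ℕ} (hm : 1 ≤ m) {n : ℝ} (hn : 0 < n)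
    (r : Fin m → Register d) :
    logLikelihood b d m r n = ∑ i, logPmfStat b d (scale b m n) (r i) :=
  Finset.sum_congr rfl fun i _ => log_pmf_eq hb d hm hn (r i)

theorem hasDerivAt_logLikelihood {b : ℝ} (hb : 1 < b) (d : ℕ) {m : ℕ} (hm : 1 ≤ m) {n : ℝ}
    (hn : 0 < n) (r : Fin m → Register d) :
    HasDerivAt (logLikelihood b d m r) (∑ i, score b d (scale b m n) (r i) / n) n := by
  refine (HasDerivAt.fun_sum fun i _ =>
    hasDerivAt_logPmfStat hb d hm hn (r i)).congr_of_eventuallyEq ?_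
  filter_upwards [lt_mem_nhds hn] with x hx using logLikelihood_eq hb d hm hx r

theorem deriv_logLikelihood {b : ℝ} (hb : 1 < b) (d : ℕ) {m : ℕ} (hm : 1 ≤ m) {n : ℝ}
    (hn : 0 < n) (r : Fin m → Register d) :
    deriv (logLikelihood b d m r) n = ∑ i, score b d (scale b m n) (r i) / n :=
  (hasDerivAt_logLikelihood hb d hm hn r).deriv

theorem iteratedDeriv_two_logLikelihood {b : ℝ} (hb : 1 < b) (d : ℕ) {m : ℕ} (hm : 1 ≤ m) {n : ℝ}
    (hn : 0 < n) (r : Fin m → Register d) :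
    iteratedDeriv 2 (logLikelihood b d m r) n =
      ∑ i, -updStat b d curv (scale b m n) (r i) / n ^ 2 := by
  rw [iteratedDeriv_succ, iteratedDeriv_one]
  refine ((HasDerivAt.fun_sum fun i _ =>
    hasDerivAt_score hb d hm hn (r i)).congr_of_eventuallyEq ?_).deriv
  filter_upwards [lt_mem_nhds hn] with x hx using deriv_logLikelihood hb d hm hx r

theorem iteratedDeriv_three_logLikelihood {b : ℝ} (hb : 1 < b) (d : ℕ) {m : ℕ} (hm : 1 ≤ m) {n : ℝ}
    (hn : 0 < n) (r : Fin m → Register d) :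
    iteratedDeriv 3 (logLikelihood b d m r) n =
      ∑ i, updStat b d curv₃ (scale b m n) (r i) / n ^ 3 := by
  rw [iteratedDeriv_succ]
  have h := HasDerivAt.fun_sum (u := Finset.univ) fun i _ =>
    (hasDerivAt_updStat hb d hm 2 (fun y hy => by exact_mod_cast hasDerivAt_curv hy) hn
      (r i)).fun_neg
  refine ((h.congr_deriv ?_).congr_of_eventuallyEq ?_).deriv
  · simp [neg_div]
  · filter_upwards [lt_mem_nhds hn] with x hx
    rw [iteratedDeriv_two_logLikelihood hb d hm hx r]
    simp [neg_div]

theorem observedInformation_eq {b : ℝ} (hb : 1 < b) (d : ℕ) {m : ℕ} (hm : 1 ≤ m) {n : ℝ}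
    (hn : 0 < n) (r : Fin m → Register d) :
    observedInformation b d m n r = (n ^ 2)⁻¹ * ∑ i, updStat b d curv (scale b m n) (r i) := by
  rw [observedInformation, iteratedDeriv_two_logLikelihood hb d hm hn, ← Finset.sum_div,
    Finset.sum_neg_distrib]
  ring

theorem biasIntegrand_eq {b : ℝ} (hb : 1 < b) (d : ℕ) {m : ℕ} (hm : 1 ≤ m) {n : ℝ}
    (hn : 0 < n) (r : Fin m → Register d) :
    biasIntegrand b d m n r = (n ^ 3)⁻¹ * (1 / 2 * ∑ i, updStat b d curv₃ (scale b m n) (r i) -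
      (∑ i, updStat b d curv (scale b m n) (r i)) * ∑ i, score b d (scale b m n) (r i)) := by
  rw [biasIntegrand, iteratedDeriv_three_logLikelihood hb d hm hn,
    iteratedDeriv_two_logLikelihood hb d hm hn, deriv_logLikelihood hb d hm hn, ← Finset.sum_div,
    ← Finset.sum_div, ← Finset.sum_div, Finset.sum_neg_distrib]
  field_simp
  ring

/-! ### Integrals over independent registers -/

theorem integral_sum_pi {α : Type*} [MeasurableSpace α] (μ : Measure α) [IsProbabilityMeasure μ]
    (m : ℕ) {f : α → ℝ} (hf : Integrable f μ) :
    Integrable (fun r : Fin m → α => ∑ i, f (r i)) (Measure.pi fun _ => μ) ∧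
      ∫ r : Fin m → α, ∑ i, f (r i) ∂(Measure.pi fun _ => μ) = m * ∫ x, f x ∂μ := by
  have hi : ∀ i : Fin m, Integrable (fun r : Fin m → α => f (r i)) (Measure.pi fun _ => μ) :=
    fun i => integrable_comp_eval (μ := fun _ : Fin m => μ) hf
  refine ⟨integrable_finsetSum _ fun i _ => hi i, ?_⟩
  rw [integral_finsetSum _ fun i _ => hi i]
  have h : ∀ i : Fin m, ∫ r : Fin m → α, f (r i) ∂(Measure.pi fun _ => μ) = ∫ x, f x ∂μ :=
    fun i => integral_comp_eval (μ := fun _ : Fin m => μ) hf.aestronglyMeasurable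
  simp [h]

/-- Independence and the centering of `g` remove the off-diagonal terms. This is why `J`, although
it contains a product of sums, is linear in `m`. -/
theorem integral_sum_mul_sum_pi {α : Type*} [MeasurableSpace α] (μ : Measure α)
    [IsProbabilityMeasure μ] (m : ℕ) {f g : α → ℝ} (hf : Integrable f μ) (hg : Integrable g μ)
    (hfg : Integrable (fun x => f x * g x) μ) (h0 : ∫ x, g x ∂μ = 0) :
    Integrable (fun r : Fin m → α => (∑ i, f (r i)) * ∑ i, g (r i)) (Measure.pi fun _ => μ) ∧
      ∫ r : Fin m → α, (∑ i, f (r i)) * ∑ i, g (r i) ∂(Measure.pi fun _ => μ) =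
        m * ∫ x, f x * g x ∂μ := by
  have hev : ∀ (f : α → ℝ), Integrable f μ → ∀ i : Fin m,
      Integrable (fun r : Fin m → α => f (r i)) (Measure.pi fun _ => μ) :=
    fun f hf i => integrable_comp_eval (μ := fun _ : Fin m => μ) hf
  have hint : ∀ (f : α → ℝ), Integrable f μ → ∀ i : Fin m,
      ∫ r : Fin m → α, f (r i) ∂(Measure.pi fun _ => μ) = ∫ x, f x ∂μ :=
    fun f hf i => integral_comp_eval (μ := fun _ : Fin m => μ) hf.aestronglyMeasurable
  have hind : ∀ i j : Fin m, i ≠ j → ProbabilityTheory.IndepFun (fun r : Fin m → α => f (r i))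
      (fun r => g (r j)) (Measure.pi fun _ => μ) := by
    intro i j hij
    have h := ProbabilityTheory.iIndepFun_pi (μ := fun _ : Fin m => μ)
      (X := fun k => if k = i then f else g) (fun k => by
        split_ifs
        · exact hf.aestronglyMeasurable.aemeasurable
        · exact hg.aestronglyMeasurable.aemeasurable)
    have h2 := h.indepFun hij
    simpa [hij.symm] using h2
  have hI : ∀ i j : Fin m,
      Integrable (fun r : Fin m → α => f (r i) * g (r j)) (Measure.pi fun _ => μ) ∧
        ∫ r : Fin m → α, f (r i) * g (r j) ∂(Measure.pi fun _ => μ) =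
          if i = j then ∫ x, f x * g x ∂μ else 0 := by
    intro i j
    split_ifs with h
    · subst h
      exact ⟨hev _ hfg i, hint _ hfg i⟩
    · refine ⟨(hind i j h).integrable_mul (hev f hf i) (hev g hg j), ?_⟩
      have := (hind i j h).integral_mul_eq_mul_integral (hev f hf i).aestronglyMeasurable
        (hev g hg j).aestronglyMeasurable
      refine this.trans ?_
      rw [hint g hg j, h0, mul_zero]
  simp only [Finset.sum_mul_sum]
  refine ⟨integrable_finsetSum _ fun i _ => integrable_finsetSum _ fun j _ => (hI i j).1, ?_⟩
  rw [integral_finsetSum _ fun i _ => integrable_finsetSum _ fun j _ => (hI i j).1]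
  simp only [integral_finsetSum _ fun j _ => (hI _ j).1, (hI _ _).2]
  simp

theorem integrable_observedInformation {b : ℝ} (hb : 1 < b) (d : ℕ) {m : ℕ} (hm : 1 ≤ m) {n : ℝ}
    (hn : 0 < n) :
    Integrable (observedInformation b d m n) (sketchLaw b d m n) ∧
      fisher b d m n = (n ^ 2)⁻¹ * (m * latticeSum b 2 (tau b d) (scale b m n)) := by
  have := isProbabilityMeasure_registerLaw hb d hm hn
  obtain ⟨h1, h2⟩ := integral_sum_pi (registerLaw b d m n) m
    (integral_updStat hb d hm hn (by norm_num) fun y hy => abs_curv_le hy).1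
  have e : observedInformation b d m n = fun r =>
    (n ^ 2)⁻¹ * ∑ i, updStat b d curv (scale b m n) (r i) :=
    funext fun r => observedInformation_eq hb d hm hn r
  rw [fisher, e]
  refine ⟨h1.const_mul _, ?_⟩
  rw [integral_const_mul]
  rw [integral_updStat_curv hb d hm hn] at h2
  exact congrArg _ h2

theorem integrable_biasIntegrand {b : ℝ} (hb : 1 < b) (d : ℕ) {m : ℕ} (hm : 1 ≤ m) {n : ℝ}
    (hn : 0 < n) :
    Integrable (biasIntegrand b d m n) (sketchLaw b d m n) ∧
      biasExpectation b d m n =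
        (n ^ 3)⁻¹ * (m * ((1 / 2 + tau b d) * latticeSum b 3 (tau b d) (scale b m n))) := by
  have := isProbabilityMeasure_registerLaw hb d hm hn
  obtain ⟨h1, h2⟩ := integral_sum_pi (registerLaw b d m n) m
    (integral_updStat hb d hm hn (by norm_num) fun y hy => abs_curv₃_le hy).1
  have hs := integral_score hb d hm hn
  obtain ⟨h3, h4⟩ := integral_sum_mul_sum_pi (registerLaw b d m n) m
    (integral_updStat hb d hm hn (by norm_num) fun y hy => abs_curv_le hy).1 hs.1
    (integral_updStat_mul_score hb d hm hn).1 hs.2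
  have e : biasIntegrand b d m n = fun r =>
    (n ^ 3)⁻¹ * (1 / 2 * ∑ i, updStat b d curv₃ (scale b m n) (r i) -
      (∑ i, updStat b d curv (scale b m n) (r i)) * ∑ i, score b d (scale b m n) (r i)) :=
    funext fun r => biasIntegrand_eq hb d hm hn r
  rw [biasExpectation, e]
  refine ⟨((h1.const_mul _).sub h3).const_mul _, ?_⟩
  rw [integral_const_mul, sketchLaw, integral_sub (h1.const_mul _) h3, integral_const_mul, h2, h4,
    ← integral_third_order hb d hm hn]
  ring

/-! ### The maximum-likelihood estimate -/

/-- The coefficient of the linear part of the log-likelihood. -/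
def linStat (b : ℝ) (d : ℕ) (c : ℝ) (r : Register d) : ℝ :=
  stat b d (fun y => y / (b - 1)) (fun _ => 0) (fun y => y) c r

/-- The first part is positive and decreasing in `c`, the second is positive and linear in `c`.
Existence, uniqueness and the control of the estimate all rest on this splitting. -/
theorem score_eq (b : ℝ) (d : ℕ) (c : ℝ) (r : Register d) :
    score b d c r = updStat b d (fun y => y * bose y) c r - linStat b d c r := by
  have : ∀ j, (if r.2 j then level b d c r.1 j * bose (level b d c r.1 j) else
      -level b d c r.1 j) = (if r.2 j then level b d c r.1 j * bose (level b d c r.1 j) else 0) -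
        if r.2 j then 0 else level b d c r.1 j := fun j => by split_ifs <;> simp
  simp only [score, updStat, linStat, stat, this, Finset.sum_sub_distrib]
  ring

theorem linStat_mul (b : ℝ) (d : ℕ) (t c : ℝ) (r : Register d) :
    linStat b d (t * c) r = t * linStat b d c r := by
  simp only [linStat, stat, level, mul_add, Finset.mul_sum]
  congr 1
  · ring
  · exact Finset.sum_congr rfl fun j _ => by split_ifs <;> ring

theorem le_linStat {b : ℝ} (hb : 1 < b) (d : ℕ) {c : ℝ} (hc : 0 < c) (r : Register d) :
    c / b ^ r.1 / (b - 1) ≤ linStat b d c r := by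
  unfold linStat stat
  refine le_add_of_nonneg_right (Finset.sum_nonneg fun j _ => ?_)
  split_ifs
  · exact le_rfl
  · exact (level_pos hb d hc _ _).le

theorem linStat_pos {b : ℝ} (hb : 1 < b) (d : ℕ) {c : ℝ} (hc : 0 < c) (r : Register d) :
    0 < linStat b d c r := by
  have : 0 < b - 1 := by linarith
  exact lt_of_lt_of_le (by positivity) (le_linStat hb d hc r)

theorem updStat_mul_bose_pos {b : ℝ} (hb : 1 < b) (d : ℕ) {c : ℝ} (hc : 0 < c) (r : Register d) :
    0 < updStat b d (fun y => y * bose y) c r := by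
  have h : ∀ y, 0 < y → 0 < y * bose y := fun y hy => mul_pos hy (bose_pos hy)
  unfold updStat stat
  refine add_pos_of_pos_of_nonneg (h _ (by positivity)) (Finset.sum_nonneg fun j _ => ?_)
  split_ifs
  · exact (h _ (level_pos hb d hc _ _)).le
  · exact le_rfl

theorem updStat_mul_bose_antitone {b : ℝ} (hb : 1 < b) (d : ℕ) {c c' : ℝ} (hc : 0 < c)
    (hcc : c ≤ c') (r : Register d) : updStat b d (fun y => y * bose y) c' r ≤
      updStat b d (fun y => y * bose y) c r := by
  unfold updStat stat
  refine add_le_add (mul_bose_antitone (by positivity) (by gcongr))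
    (Finset.sum_le_sum fun j _ => ?_)
  split_ifs
  · refine mul_bose_antitone (level_pos hb d hc _ _) ?_
    unfold level
    gcongr
  · exact le_rfl

theorem scale_mul (b : ℝ) (m : ℕ) (t n : ℝ) : scale b m (t * n) = t * scale b m n := by
  unfold scale; ring

theorem scale_mono {b : ℝ} (hb : 1 < b) (m : ℕ) {x y : ℝ} (h : x ≤ y) :
    scale b m x ≤ scale b m y := by
  have : 0 ≤ b - 1 := by linarith
  unfold scale; gcongr

/-- The ratio of two points of which one is the zero of the score is controlled by the score at the
other one. -/
theorem abs_ratio_sub_one_le {b : ℝ} (hb : 1 < b) (d : ℕ) {m : ℕ} (hm : 1 ≤ m) {n x : ℝ}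
    (hn : 0 < n) (hx : 0 < x) (r : Fin m → Register d)
    (h : ∑ i, score b d (scale b m x) (r i) = 0) :
    |x / n - 1| * ∑ i, linStat b d (scale b m n) (r i) ≤
      |∑ i, score b d (scale b m n) (r i)| := by
  have e : scale b m x = x / n * scale b m n := by
    rw [← scale_mul, div_mul_cancel₀ _ hn.ne']
  have hA : 0 ≤ ∑ i, linStat b d (scale b m n) (r i) :=
    Finset.sum_nonneg fun i _ => (linStat_pos hb d (scale_pos hb hm hn) _).le
  simp only [score_eq, Finset.sum_sub_distrib] at h ⊢
  simp only [e, linStat_mul, ← Finset.mul_sum] at h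
  rw [← e] at h
  -- Write `Φ` for the sum of the decreasing parts and `A` for the linear part at `n`. At the zero,
  -- `Φ x = (x / n) * A`, hence `(x / n - 1) * A = Φ x - A`; monotonicity of `Φ` compares this with
  -- the score `Φ n - A`.
  rcases le_total n x with hnx | hxn
  · have h1 : ∑ i, updStat b d (fun y => y * bose y) (scale b m x) (r i) ≤
        ∑ i, updStat b d (fun y => y * bose y) (scale b m n) (r i) := Finset.sum_le_sum fun i _ =>
      updStat_mul_bose_antitone hb d (scale_pos hb hm hn) (scale_mono hb m hnx) _
    have h2 : 0 ≤ x / n - 1 := by rw [sub_nonneg]; exact (one_le_div hn).2 hnx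
    rw [abs_of_nonneg h2]
    refine le_trans ?_ (le_abs_self _)
    linarith
  · have h1 : ∑ i, updStat b d (fun y => y * bose y) (scale b m n) (r i) ≤
        ∑ i, updStat b d (fun y => y * bose y) (scale b m x) (r i) := Finset.sum_le_sum fun i _ =>
      updStat_mul_bose_antitone hb d (scale_pos hb hm hx) (scale_mono hb m hxn) _
    have h2 : x / n - 1 ≤ 0 := by rw [sub_nonpos]; exact (div_le_one hn).2 hxn
    rw [abs_of_nonpos h2]
    refine le_trans ?_ (neg_abs_le _ |> neg_le_neg |>.trans_eq (neg_neg _))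
    linarith

theorem sum_score_strictAnti {b : ℝ} (hb : 1 < b) (d : ℕ) {m : ℕ} (hm : 1 ≤ m) {x y : ℝ}
    (hx : 0 < x) (hxy : x < y) (r : Fin m → Register d) :
    ∑ i, score b d (scale b m y) (r i) < ∑ i, score b d (scale b m x) (r i) := by
  have : Nonempty (Fin m) := ⟨⟨0, hm⟩⟩
  have hs : scale b m y = y / x * scale b m x := by
    rw [← scale_mul, div_mul_cancel₀ _ hx.ne']
  refine Finset.sum_lt_sum_of_nonempty Finset.univ_nonempty fun i _ => ?_
  have h1 := updStat_mul_bose_antitone hb d (scale_pos hb hm hx) (scale_mono hb m hxy.le) (r i)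
  have h2 : linStat b d (scale b m x) (r i) < linStat b d (scale b m y) (r i) := by
    rw [hs, linStat_mul]
    exact lt_mul_of_one_lt_left (linStat_pos hb d (scale_pos hb hm hx) _) ((one_lt_div hx).2 hxy)
  rw [score_eq, score_eq]
  linarith

theorem exists_score_zero {b : ℝ} (hb : 1 < b) (d : ℕ) {m : ℕ} (hm : 1 ≤ m)
    (r : Fin m → Register d) : ∃ x, 0 < x ∧ ∑ i, score b d (scale b m x) (r i) = 0 := by
  have : Nonempty (Fin m) := ⟨⟨0, hm⟩⟩
  have h1 := scale_pos hb hm one_pos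
  set Φ : ℝ → ℝ := fun x => ∑ i, updStat b d (fun y => y * bose y) (scale b m x) (r i) with hΦ
  set A := ∑ i, linStat b d (scale b m 1) (r i) with hA
  have hA0 : 0 < A := Finset.sum_pos (fun i _ => linStat_pos hb d h1 _) Finset.univ_nonempty
  have hΦ1 : 0 < Φ 1 := Finset.sum_pos (fun i _ => updStat_mul_bose_pos hb d h1 _)
    Finset.univ_nonempty
  have hS : ∀ x, ∑ i, score b d (scale b m x) (r i) = Φ x - x * A := by
    intro x
    have : scale b m x = x * scale b m 1 := by rw [← scale_mul, mul_one]
    simp only [score_eq, Finset.sum_sub_distrib, hΦ, hA, Finset.mul_sum]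
    congr 1
    exact Finset.sum_congr rfl fun i _ => by rw [this, linStat_mul]
  have hanti : ∀ x y, 0 < x → x ≤ y → Φ y ≤ Φ x := fun x y hx hxy =>
    Finset.sum_le_sum fun i _ =>
      updStat_mul_bose_antitone hb d (scale_pos hb hm hx) (scale_mono hb m hxy) _
  -- The score is `Φ x - x * A` with `Φ` decreasing, so comparing `x` with `1` and with `Φ 1 / A`
  -- fixes its sign at both endpoints.
  set u := min 1 (Φ 1 / A) with hu
  set v := max 1 (Φ 1 / A) with hv
  have hu0 : 0 < u := lt_min one_pos (by positivity)
  have huv : u ≤ v := (min_le_left _ _).trans (le_max_left _ _)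
  have hcont : ContinuousOn (fun x => ∑ i, score b d (scale b m x) (r i)) (Set.Icc u v) := by
    intro x hx
    have hx0 : 0 < x := hu0.trans_le hx.1
    refine ContinuousAt.continuousWithinAt (tendsto_finsetSum _ fun i _ => ?_)
    have h2 := (hasDerivAt_score hb d hm hx0 (r i)).continuousAt.mul continuousAt_id
    have : (fun y => score b d (scale b m y) (r i)) =ᶠ[nhds x]
        (fun y => score b d (scale b m y) (r i) / y) * id := by
      filter_upwards [lt_mem_nhds hx0] with y hy
      simp [hy.ne']
    exact h2.congr this.symm
  have hmem : (0 : ℝ) ∈ Set.Icc (∑ i, score b d (scale b m v) (r i))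
      (∑ i, score b d (scale b m u) (r i)) := by
    rw [hS, hS]
    constructor
    · have := hanti 1 v one_pos (le_max_left _ _)
      have h3 : Φ 1 ≤ v * A := by
        rw [← div_le_iff₀ hA0]; exact le_max_right _ _
      linarith
    · have := hanti u 1 hu0 (min_le_left _ _)
      have h3 : u * A ≤ Φ 1 := by
        rw [← le_div_iff₀ hA0]; exact min_le_right _ _
      linarith
  obtain ⟨x, hx, hx2⟩ := intermediate_value_Icc' huv hcont hmem
  exact ⟨x, hu0.trans_le hx.1, hx2⟩

theorem logLikelihood_lt {b : ℝ} (hb : 1 < b) (d : ℕ) {m : ℕ} (hm : 1 ≤ m)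
    (r : Fin m → Register d) {x : ℝ} (hx : 0 < x) (h0 : ∑ i, score b d (scale b m x) (r i) = 0)
    {y : ℝ} (hy : 0 < y) (hne : y ≠ x) : logLikelihood b d m r y < logLikelihood b d m r x := by
  have hc : ∀ t, 0 < t → ContinuousAt (logLikelihood b d m r) t := fun t ht =>
    (hasDerivAt_logLikelihood hb d hm ht r).continuousAt
  rcases lt_or_gt_of_ne hne with h | h
  · refine strictMonoOn_of_deriv_pos (convex_Icc y x)
      (fun t ht => (hc t (hy.trans_le ht.1)).continuousWithinAt) (fun t ht => ?_)
      (Set.left_mem_Icc.2 h.le) (Set.right_mem_Icc.2 h.le) h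
    rw [interior_Icc] at ht
    have ht0 : 0 < t := hy.trans ht.1
    rw [deriv_logLikelihood hb d hm ht0, ← Finset.sum_div]
    have := sum_score_strictAnti hb d hm ht0 ht.2 r
    rw [h0] at this
    exact div_pos this ht0
  · refine strictAntiOn_of_deriv_neg (convex_Icc x y)
      (fun t ht => (hc t (hx.trans_le ht.1)).continuousWithinAt) (fun t ht => ?_)
      (Set.left_mem_Icc.2 h.le) (Set.right_mem_Icc.2 h.le) h
    rw [interior_Icc] at ht
    have ht0 : 0 < t := hx.trans ht.1
    rw [deriv_logLikelihood hb d hm ht0, ← Finset.sum_div]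
    have := sum_score_strictAnti hb d hm hx ht.1 r
    rw [h0] at this
    exact div_neg_of_neg_of_pos this ht0

theorem isMLEstimate_iff {b : ℝ} (hb : 1 < b) (d : ℕ) {m : ℕ} (hm : 1 ≤ m)
    (r : Fin m → Register d) (x : ℝ) :
    IsMLEstimate b d m r x ↔ 0 < x ∧ ∑ i, score b d (scale b m x) (r i) = 0 := by
  refine ⟨fun ⟨hx, h⟩ => ⟨hx, ?_⟩, fun ⟨hx, h⟩ => ⟨hx, fun y hy => ?_⟩⟩
  · obtain ⟨x', hx', h0⟩ := exists_score_zero hb d hm r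
    by_cases hxx : x = x'
    · rwa [hxx]
    · exact absurd (h x' hx') (not_le.2 (logLikelihood_lt hb d hm r hx' h0 hx hxx))
  · by_cases hxy : y = x
    · rw [hxy]
    · exact (logLikelihood_lt hb d hm r hx h hy hxy).le

theorem existsUnique_isMLEstimate {b : ℝ} (hb : 1 < b) (d : ℕ) {m : ℕ} (hm : 1 ≤ m)
    (r : Fin m → Register d) : ∃! x, IsMLEstimate b d m r x := by
  obtain ⟨x, hx⟩ := exists_score_zero hb d hm r
  refine ⟨x, (isMLEstimate_iff hb d hm r x).2 hx, fun y hy => ?_⟩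
  by_contra hne
  exact absurd (hy.2 x hx.1) (not_le.2 (logLikelihood_lt hb d hm r hx.1 hx.2 hy.1 hne))

theorem mlEstimate_spec {b : ℝ} (hb : 1 < b) (d : ℕ) {m : ℕ} (hm : 1 ≤ m)
    (r : Fin m → Register d) : 0 < mlEstimate b d m r ∧
      ∑ i, score b d (scale b m (mlEstimate b d m r)) (r i) = 0 := by
  have h := (existsUnique_isMLEstimate hb d hm r).exists
  rw [← isMLEstimate_iff hb d hm r, mlEstimate, dif_pos h]
  exact h.choose_spec

/-! ### Moments of means of independent variables -/

theorem exp_le_one_add_add (x : ℝ) : Real.exp x ≤ 1 + x + x ^ 2 * Real.exp |x| := by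
  have h1 : Real.exp x - 1 ≤ x * Real.exp x := by
    have := mul_le_mul_of_nonneg_left (Real.add_one_le_exp (-x)) (Real.exp_pos x).le
    rw [← Real.exp_add, add_neg_cancel, Real.exp_zero] at this
    linarith
  rcases le_total 0 x with hx | hx
  · rw [abs_of_nonneg hx]
    nlinarith
  · have h2 := Real.one_le_exp (abs_nonneg x)
    have h3 := Real.add_one_le_exp x
    nlinarith [sq_nonneg x]

section Moments

variable {α : Type*} [Countable α] [MeasurableSpace α] [MeasurableSingletonClass α]

theorem integrable_of_le {f g : α → ℝ} {μ : Measure α} (hg : Integrable g μ)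
    (h : ∀ x, |f x| ≤ g x) : Integrable f μ :=
  hg.mono' (measurable_of_countable f).aestronglyMeasurable (Filter.Eventually.of_forall h)

/-- Exponential moments of the normalized mean of centered independent variables. -/
theorem integral_exp_sum_le (μ : Measure α) [IsProbabilityMeasure μ] {m : ℕ} (hm : 1 ≤ m)
    {f : α → ℝ} (h0 : ∫ x, f x ∂μ = 0) {θ C : ℝ} (hθ : 0 < θ)
    (he : Integrable (fun x => Real.exp (2 * θ * |f x|)) μ)
    (hC : ∫ x, Real.exp (2 * θ * |f x|) ∂μ ≤ C) :
    Integrable (fun r : Fin m → α => Real.exp (θ / √m * ∑ i, f (r i))) (Measure.pi fun _ => μ) ∧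
      ∫ r : Fin m → α, Real.exp (θ / √m * ∑ i, f (r i)) ∂(Measure.pi fun _ => μ) ≤
        Real.exp (2 * C) := by
  have hm1 : (1 : ℝ) ≤ m := by exact_mod_cast hm
  have hm0 : (0 : ℝ) < m := by linarith
  have hs1 : 1 ≤ √(m : ℝ) := Real.one_le_sqrt.2 hm1
  have hx : ∀ x, |θ / √m * f x| ≤ θ * |f x| := fun x => by
    rw [abs_mul, abs_of_pos (by positivity)]
    exact mul_le_mul_of_nonneg_right (div_le_self hθ.le hs1) (abs_nonneg _)
  have hi : Integrable (fun x => Real.exp (θ / √m * f x)) μ := by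
    refine integrable_of_le he fun x => ?_
    rw [abs_of_pos (Real.exp_pos _), Real.exp_le_exp]
    have := (le_abs_self _).trans (hx x)
    have h2 : 0 ≤ θ * |f x| := by positivity
    linarith
  have hfi : Integrable f μ := by
    refine integrable_of_le (he.const_mul (2 * θ)⁻¹) fun x => ?_
    rw [inv_mul_eq_div, le_div_iff₀ (by positivity)]
    have := Real.add_one_le_exp (2 * θ * |f x|)
    linarith
  have hexp : ∀ r : Fin m → α, Real.exp (θ / √m * ∑ i, f (r i)) =
      ∏ i, Real.exp (θ / √m * f (r i)) := fun r => by
    rw [Finset.mul_sum, Real.exp_sum]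
  simp only [hexp]
  refine ⟨Integrable.fintype_prod (f := fun _ x => Real.exp (θ / √m * f x)) fun _ => hi, ?_⟩
  -- Second-order expansion: the linear term has mean zero and the quadratic one carries `1 / m`, so
  -- that the `m`-fold product stays below `(1 + 2 C / m) ^ m`. The factor `2 * θ` absorbs the
  -- square into the exponential.
  have hpt : ∀ x, Real.exp (θ / √m * f x) ≤
      1 + θ / √m * f x + 2 / m * Real.exp (2 * θ * |f x|) := by
    intro x
    refine (exp_le_one_add_add _).trans ?_
    gcongr 1 + _ + ?_
    have h1 : (θ / √m * f x) ^ 2 = (θ * |f x|) ^ 2 / m := by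
      rw [mul_pow, mul_pow, div_pow, Real.sq_sqrt hm0.le, sq_abs]; ring
    have h2 := Real.pow_div_factorial_le_exp (θ * |f x|) (by positivity) 2
    have h3 : Real.exp |θ / √m * f x| ≤ Real.exp (θ * |f x|) := Real.exp_le_exp.2 (hx x)
    norm_num at h2
    rw [h1]
    calc _ ≤ (2 * Real.exp (θ * |f x|)) / m * Real.exp (θ * |f x|) := by
          gcongr
          linarith
      _ = 2 / m * (Real.exp (θ * |f x|) * Real.exp (θ * |f x|)) := by ring
      _ = _ := by rw [← Real.exp_add]; ring_nf
  have hle : ∫ x, Real.exp (θ / √m * f x) ∂μ ≤ 1 + 2 * C / m := by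
    refine (integral_mono hi (((integrable_const 1).add (hfi.const_mul _)).add
      (he.const_mul _)) hpt).trans ?_
    rw [integral_add' ((integrable_const 1).add (hfi.const_mul _)) (he.const_mul _),
      integral_add' (integrable_const 1) (hfi.const_mul _), integral_const_mul, integral_const_mul,
      h0]
    simp only [integral_const, probReal_univ, smul_eq_mul, mul_one, mul_zero, add_zero]
    rw [mul_div_right_comm]
    gcongr
  rw [integral_fintype_prod_eq_pow (fun x => Real.exp (θ / √m * f x)), Fintype.card_fin]
  calc _ ≤ (1 + 2 * C / m) ^ m := by
        gcongr
    _ ≤ (Real.exp (2 * C / m)) ^ m := by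
        have : 0 ≤ C := (integral_nonneg fun x => (Real.exp_pos _).le).trans hC
        gcongr
        linarith [Real.add_one_le_exp (2 * C / m)]
    _ = _ := by rw [← Real.exp_nat_mul]; congr 1; field_simp

/-- Exponential moments of the absolute value of the normalized mean of centered independent
variables. -/
theorem integral_exp_abs_sum_le (μ : Measure α) [IsProbabilityMeasure μ] {m : ℕ} (hm : 1 ≤ m)
    {f : α → ℝ} (h0 : ∫ x, f x ∂μ = 0) {θ C : ℝ} (hθ : 0 < θ)
    (he : Integrable (fun x => Real.exp (2 * θ * |f x|)) μ)
    (hC : ∫ x, Real.exp (2 * θ * |f x|) ∂μ ≤ C) :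
    Integrable (fun r : Fin m → α => Real.exp (θ * |√m * ((∑ i, f (r i)) / m)|))
        (Measure.pi fun _ => μ) ∧
      ∫ r : Fin m → α, Real.exp (θ * |√m * ((∑ i, f (r i)) / m)|) ∂(Measure.pi fun _ => μ) ≤
        2 * Real.exp (2 * C) := by
  have hm0 : (0 : ℝ) < m := by exact_mod_cast hm
  obtain ⟨h1, h2⟩ := integral_exp_sum_le μ hm h0 hθ he hC
  obtain ⟨h3, h4⟩ := integral_exp_sum_le μ hm (f := fun x => -f x) (by simp [integral_neg, h0]) hθ
    (by simpa using he) (by simpa using hC)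
  have hle : ∀ r : Fin m → α, Real.exp (θ * |√m * ((∑ i, f (r i)) / m)|) ≤
      Real.exp (θ / √m * ∑ i, f (r i)) + Real.exp (θ / √m * ∑ i, -f (r i)) := by
    intro r
    have e : √m * ((∑ i, f (r i)) / m) = (∑ i, f (r i)) / √m := by
      have := Real.mul_self_sqrt hm0.le
      have h : 0 < √(m : ℝ) := Real.sqrt_pos.2 hm0
      field_simp
      rw [sq, this, mul_comm]
    rw [e, Finset.sum_neg_distrib]
    rcases abs_cases ((∑ i, f (r i)) / √(m : ℝ)) with ⟨h, -⟩ | ⟨h, -⟩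
    · rw [h, show θ * ((∑ i, f (r i)) / √m) = θ / √m * ∑ i, f (r i) by ring]
      linarith [Real.exp_pos (θ / √m * -∑ i, f (r i))]
    · rw [h, show θ * -((∑ i, f (r i)) / √m) = θ / √m * -∑ i, f (r i) by ring]
      linarith [Real.exp_pos (θ / √m * ∑ i, f (r i))]
  have hint : Integrable (fun r : Fin m → α => Real.exp (θ * |√m * ((∑ i, f (r i)) / m)|))
      (Measure.pi fun _ => μ) :=
    integrable_of_le (h1.add h3) fun r => by
      rw [abs_of_pos (Real.exp_pos _)]; exact hle r
  refine ⟨hint, (integral_mono hint (h1.add h3) hle).trans ?_⟩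
  rw [integral_add' h1 h3]
  linarith

/-- Negative moments of the mean of positive independent variables. -/
theorem integral_inv_mean_pow_le (μ : Measure α) [IsProbabilityMeasure μ] {m : ℕ} (hm : 16 ≤ m)
    {u : α → ℝ} (hu : ∀ x, 0 < u x) {C : ℝ} (hi : Integrable (fun x => (√(u x))⁻¹) μ)
    (hC : ∫ x, (√(u x))⁻¹ ∂μ ≤ C) :
    Integrable (fun r : Fin m → α => ((∑ i, u (r i)) / m)⁻¹ ^ 8) (Measure.pi fun _ => μ) ∧
      ∫ r : Fin m → α, ((∑ i, u (r i)) / m)⁻¹ ^ 8 ∂(Measure.pi fun _ => μ) ≤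
        Real.exp (16 * C) := by
  have hm16 : (16 : ℝ) ≤ m := by exact_mod_cast hm
  have hm0 : (0 : ℝ) < m := by linarith
  have : Nonempty (Fin m) := ⟨⟨0, by omega⟩⟩
  -- By convexity `u ^ (-8 / m)` is at most the interpolation between `1` and `u ^ (-1 / 2)` with
  -- weight `16 / m`, a legitimate weight exactly when `m ≥ 16`.
  have hpt : ∀ x, Real.exp (8 / m * -Real.log (u x)) ≤ 1 + 16 / m * (√(u x))⁻¹ := by
    intro x
    have e : (√(u x))⁻¹ = Real.exp (-Real.log (u x) / 2) := by
      rw [neg_div, Real.exp_neg, ← Real.log_sqrt (hu x).le, Real.exp_log (Real.sqrt_pos.2 (hu x))]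
    have h1 : (16 : ℝ) / m ≤ 1 := by rw [div_le_one hm0]; exact hm16
    have h := convexOn_exp.2 (Set.mem_univ (0 : ℝ)) (Set.mem_univ (-Real.log (u x) / 2))
      (show 0 ≤ 1 - 16 / (m : ℝ) by linarith) (show 0 ≤ 16 / (m : ℝ) by positivity) (by ring)
    simp only [smul_eq_mul, mul_zero, zero_add, Real.exp_zero, mul_one] at h
    rw [e]
    have e2 : 16 / (m : ℝ) * (-Real.log (u x) / 2) = 8 / m * -Real.log (u x) := by ring
    rw [e2] at h
    have h3 : 0 ≤ 16 / (m : ℝ) := by positivity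
    linarith
  have hI : Integrable (fun x => Real.exp (8 / m * -Real.log (u x))) μ :=
    integrable_of_le ((integrable_const 1).add (hi.const_mul (16 / m))) fun x => by
      rw [abs_of_pos (Real.exp_pos _)]; exact hpt x
  -- The arithmetic mean is at least the geometric mean, which factorizes over the independent
  -- registers.
  have hle : ∀ r : Fin m → α, ((∑ i, u (r i)) / m)⁻¹ ^ 8 ≤
      ∏ i, Real.exp (8 / m * -Real.log (u (r i))) := by
    intro r
    have hS : 0 < (∑ i, u (r i)) / m :=
      div_pos (Finset.sum_pos (fun i _ => hu _) Finset.univ_nonempty) hm0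
    have h := convexOn_exp.map_sum_le (t := (Finset.univ : Finset (Fin m)))
      (w := fun _ => (m : ℝ)⁻¹) (p := fun i => Real.log (u (r i))) (fun _ _ => by positivity)
      (by simp [hm0.ne']) (fun _ _ => Set.mem_univ _)
    simp only [smul_eq_mul, Real.exp_log (hu _), ← Finset.mul_sum] at h
    rw [inv_mul_eq_div (m : ℝ) (∑ i, u (r i))] at h
    rw [← Real.exp_sum, ← Finset.mul_sum, Finset.sum_neg_distrib]
    have e : Real.exp (8 / m * -∑ i, Real.log (u (r i))) =
        (Real.exp ((m : ℝ)⁻¹ * ∑ i, Real.log (u (r i))))⁻¹ ^ 8 := by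
      rw [← Real.exp_neg, ← Real.exp_nat_mul]
      congr 1
      push_cast
      ring
    rw [e]
    gcongr
  have hJ : Integrable (fun r : Fin m → α => ∏ i, Real.exp (8 / m * -Real.log (u (r i))))
      (Measure.pi fun _ => μ) :=
    Integrable.fintype_prod (f := fun _ x => Real.exp (8 / m * -Real.log (u x))) fun _ => hI
  have hK : Integrable (fun r : Fin m → α => ((∑ i, u (r i)) / m)⁻¹ ^ 8)
      (Measure.pi fun _ => μ) :=
    integrable_of_le hJ fun r => by
      rw [abs_of_nonneg]
      · exact hle r
      · have : 0 ≤ ∑ i, u (r i) := Finset.sum_nonneg fun i _ => (hu _).le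
        positivity
  refine ⟨hK, (integral_mono hK hJ hle).trans ?_⟩
  rw [integral_fintype_prod_eq_pow (fun x => Real.exp (8 / m * -Real.log (u x))),
    Fintype.card_fin]
  have h1 : ∫ x, Real.exp (8 / m * -Real.log (u x)) ∂μ ≤ 1 + 16 * C / m := by
    refine (integral_mono hI ((integrable_const 1).add (hi.const_mul (16 / m))) hpt).trans ?_
    rw [integral_add' (integrable_const 1) (hi.const_mul _), integral_const_mul]
    simp only [integral_const, probReal_univ, smul_eq_mul, mul_one]
    rw [mul_div_right_comm]
    gcongr
  calc _ ≤ (1 + 16 * C / m) ^ m := by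
        gcongr
    _ ≤ (Real.exp (16 * C / m)) ^ m := by
        have : 0 ≤ C := (integral_nonneg fun x => by positivity).trans hC
        gcongr
        linarith [Real.add_one_le_exp (16 * C / m)]
    _ = _ := by rw [← Real.exp_nat_mul]; congr 1; field_simp

end Moments

/-! ### The expansion of the zero of the score -/

/-- Three nested applications of the mean value inequality. The factor `1 / 6` is given up, which is
harmless here. -/
theorem taylor_second_order {f₀ f₁ f₂ f₃ : ℝ → ℝ} {x₀ x M : ℝ}
    (h₀ : ∀ t ∈ Set.uIcc x₀ x, HasDerivAt f₀ (f₁ t) t)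
    (h₁ : ∀ t ∈ Set.uIcc x₀ x, HasDerivAt f₁ (f₂ t) t)
    (h₂ : ∀ t ∈ Set.uIcc x₀ x, HasDerivAt f₂ (f₃ t) t)
    (hM : ∀ t ∈ Set.uIcc x₀ x, |f₃ t| ≤ M) :
    |f₀ x - f₀ x₀ - f₁ x₀ * (x - x₀) - 1 / 2 * f₂ x₀ * (x - x₀) ^ 2| ≤ M * |x - x₀| ^ 3 := by
  have hc : Convex ℝ (Set.uIcc x₀ x) := convex_uIcc x₀ x
  have hl : x₀ ∈ Set.uIcc x₀ x := Set.left_mem_uIcc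
  have hr : x ∈ Set.uIcc x₀ x := Set.right_mem_uIcc
  have hM0 : 0 ≤ M := (abs_nonneg _).trans (hM x₀ hl)
  have hd : ∀ t ∈ Set.uIcc x₀ x, |t - x₀| ≤ |x - x₀| := fun t ht => Set.abs_sub_left_of_mem_uIcc ht
  have b₂ : ∀ t ∈ Set.uIcc x₀ x, |f₂ t - f₂ x₀| ≤ M * |x - x₀| := fun t ht =>
    (hc.norm_image_sub_le_of_norm_hasDerivWithin_le (fun t ht => (h₂ t ht).hasDerivWithinAt) hM hl
      ht).trans (mul_le_mul_of_nonneg_left (hd t ht) hM0)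
  have b₁ : ∀ t ∈ Set.uIcc x₀ x, |f₁ t - f₁ x₀ - f₂ x₀ * (t - x₀)| ≤
      M * |x - x₀| * |x - x₀| := fun t ht => by
    have := hc.norm_image_sub_le_of_norm_hasDerivWithin_le (f := fun t => f₁ t - f₂ x₀ * (t - x₀))
      (f' := fun t => f₂ t - f₂ x₀ * 1) (fun t ht => ((h₁ t ht).sub
        (((hasDerivAt_id t).sub_const x₀).const_mul (f₂ x₀))).hasDerivWithinAt)
      (by simpa using b₂) hl ht
    refine le_trans (le_of_eq ?_) (this.trans
      (mul_le_mul_of_nonneg_left (hd t ht) (by positivity)))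
    rw [Real.norm_eq_abs]; congr 1; ring
  have := hc.norm_image_sub_le_of_norm_hasDerivWithin_le
    (f := fun t => f₀ t - f₁ x₀ * (t - x₀) - 1 / 2 * f₂ x₀ * (t - x₀) ^ 2)
    (f' := fun t => f₁ t - f₁ x₀ - f₂ x₀ * (t - x₀)) (C := M * |x - x₀| * |x - x₀|)
    (fun t ht => by
      have := ((h₀ t ht).fun_sub (((hasDerivAt_id' t).sub_const x₀).const_mul (f₁ x₀))).fun_sub
        ((((hasDerivAt_id' t).sub_const x₀).fun_pow 2).const_mul (1 / 2 * f₂ x₀))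
      refine (this.congr_deriv ?_).hasDerivWithinAt
      simp; ring) b₁ hl hr
  refine le_trans (le_of_eq ?_) (this.trans_eq ?_)
  · rw [Real.norm_eq_abs]; congr 1; ring
  · rw [Real.norm_eq_abs]; ring

/-- The second-order expansion of the solution `δ` of a perturbed quadratic equation. -/
theorem quadratic_expansion {i₀ K : ℝ} (hi₀ : 0 < i₀) (hK : 1 ≤ K) : ∃ C, 0 < C ∧
    ∀ i κ S T V δ R Q P : ℝ, i₀ ≤ i → |κ| ≤ K → 1 ≤ P → |S| ≤ Q → |T| ≤ Q → |V| ≤ Q →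
      |δ| ≤ Q * P → |R| ≤ K * (1 + Q) * |δ| ^ 3 →
      S + (T - i) * δ + 1 / 2 * (κ + V) * δ ^ 2 + R = 0 →
      |δ - (S / i + T * S / i ^ 2 + κ * (S * S) / (2 * i ^ 3))| ≤
        C * (Q ^ 3 * (1 + Q) ^ 2 * P ^ 4) := by
  refine ⟨i₀⁻¹ * (2 * K + 3 * K * i₀⁻¹ + 1 / 2 * K * (3 * K * i₀⁻¹) * (1 + i₀⁻¹)), by positivity,
    fun i κ S T V δ R Q P hi hκ hP hS hT hV hδ hR h => ?_⟩
  have hQ : 0 ≤ Q := (abs_nonneg _).trans hS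
  have hi0 : 0 < i := hi₀.trans_le hi
  have hii : i⁻¹ ≤ i₀⁻¹ := by gcongr
  have hPpow : ∀ a b : ℕ, a ≤ b → P ^ a ≤ P ^ b := fun a b hab => pow_le_pow_right₀ hP hab
  have hQpow : ∀ a b : ℕ, a ≤ b → (1 + Q) ^ a ≤ (1 + Q) ^ b := fun a b hab =>
    pow_le_pow_right₀ (by linarith) hab
  have hδ2 : |δ| ^ 2 ≤ Q ^ 2 * P ^ 2 := by rw [← mul_pow]; gcongr
  have hδ3 : |δ| ^ 3 ≤ Q ^ 3 * P ^ 3 := by rw [← mul_pow]; gcongr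
  have hR' : |R| ≤ K * (1 + Q) * (Q ^ 3 * P ^ 3) := hR.trans (by gcongr)
  have t1 : |T * δ| ≤ Q ^ 2 * P := by
    rw [abs_mul]
    calc _ ≤ Q * (Q * P) := by gcongr
      _ = _ := by ring
  have t2 : |1 / 2 * (κ + V) * δ ^ 2| ≤ 1 / 2 * (K + Q) * (Q ^ 2 * P ^ 2) := by
    rw [abs_mul, abs_mul, abs_pow, abs_of_pos (by norm_num : (0 : ℝ) < 1 / 2)]
    have : |κ + V| ≤ K + Q := (abs_add_le _ _).trans (add_le_add hκ hV)
    gcongr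
  have t3 : |1 / 2 * V * δ ^ 2| ≤ 1 / 2 * Q * (Q ^ 2 * P ^ 2) := by
    rw [abs_mul, abs_mul, abs_pow, abs_of_pos (by norm_num : (0 : ℝ) < 1 / 2)]
    gcongr
  -- The first-order solution is `δ = S / i`, with error `e₁ / i` of second order. Substituting it
  -- once into the linear and quadratic terms leaves errors of third order.
  set e₁ := i * δ - S with he₁
  have E₁ : |e₁| ≤ 3 * K * (Q ^ 2 * (1 + Q) ^ 2 * P ^ 3) := by
    have : e₁ = T * δ + 1 / 2 * (κ + V) * δ ^ 2 + R := by rw [he₁]; linarith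
    rw [this]
    refine (abs_add_three _ _ _).trans ((add_le_add (add_le_add t1 t2) hR').trans ?_)
    have p1 : Q ^ 2 * P ≤ Q ^ 2 * P ^ 3 := by
      have := hPpow 1 3 (by norm_num)
      rw [pow_one] at this
      gcongr
    have p2 : 1 / 2 * (K + Q) * (Q ^ 2 * P ^ 2) ≤ 1 / 2 * (K + Q) * (Q ^ 2 * P ^ 3) := by
      have := hPpow 2 3 (by norm_num)
      gcongr
    have p3 : Q ^ 2 * P ^ 3 + 1 / 2 * (K + Q) * (Q ^ 2 * P ^ 3) + K * (1 + Q) * (Q ^ 3 * P ^ 3) =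
        (1 + 1 / 2 * (K + Q) + K * (1 + Q) * Q) * (Q ^ 2 * P ^ 3) := by ring
    have p4 : 1 + 1 / 2 * (K + Q) + K * (1 + Q) * Q ≤ 3 * K * (1 + Q) ^ 2 := by nlinarith
    calc _ ≤ (1 + 1 / 2 * (K + Q) + K * (1 + Q) * Q) * (Q ^ 2 * P ^ 3) := by linarith
      _ ≤ 3 * K * (1 + Q) ^ 2 * (Q ^ 2 * P ^ 3) := by gcongr
      _ = _ := by ring
  have E₂ : |1 / 2 * V * δ ^ 2 + R| ≤ 2 * K * (Q ^ 3 * (1 + Q) ^ 2 * P ^ 4) := by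
    refine (abs_add_le _ _).trans ((add_le_add t3 hR').trans ?_)
    have p1 : P ^ 2 ≤ P ^ 4 := hPpow 2 4 (by norm_num)
    have p2 : P ^ 3 ≤ P ^ 4 := hPpow 3 4 (by norm_num)
    have p3 : 1 / 2 ≤ K * (1 + Q) ^ 2 := by nlinarith
    have p4 : 1 + Q ≤ (1 + Q) ^ 2 := by nlinarith
    calc _ = 1 / 2 * (Q ^ 3 * P ^ 2) + K * (1 + Q) * (Q ^ 3 * P ^ 3) := by ring
      _ ≤ K * (1 + Q) ^ 2 * (Q ^ 3 * P ^ 4) + K * (1 + Q) ^ 2 * (Q ^ 3 * P ^ 4) := by gcongr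
      _ = _ := by ring
  -- Uses `δ - S / i = e₁ / i` in the term `T * δ` and `δ² - (S / i)² = (e₁ / i) * (δ + S / i)` in
  -- the quadratic term.
  have e : δ - (S / i + T * S / i ^ 2 + κ * (S * S) / (2 * i ^ 3)) =
      i⁻¹ * ((1 / 2 * V * δ ^ 2 + R) + T * (e₁ * i⁻¹) +
        1 / 2 * κ * (e₁ * i⁻¹) * (δ + S * i⁻¹)) := by
    rw [he₁]
    field_simp
    linear_combination (-2 * i ^ 2) * h
  have E₃ : |e₁ * i⁻¹| ≤ 3 * K * (Q ^ 2 * (1 + Q) ^ 2 * P ^ 3) * i₀⁻¹ := by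
    rw [abs_mul, abs_of_pos (inv_pos.2 hi0)]
    gcongr
  have E₄ : |δ + S * i⁻¹| ≤ Q * P * (1 + i₀⁻¹) := by
    refine (abs_add_le _ _).trans ?_
    rw [abs_mul, abs_of_pos (inv_pos.2 hi0), mul_add, mul_one]
    have : Q ≤ Q * P := le_mul_of_one_le_right hQ hP
    gcongr
    exact hS.trans this
  rw [e, abs_mul, abs_of_pos (inv_pos.2 hi0), mul_assoc i₀⁻¹]
  refine mul_le_mul hii ?_ (abs_nonneg _) (by positivity)
  refine (abs_add_three _ _ _).trans ?_
  have F₁ : |T * (e₁ * i⁻¹)| ≤ 3 * K * i₀⁻¹ * (Q ^ 3 * (1 + Q) ^ 2 * P ^ 4) := by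
    rw [abs_mul]
    have p2 : P ^ 3 ≤ P ^ 4 := hPpow 3 4 (by norm_num)
    calc _ ≤ Q * (3 * K * (Q ^ 2 * (1 + Q) ^ 2 * P ^ 3) * i₀⁻¹) := by gcongr
      _ = 3 * K * i₀⁻¹ * (Q ^ 3 * (1 + Q) ^ 2 * P ^ 3) := by ring
      _ ≤ _ := by gcongr
  have F₂ : |1 / 2 * κ * (e₁ * i⁻¹) * (δ + S * i⁻¹)| ≤
      1 / 2 * K * (3 * K * i₀⁻¹) * (1 + i₀⁻¹) * (Q ^ 3 * (1 + Q) ^ 2 * P ^ 4) := by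
    rw [abs_mul, abs_mul, abs_mul, abs_of_pos (by norm_num : (0 : ℝ) < 1 / 2)]
    calc _ ≤ 1 / 2 * K * (3 * K * (Q ^ 2 * (1 + Q) ^ 2 * P ^ 3) * i₀⁻¹) *
          (Q * P * (1 + i₀⁻¹)) := by gcongr
      _ = _ := by ring
  linarith

/-! ### The first-order bias of the maximum-likelihood estimate -/

theorem exists_integral_level_le {b : ℝ} (hb : 1 < b) (d : ℕ) {G : ℝ → ℝ}
    (hG0 : ∀ y, 0 < y → 0 ≤ G y) (hG : IsDamped fun y => rho b y * G y) :
    ∃ K, 0 < K ∧ ∀ m : ℕ, 1 ≤ m → ∀ n : ℝ, 0 < n →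
      Integrable (fun r : Register d => G (scale b m n / b ^ r.1)) (registerLaw b d m n) ∧
        ∫ r : Register d, G (scale b m n / b ^ r.1) ∂(registerLaw b d m n) ≤ K := by
  obtain ⟨K, hK, h⟩ := hG.exists_tsum_le hb
  refine ⟨K, hK, fun m hm n hn => ?_⟩
  have hc := scale_pos hb hm hn
  have h1 := integral_registerLaw hb d hm hn
    (f := fun r : Register d => G (scale b m n / b ^ r.1)) hG
    (fun r => (abs_of_nonneg (hG0 _ (by positivity))).le)
  refine ⟨h1.1, ?_⟩
  rw [h1.2]
  simp only [bitsMean_const]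
  exact (le_abs_self _).trans (h _ hc)

/-- `rho` decays at rate `1 / (b - 1)`; an exponential with half this rate leaves the other half for
summability. -/
theorem exists_integral_exp_level_le {b : ℝ} (hb : 1 < b) (d : ℕ) :
    ∃ K, 0 < K ∧ ∀ m : ℕ, 1 ≤ m → ∀ n : ℝ, 0 < n →
      Integrable (fun r : Register d => Real.exp ((b - 1)⁻¹ / 2 * (1 + scale b m n / b ^ r.1)))
        (registerLaw b d m n) ∧
      ∫ r : Register d, Real.exp ((b - 1)⁻¹ / 2 * (1 + scale b m n / b ^ r.1))
        ∂(registerLaw b d m n) ≤ K := by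
  have hi : 0 < (b - 1)⁻¹ := by simpa using hb
  refine exists_integral_level_le hb d (G := fun y => Real.exp ((b - 1)⁻¹ / 2 * (1 + y)))
    (fun y _ => (Real.exp_pos _).le) ?_
  refine isDamped_of_le_exp (C := Real.exp ((b - 1)⁻¹ / 2)) (κ := (b - 1)⁻¹ / 2) (by positivity)
    (Real.exp_pos _).le 0 fun y hy => ?_
  have h1 := (rho_pos (b := b) hy).le
  rw [abs_of_nonneg (by positivity), pow_zero, mul_one]
  calc _ ≤ y * Real.exp (-((b - 1)⁻¹ * y)) * Real.exp ((b - 1)⁻¹ / 2 * (1 + y)) := by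
        gcongr
        exact rho_le
    _ = _ := by
        rw [mul_assoc, ← Real.exp_add, mul_left_comm, ← Real.exp_add]
        ring_nf

/-- Near zero `rho b y ≤ y`, so `rho b y / √y` is only of order `√y`. This moment is the reason for
the square roots in `damp`. -/
theorem exists_integral_inv_sqrt_level_le {b : ℝ} (hb : 1 < b) (d : ℕ) :
    ∃ K, 0 < K ∧ ∀ m : ℕ, 1 ≤ m → ∀ n : ℝ, 0 < n →
      Integrable (fun r : Register d => (√(scale b m n / b ^ r.1 / (b - 1)))⁻¹)
        (registerLaw b d m n) ∧
      ∫ r : Register d, (√(scale b m n / b ^ r.1 / (b - 1)))⁻¹ ∂(registerLaw b d m n) ≤ K := by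
  have ha : 0 < b - 1 := by linarith
  refine exists_integral_level_le hb d (G := fun y => (√(y / (b - 1)))⁻¹)
    (fun y _ => by positivity) ⟨√(b - 1) * 2, fun y hy => ?_⟩
  have h1 := (rho_pos (b := b) hy).le
  have hs : 0 < √y := Real.sqrt_pos.2 hy
  change |rho b y * (√(y / (b - 1)))⁻¹| ≤ _
  rw [abs_of_nonneg (by positivity), Real.sqrt_div hy.le, inv_div, mul_assoc]
  have h2 : rho b y / √y ≤ min (√y) (√y)⁻¹ := by
    have e1 : Real.exp (-(y / (b - 1))) ≤ 1 := by
      rw [Real.exp_le_one_iff]; have : 0 < y / (b - 1) := by positivity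
      linarith
    have e2 : 1 - Real.exp (-y) ≤ y := by linarith [Real.add_one_le_exp (-y)]
    have e3 := one_sub_exp_neg_pos hy
    have e4 : rho b y ≤ 1 - Real.exp (-y) := mul_le_of_le_one_left e3.le e1
    refine le_min ?_ ?_
    · rw [div_le_iff₀ hs, Real.mul_self_sqrt hy.le]; linarith
    · rw [div_eq_mul_inv]
      refine mul_le_of_le_one_left (by positivity) ?_
      linarith [Real.exp_pos (-y)]
  calc _ = √(b - 1) * (rho b y / √y) := by ring
    _ ≤ √(b - 1) * (2 * damp y) := by
        gcongr
        exact h2.trans (min_le_two_mul_damp hy)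

/-- Every lattice has a point in `[1, b)`, and this single positive term already bounds the
information from below. -/
theorem exists_le_latticeSum_two {b : ℝ} (hb : 1 < b) {τ : ℝ} (hτ : 0 ≤ τ) :
    ∃ i₀, 0 < i₀ ∧ ∀ c, 0 < c → i₀ ≤ latticeSum b 2 τ c := by
  refine ⟨Real.exp (-(b + τ * b)), Real.exp_pos _, fun c hc => ?_⟩
  obtain ⟨k₀, y, h1, h2, h3⟩ := exists_lattice_shift hb hc
  have hy : 0 < y := by linarith
  have hs := (isDamped_kern (p := 2) le_rfl hτ).summable hb hc
  have h4 := hs.le_tsum k₀ fun k _ => (kern_pos 2 τ (by positivity)).le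
  have h5 := h3 0
  simp only [zero_add, zpow_zero, div_one] at h5
  rw [h5] at h4
  refine le_trans ?_ h4
  have h6 : Real.exp (-b) ≤ bose y := by
    unfold bose
    rw [Real.exp_neg]
    have := exp_sub_one_pos hy
    have : Real.exp y ≤ Real.exp b := Real.exp_le_exp.2 h2.le
    gcongr
    linarith
  have h7 : Real.exp (-(τ * b)) ≤ Real.exp (-(τ * y)) := by
    rw [Real.exp_le_exp]; nlinarith
  have h8 : (1 : ℝ) ≤ y ^ 2 := one_le_pow₀ h1
  rw [neg_add, Real.exp_add, kern]
  have h9 := bose_pos hy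
  calc _ ≤ bose y * Real.exp (-(τ * y)) := by gcongr
    _ ≤ y ^ 2 * bose y * Real.exp (-(τ * y)) := by
        have : bose y ≤ y ^ 2 * bose y := le_mul_of_one_le_left h9.le h8
        gcongr

/-- The remainder of the expansion of the score at its zero. -/
theorem abs_score_expansion_le {b : ℝ} (hb : 1 < b) (d : ℕ) {m : ℕ} (hm : 1 ≤ m) {n x : ℝ}
    (hn : 0 < n) (hx : 0 < x) (r : Fin m → Register d)
    (h : ∑ i, score b d (scale b m x) (r i) = 0) :
    |(∑ i, score b d (scale b m n) (r i)) / m -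
      (∑ i, updStat b d curv (scale b m n) (r i)) / m * (x / n - 1) +
      1 / 2 * ((∑ i, updStat b d curv₃ (scale b m n) (r i)) / m) * (x / n - 1) ^ 2| ≤
    1600 * (1 + d) * (1 + |(∑ i, score b d (scale b m n) (r i)) / m|) * |x / n - 1| ^ 3 := by
  have hm0 : (0 : ℝ) < m := by exact_mod_cast hm
  have hc := scale_pos hb hm hn
  -- For `x ≥ n / 2` Taylor's formula applies; the bound `100` on `curv₄` and `t ≥ n / 2` give `100
  -- * 2 ^ 4 = 1600`. For `x ≤ n / 2` no expansion is needed: `|δ| ^ 3 ≥ 1 / 8`, and the trivial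
  -- bounds on all terms suffice.
  rcases le_total (n / 2) x with hxn | hxn
  · have ht : ∀ t ∈ Set.uIcc n x, n / 2 ≤ t := fun t ht => by
      have := ht.1
      exact (le_min (by linarith) hxn).trans this
    have ht0 : ∀ t ∈ Set.uIcc n x, 0 < t := fun t h => (half_pos hn).trans_le (ht t h)
    have hT := taylor_second_order (x₀ := n) (x := x)
      (f₀ := fun t => ∑ i, score b d (scale b m t) (r i) / t)
      (f₁ := fun t => ∑ i, -updStat b d curv (scale b m t) (r i) / t ^ 2)
      (f₂ := fun t => ∑ i, updStat b d curv₃ (scale b m t) (r i) / t ^ 3)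
      (f₃ := fun t => ∑ i, -updStat b d curv₄ (scale b m t) (r i) / t ^ 4)
      (M := m * (100 * (1 + d) / (n / 2) ^ 4))
      (fun t h => HasDerivAt.fun_sum fun i _ => hasDerivAt_score hb d hm (ht0 t h) _)
      (fun t h => HasDerivAt.fun_sum fun i _ =>
        ((hasDerivAt_updStat hb d hm 2 (h := curv₃)
          (fun y hy => by exact_mod_cast hasDerivAt_curv hy) (ht0 t h) (r i)).fun_neg.congr_deriv
            (by ring)).congr_of_eventuallyEq (Filter.Eventually.of_forall fun t => by ring))
      (fun t h => HasDerivAt.fun_sum fun i _ => hasDerivAt_updStat hb d hm 3 (h := curv₄)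
          (fun y hy => by exact_mod_cast hasDerivAt_curv₃ hy) (ht0 t h) (r i))
      (fun t h => by
        refine (Finset.abs_sum_le_sum_abs _ _).trans ?_
        have : ∀ i ∈ Finset.univ, |-updStat b d curv₄ (scale b m t) (r i) / t ^ 4| ≤
            100 * (1 + d) / (n / 2) ^ 4 := fun i _ => by
          have h4 := abs_updStat_le hb d (by norm_num) (fun y hy => abs_curv₄_le hy)
            (scale_pos hb hm (ht0 t h)) (r i)
          have h5 := ht0 t h
          rw [abs_div, abs_neg, abs_of_pos (a := t ^ 4) (by positivity)]
          have h6 := ht t h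
          gcongr
        exact (Finset.sum_le_sum this).trans_eq (by simp))
    simp only [← Finset.sum_div, h, Finset.sum_neg_distrib] at hT
    generalize ∑ i, score b d (scale b m n) (r i) = S at hT ⊢
    generalize ∑ i, updStat b d curv (scale b m n) (r i) = U at hT ⊢
    generalize ∑ i, updStat b d curv₃ (scale b m n) (r i) = W at hT ⊢
    have e1 : S / m - U / m * (x / n - 1) + 1 / 2 * (W / m) * (x / n - 1) ^ 2 =
        -(n / m) * (0 / x - S / n - -U / n ^ 2 * (x - n) - 1 / 2 * (W / n ^ 3) * (x - n) ^ 2) := by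
      field_simp; ring
    have e2 : x - n = n * (x / n - 1) := by field_simp
    rw [e1, abs_mul, abs_neg, abs_of_pos (by positivity)]
    refine (mul_le_mul_of_nonneg_left hT (by positivity)).trans ?_
    have e3 : n / m * (m * (100 * (1 + d) / (n / 2) ^ 4) * |x - n| ^ 3) =
        1600 * (1 + d) * |x / n - 1| ^ 3 := by
      rw [e2, abs_mul, abs_of_pos hn]
      field_simp; norm_num; ring
    rw [e3]
    refine mul_le_mul_of_nonneg_right ?_ (by positivity)
    have : 0 ≤ 1600 * (1 + (d : ℝ)) := by positivity
    nlinarith [abs_nonneg (S / m)]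
  · have h1 : x / n - 1 ≤ -(1 / 2) := by
      have : x / n ≤ 1 / 2 := by rw [div_le_iff₀ hn]; linarith
      linarith
    have h2 : -1 ≤ x / n - 1 := by
      have : 0 < x / n := by positivity
      linarith
    have hU : ∀ (f : ℝ → ℝ) (C : ℝ), 0 ≤ C → (∀ y, 0 < y → |f y| ≤ C) →
        |(∑ i, updStat b d f (scale b m n) (r i)) / m| ≤ C * (1 + d) := fun f C hC hf => by
      rw [abs_div, abs_of_pos hm0, div_le_iff₀ hm0]
      refine (Finset.abs_sum_le_sum_abs _ _).trans
        ((Finset.sum_le_sum fun i _ => abs_updStat_le hb d hC hf hc (r i)).trans_eq ?_)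
      simp; ring
    have u1 := hU curv 3 (by norm_num) fun y hy => abs_curv_le hy
    have u2 := hU curv₃ 14 (by norm_num) fun y hy => abs_curv₃_le hy
    generalize (∑ i, score b d (scale b m n) (r i)) / (m : ℝ) = S at *
    generalize (∑ i, updStat b d curv (scale b m n) (r i)) / (m : ℝ) = U at *
    generalize (∑ i, updStat b d curv₃ (scale b m n) (r i)) / (m : ℝ) = W at *
    generalize x / n - 1 = δ at *
    have hδ : 1 / 2 ≤ |δ| := by rw [abs_of_neg (by linarith)]; linarith
    have hδ1 : |δ| ≤ 1 := by rw [abs_of_neg (by linarith)]; linarith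
    have h3 : 1 / 8 ≤ |δ| ^ 3 := by
      calc (1 / 8 : ℝ) = (1 / 2) ^ 3 := by norm_num
        _ ≤ _ := by gcongr
    have hd : (0 : ℝ) ≤ d := by positivity
    calc |S - U * δ + 1 / 2 * W * δ ^ 2| ≤ |S| + |U| * |δ| + 1 / 2 * |W| * |δ| ^ 2 := by
          refine (abs_add_le _ _).trans ?_
          rw [abs_mul, abs_mul, abs_pow, abs_of_pos (by norm_num : (0 : ℝ) < 1 / 2)]
          gcongr
          refine (abs_sub _ _).trans_eq ?_
          rw [abs_mul]
      _ ≤ |S| + 3 * (1 + d) * 1 + 1 / 2 * (14 * (1 + d)) * 1 ^ 2 := by gcongr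
      _ ≤ 1600 * (1 + d) * (1 + |S|) * (1 / 8) := by
          nlinarith [abs_nonneg S, mul_nonneg hd (abs_nonneg S)]
      _ ≤ _ := by gcongr

theorem exists_one_add_pow_le_exp {κ : ℝ} (hκ : 0 < κ) (N : ℕ) :
    ∃ C, 0 < C ∧ ∀ q, 0 ≤ q → (1 + q) ^ N * Real.exp (-(κ * q)) ≤ C :=
  ⟨N.factorial / κ ^ N * Real.exp κ, by positivity, fun _ hq => one_add_pow_le_exp hκ N hq⟩

theorem normalized_bound {θ : ℝ} (hθ : 0 < θ) : ∃ C, 0 < C ∧ ∀ s S T V P : ℝ, 1 ≤ s → 1 ≤ P →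
    (|S| + |T| + |V|) ^ 3 * (1 + (|S| + |T| + |V|)) ^ 2 * P ^ 4 ≤
      s⁻¹ ^ 3 * (C * (Real.exp (θ * |s * S|) + Real.exp (θ * |s * T|) + Real.exp (θ * |s * V|)) +
        P ^ 8) := by
  -- `(1 + q) ^ 5 * P ^ 4` is split into `(1 + q) ^ 10 + P ^ 8`, so only the eighth moment of `P` is
  -- required. The rate `θ / 3` works because the largest of the three summands of `q` is at least
  -- `q / 3`.
  obtain ⟨C, hC0, hC⟩ := exists_one_add_pow_le_exp (show 0 < θ / 3 by positivity) 10
  refine ⟨C, hC0, fun s S T V P hs hP => ?_⟩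
  have hs0 : 0 < s := by linarith
  set q := |s * S| + |s * T| + |s * V| with hq
  have hq0 : 0 ≤ q := by positivity
  have e : |S| + |T| + |V| = s⁻¹ * q := by
    rw [hq, abs_mul, abs_mul, abs_mul, abs_of_pos hs0]; field_simp
  have h1 : s⁻¹ * q ≤ q := mul_le_of_le_one_left hq0 (inv_le_one_of_one_le₀ hs)
  have h2 := hC q hq0
  rw [Real.exp_neg, ← div_eq_mul_inv, div_le_iff₀ (Real.exp_pos _)] at h2
  have h3 : Real.exp (θ / 3 * q) ≤
      Real.exp (θ * |s * S|) + Real.exp (θ * |s * T|) + Real.exp (θ * |s * V|) := by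
    have p1 := Real.exp_pos (θ * |s * S|)
    have p2 := Real.exp_pos (θ * |s * T|)
    have p3 := Real.exp_pos (θ * |s * V|)
    have hle : ∀ t, q ≤ 3 * t → Real.exp (θ / 3 * q) ≤ Real.exp (θ * t) := fun t ht =>
      Real.exp_le_exp.2 (by nlinarith)
    rcases le_total (|s * S|) (|s * T|) with a | a
    · rcases le_total (|s * T|) (|s * V|) with b | b
      · linarith [hle (|s * V|) (by linarith)]
      · linarith [hle (|s * T|) (by linarith)]
    · rcases le_total (|s * S|) (|s * V|) with b | b
      · linarith [hle (|s * V|) (by linarith)]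
      · linarith [hle (|s * S|) (by linarith)]
  rw [e]
  calc _ = s⁻¹ ^ 3 * (q ^ 3 * (1 + s⁻¹ * q) ^ 2 * P ^ 4) := by ring
    _ ≤ s⁻¹ ^ 3 * ((1 + q) ^ 3 * (1 + q) ^ 2 * P ^ 4) := by
        have : q ≤ 1 + q := by linarith
        gcongr
    _ = s⁻¹ ^ 3 * ((1 + q) ^ 5 * P ^ 4) := by ring
    _ ≤ s⁻¹ ^ 3 * ((1 + q) ^ 10 + P ^ 8) := by
        refine mul_le_mul_of_nonneg_left ?_ (by positivity)
        have h4 := two_mul_le_add_sq ((1 + q) ^ 5) (P ^ 4)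
        have h5 : 0 ≤ (1 + q) ^ 5 * P ^ 4 := by positivity
        rw [← pow_mul, ← pow_mul, mul_assoc] at h4
        exact (le_mul_of_one_le_left h5 one_le_two).trans h4
    _ ≤ _ := mul_le_mul_of_nonneg_left (add_le_add_left
        (h2.trans (mul_le_mul_of_nonneg_left h3 hC0.le)) _) (by positivity)

/-- The pointwise second-order expansion of the maximum-likelihood estimate. -/
theorem exists_mlEstimate_expansion {b : ℝ} (hb : 1 < b) (d : ℕ) : ∃ C, 0 < C ∧
    ∀ m : ℕ, 1 ≤ m → ∀ n : ℝ, 0 < n → ∀ r : Fin m → Register d, ∀ κ S T V W : ℝ,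
      |κ| ≤ 1600 * (1 + d) →
      S = (∑ i, score b d (scale b m n) (r i)) / m →
      T = (∑ i, (latticeSum b 2 (tau b d) (scale b m n) -
        updStat b d curv (scale b m n) (r i))) / m →
      V = (∑ i, (updStat b d curv₃ (scale b m n) (r i) - κ)) / m →
      W = ((∑ i, scale b m n / b ^ (r i).1 / (b - 1)) / m)⁻¹ →
      |mlEstimate b d m r / n - 1 - (S / latticeSum b 2 (tau b d) (scale b m n) +
          T * S / latticeSum b 2 (tau b d) (scale b m n) ^ 2 +
          κ * (S * S) / (2 * latticeSum b 2 (tau b d) (scale b m n) ^ 3))| ≤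
        C * ((|S| + |T| + |V|) ^ 3 * (1 + (|S| + |T| + |V|)) ^ 2 * (1 + W) ^ 4) := by
  obtain ⟨i₀, hi₀, hi⟩ := exists_le_latticeSum_two hb (tau_pos hb d).le
  obtain ⟨C, hC, h⟩ := quadratic_expansion (K := 1600 * (1 + d)) hi₀
    (by have : (0 : ℝ) ≤ d := by positivity
        linarith)
  refine ⟨C, hC, fun m hm n hn r κ S T V W hκ hS hT hV hW => ?_⟩
  have hm0 : (0 : ℝ) < m := by exact_mod_cast hm
  have hne : Nonempty (Fin m) := ⟨⟨0, hm⟩⟩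
  have hc := scale_pos hb hm hn
  have ha : 0 < b - 1 := by linarith
  obtain ⟨hx, hx0⟩ := mlEstimate_spec hb d hm r
  have hA : 0 < (∑ i, scale b m n / b ^ (r i).1 / (b - 1)) / m :=
    div_pos (Finset.sum_pos (fun i _ => by positivity) Finset.univ_nonempty) hm0
  have hW0 : 0 < W := by rw [hW]; positivity
  have hQ : 0 ≤ |S| + |T| + |V| := by positivity
  -- A global bound, valid even when the estimate is far from `n`; it makes the expansion hold for
  -- all register states.
  have hδS : |mlEstimate b d m r / n - 1| ≤ |S| * W := by
    have h1 := abs_ratio_sub_one_le hb d hm hn hx r hx0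
    have h2 : ∑ i, scale b m n / b ^ (r i).1 / (b - 1) ≤
        ∑ i, linStat b d (scale b m n) (r i) :=
      Finset.sum_le_sum fun i _ => le_linStat hb d hc (r i)
    have h3 := (mul_le_mul_of_nonneg_left h2 (abs_nonneg _)).trans h1
    rw [hW, hS, ← div_eq_mul_inv, le_div_iff₀ hA, abs_div, abs_of_pos hm0, ← mul_div_assoc]
    gcongr
  have hT' : T = latticeSum b 2 (tau b d) (scale b m n) -
      (∑ i, updStat b d curv (scale b m n) (r i)) / m := by
    rw [hT, Finset.sum_sub_distrib, sub_div]; simp [hm0.ne']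
  have hV' : V = (∑ i, updStat b d curv₃ (scale b m n) (r i)) / m - κ := by
    rw [hV, Finset.sum_sub_distrib, sub_div]; simp [hm0.ne']
  have hR := abs_score_expansion_le hb d hm hn hx r hx0
  rw [← hS] at hR
  refine h _ κ S T V _ (-(S - (∑ i, updStat b d curv (scale b m n) (r i)) / m *
      (mlEstimate b d m r / n - 1) + 1 / 2 * ((∑ i, updStat b d curv₃ (scale b m n) (r i)) / m) *
        (mlEstimate b d m r / n - 1) ^ 2)) (|S| + |T| + |V|) (1 + W) (hi _ hc) hκ (by linarith)
    (by linarith [abs_nonneg T, abs_nonneg V]) (by linarith [abs_nonneg S, abs_nonneg V])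
    (by linarith [abs_nonneg S, abs_nonneg T]) ?_ ?_ ?_
  · refine hδS.trans (mul_le_mul ?_ (by linarith) hW0.le hQ)
    linarith [abs_nonneg T, abs_nonneg V]
  · rw [abs_neg]
    refine hR.trans (mul_le_mul_of_nonneg_right ?_ (by positivity))
    gcongr
    linarith [abs_nonneg T, abs_nonneg V]
  · rw [hT', hV']; ring

theorem firstOrderBias_eq {b : ℝ} (hb : 1 < b) (d : ℕ) {m : ℕ} (hm : 1 ≤ m) {n : ℝ}
    (hn : 0 < n) : firstOrderBias b d m n = n / m * ((1 / 2 + tau b d) *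
      latticeSum b 3 (tau b d) (scale b m n) / latticeSum b 2 (tau b d) (scale b m n) ^ 2) := by
  obtain ⟨i₀, hi₀, hi⟩ := exists_le_latticeSum_two hb (tau_pos hb d).le
  have h1 := hi₀.trans_le (hi _ (scale_pos hb hm hn))
  have hm0 : (0 : ℝ) < m := by exact_mod_cast hm
  rw [firstOrderBias, (integrable_observedInformation hb d hm hn).2,
    (integrable_biasIntegrand hb d hm hn).2]
  field_simp

/-- The first-order expansion of the bias of the maximum-likelihood estimate, with an explicit order
of the error. -/
theorem exists_bias_expansion {b : ℝ} (hb : 1 < b) (d : ℕ) : ∃ C, 0 < C ∧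
    ∀ m : ℕ, 16 ≤ m → ∀ n : ℝ, 0 < n →
      Integrable (mlEstimate b d m) (sketchLaw b d m n) ∧
        |bias b d m n (mlEstimate b d m) - firstOrderBias b d m n| ≤ C * (√m)⁻¹ ^ 3 * n := by
  have ha : 0 < b - 1 := by linarith
  have hd : (0 : ℝ) ≤ d := by positivity
  obtain ⟨Cs, hCs, hs⟩ := exists_abs_score_le hb d
  obtain ⟨i₀, hi₀, hi⟩ := exists_le_latticeSum_two hb (tau_pos hb d).le
  obtain ⟨C₄, hC₄, h₄⟩ := exists_integral_exp_level_le hb d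
  obtain ⟨C₅, hC₅, h₅⟩ := exists_integral_inv_sqrt_level_le hb d
  obtain ⟨Cq, hCq, hq⟩ := exists_mlEstimate_expansion hb d
  set K := Cs + 28 * (1 + d) with hK
  have hK0 : 0 < K := by positivity
  -- Chosen so that `2 * θ * K` is half the decay rate of `rho`. The constant `K` dominates the
  -- score and both centered statistics, bounded by `6 * (1 + d)` and `28 * (1 + d)`.
  set θ := (b - 1)⁻¹ / (4 * K) with hθ
  have hθ0 : 0 < θ := by positivity
  obtain ⟨Cn, hCn, hn'⟩ := normalized_bound hθ0
  refine ⟨Cq * (Cn * (6 * Real.exp (2 * C₄)) + 2 ^ 7 * (1 + Real.exp (16 * C₅))), by positivity,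
    fun m hm16 n hn => ?_⟩
  have hm : 1 ≤ m := by omega
  have hm0 : (0 : ℝ) < m := by exact_mod_cast hm
  have hs1 : 1 ≤ √(m : ℝ) := Real.one_le_sqrt.2 (by exact_mod_cast hm)
  have hc := scale_pos hb hm hn
  have hprob := isProbabilityMeasure_registerLaw hb d hm hn
  set μ := registerLaw b d m n with hμ
  set c := scale b m n with hcdef
  set i := latticeSum b 2 (tau b d) c with hidef
  have hi0 : 0 < i := hi₀.trans_le (hi c hc)
  set κ := ∫ x, updStat b d curv₃ c x ∂μ with hκ
  have hU2 := (integral_updStat hb d hm hn (by norm_num) fun y hy => abs_curv_le hy).1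
  have hU2i : ∫ x, updStat b d curv c x ∂μ = i := integral_updStat_curv hb d hm hn
  have hU3 := (integral_updStat hb d hm hn (by norm_num) fun y hy => abs_curv₃_le hy).1
  have hbd : ∀ (f : Register d → ℝ) (B : ℝ), (∀ x, |f x| ≤ B) → |∫ x, f x ∂μ| ≤ B := by
    intro f B hf
    have := norm_integral_le_of_norm_le_const (μ := μ) (f := f) (C := B)
      (Filter.Eventually.of_forall hf)
    simpa using this
  have b2 : ∀ x, |updStat b d curv c x| ≤ 3 * (1 + d) := fun x =>
    abs_updStat_le hb d (by norm_num) (fun y hy => abs_curv_le hy) hc x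
  have b3 : ∀ x, |updStat b d curv₃ c x| ≤ 14 * (1 + d) := fun x =>
    abs_updStat_le hb d (by norm_num) (fun y hy => abs_curv₃_le hy) hc x
  have hiB : |i| ≤ 3 * (1 + d) := by rw [← hU2i]; exact hbd _ _ b2
  have hκB : |κ| ≤ 14 * (1 + d) := hbd _ _ b3
  have hsc := integral_score hb d hm hn
  have hmom : ∀ f : Register d → ℝ, ∫ x, f x ∂μ = 0 → (∀ x, |f x| ≤ K * (1 + c / b ^ x.1)) →
      Integrable (fun r : Fin m → Register d => Real.exp (θ * |√m * ((∑ i, f (r i)) / m)|))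
        (Measure.pi fun _ => μ) ∧
      ∫ r : Fin m → Register d, Real.exp (θ * |√m * ((∑ i, f (r i)) / m)|)
        ∂(Measure.pi fun _ => μ) ≤ 2 * Real.exp (2 * C₄) := by
    intro f h0 hf
    have hle : ∀ x : Register d, Real.exp (2 * θ * |f x|) ≤
        Real.exp ((b - 1)⁻¹ / 2 * (1 + c / b ^ x.1)) := fun x => by
      rw [Real.exp_le_exp]
      have e : (b - 1)⁻¹ / 2 * (1 + c / b ^ x.1) = 2 * θ * (K * (1 + c / b ^ x.1)) := by
        rw [hθ]; field_simp; norm_num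
      rw [e]
      exact mul_le_mul_of_nonneg_left (hf x) (by positivity)
    have hint := integrable_of_le (h₄ m hm n hn).1 (f := fun x => Real.exp (2 * θ * |f x|))
      fun x => by rw [abs_of_pos (Real.exp_pos _)]; exact hle x
    exact integral_exp_abs_sum_le μ hm h0 hθ0 hint
      ((integral_mono hint (h₄ m hm n hn).1 hle).trans (h₄ m hm n hn).2)
  have hlev : ∀ x : Register d, 0 ≤ c / b ^ x.1 := fun x => by positivity
  have hT0 : ∫ x, (i - updStat b d curv c x) ∂μ = 0 := by
    rw [integral_sub (integrable_const i) hU2, hU2i]; simp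
  have hV0 : ∫ x, (updStat b d curv₃ c x - κ) ∂μ = 0 := by
    rw [integral_sub hU3 (integrable_const κ)]
    simp only [integral_const, probReal_univ, smul_eq_mul, one_mul]
    exact sub_self _
  obtain ⟨iS, jS⟩ := hmom (score b d c) hsc.2 fun x => (hs c hc x).trans (by
    have := hlev x
    gcongr; rw [hK]; linarith)
  obtain ⟨iT, jT⟩ := hmom (fun x => i - updStat b d curv c x) hT0 fun x => by
    refine (abs_sub _ _).trans ((add_le_add hiB (b2 x)).trans ?_)
    have := hlev x
    nlinarith [mul_nonneg hK0.le this]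
  obtain ⟨iV, jV⟩ := hmom (fun x => updStat b d curv₃ c x - κ) hV0 fun x => by
    refine (abs_sub _ _).trans ((add_le_add (b3 x) hκB).trans ?_)
    have := hlev x
    nlinarith [mul_nonneg hK0.le this]
  obtain ⟨iW, jW⟩ :=
    integral_inv_mean_pow_le μ hm16 (u := fun x : Register d => c / b ^ x.1 / (b - 1))
    (fun x => by positivity) (h₅ m hm n hn).1 (h₅ m hm n hn).2
  set S : (Fin m → Register d) → ℝ := fun r => (∑ i, score b d c (r i)) / m with hS
  set T : (Fin m → Register d) → ℝ := fun r => (∑ j, (i - updStat b d curv c (r j))) / m with hT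
  set V : (Fin m → Register d) → ℝ := fun r => (∑ j, (updStat b d curv₃ c (r j) - κ)) / m with hV
  set W : (Fin m → Register d) → ℝ := fun r => ((∑ j, c / b ^ (r j).1 / (b - 1)) / m)⁻¹ with hW
  -- `main` is the explicit second-order part. `dom` is integrable with a bound independent of `m`
  -- and `n`, and carries the prefactor `m ^ (-3/2)` in `hpt`.
  set main : (Fin m → Register d) → ℝ := fun r => S r / i + T r * S r / i ^ 2 +
    κ * (S r * S r) / (2 * i ^ 3) with hmain
  set dom : (Fin m → Register d) → ℝ := fun r => Cn * (Real.exp (θ * |√m * S r|) +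
    Real.exp (θ * |√m * T r|) + Real.exp (θ * |√m * V r|)) + 2 ^ 7 * (1 + W r ^ 8) with hdom
  have hpt : ∀ r, |mlEstimate b d m r / n - 1 - main r| ≤ Cq * ((√m)⁻¹ ^ 3 * dom r) := by
    intro r
    refine (hq m hm n hn r κ (S r) (T r) (V r) (W r) (hκB.trans (by gcongr; norm_num)) rfl rfl rfl
      rfl).trans (mul_le_mul_of_nonneg_left ?_ hCq.le)
    have hW0 : 0 ≤ W r := by
      have : 0 ≤ ∑ j, c / b ^ (r j).1 / (b - 1) := Finset.sum_nonneg fun j _ => by positivity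
      simp only [hW]; positivity
    refine (hn' (√m) (S r) (T r) (V r) (1 + W r) hs1 (by linarith)).trans
      (mul_le_mul_of_nonneg_left (add_le_add_right ?_ _) (by positivity))
    have := add_pow_le zero_le_one hW0 8
    simpa using this
  have iD : Integrable dom (sketchLaw b d m n) :=
    (((iS.add iT).add iV).const_mul Cn).add (((integrable_const 1).add iW).const_mul _)
  have jD : ∫ r, dom r ∂(sketchLaw b d m n) ≤
      Cn * (6 * Real.exp (2 * C₄)) + 2 ^ 7 * (1 + Real.exp (16 * C₅)) := by
    have e1 := integral_add (((iS.add iT).add iV).const_mul Cn)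
      (((integrable_const (μ := Measure.pi fun _ : Fin m => μ) (1 : ℝ)).add iW).const_mul (2 ^ 7))
    refine (e1.trans ?_).le.trans (add_le_add (mul_le_mul_of_nonneg_left
      ((add_le_add (add_le_add jS jT) jV).trans_eq (by ring)) hCn.le)
      (mul_le_mul_of_nonneg_left (add_le_add_right jW 1) (by norm_num)))
    rw [integral_const_mul, integral_const_mul, integral_add' (iS.add iT) iV, integral_add' iS iT,
      integral_add' (integrable_const 1) iW]
    simp
  obtain ⟨iS1, jS1⟩ := integral_sum_pi μ m hsc.1
  have hss := integral_score_sq hb d hm hn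
  obtain ⟨iSS, jSS⟩ := integral_sum_mul_sum_pi μ m hsc.1 hsc.1 hss.1 hsc.2
  have hus := integral_updStat_mul_score hb d hm hn
  have hts : (fun x => (i - updStat b d curv c x) * score b d c x) =
      fun x => i * score b d c x - updStat b d curv c x * score b d c x := by
    funext x; ring
  have its : Integrable (fun x => (i - updStat b d curv c x) * score b d c x) μ := by
    rw [hts]; exact (hsc.1.const_mul i).sub hus.1
  obtain ⟨iTS, jTS⟩ := integral_sum_mul_sum_pi μ m ((integrable_const i).sub hU2) hsc.1 its hsc.2
  have iTS' : Integrable (fun r : Fin m → Register d => (∑ j, (i - updStat b d curv c (r j))) *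
      ∑ j, score b d c (r j)) (sketchLaw b d m n) := iTS
  have jts : ∫ x, (i - updStat b d curv c x) * score b d c x ∂μ =
      -∫ x, updStat b d curv c x * score b d c x ∂μ := by
    rw [hts, integral_sub (hsc.1.const_mul i) hus.1, integral_const_mul, hsc.2]; ring
  have hmain' : main = fun r => (m * i)⁻¹ * (∑ j, score b d c (r j)) +
      (m ^ 2 * i ^ 2 : ℝ)⁻¹ * ((∑ j, (i - updStat b d curv c (r j))) * ∑ j, score b d c (r j)) +
      (κ * (2 * m ^ 2 * i ^ 3)⁻¹) * ((∑ j, score b d c (r j)) * ∑ j, score b d c (r j)) := by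
    funext r
    simp only [hmain, hS, hT]
    field_simp
  have iM : Integrable main (sketchLaw b d m n) := by
    rw [hmain']
    exact ((iS1.const_mul _).add (iTS'.const_mul _)).add (iSS.const_mul _)
  -- The linear term has mean zero. The other two give `(κ / 2 - E(curvature * score)) / (m i²)`,
  -- because `E(score²) = i` cancels one power of `i`; `integral_third_order` evaluates this
  -- difference.
  have jM : ∫ r, main r ∂(sketchLaw b d m n) =
      (1 / 2 + tau b d) * latticeSum b 3 (tau b d) c / i ^ 2 / m := by
    have e1 : ∫ r, main r ∂(sketchLaw b d m n) = (m * i)⁻¹ * (m * 0) +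
        (m ^ 2 * i ^ 2 : ℝ)⁻¹ * (m * (-∫ x, updStat b d curv c x * score b d c x ∂μ)) +
        (κ * (2 * m ^ 2 * i ^ 3)⁻¹) * (m * i) := by
      have q1 : ∫ r, ∑ j, score b d c (r j) ∂(sketchLaw b d m n) = m * 0 :=
        jS1.trans (congrArg _ hsc.2)
      have q2 : ∫ r, (∑ j, (i - updStat b d curv c (r j))) * ∑ j, score b d c (r j)
          ∂(sketchLaw b d m n) = m * (-∫ x, updStat b d curv c x * score b d c x ∂μ) :=
        jTS.trans (congrArg _ jts)
      have q3 : ∫ r, (∑ j, score b d c (r j)) * ∑ j, score b d c (r j) ∂(sketchLaw b d m n) =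
          m * i := jSS.trans (congrArg _ hss.2)
      rw [hmain']
      refine (integral_add ((iS1.const_mul _).add (iTS'.const_mul _)) (iSS.const_mul _)).trans ?_
      rw [integral_add' (iS1.const_mul _) (iTS'.const_mul _), integral_const_mul,
        integral_const_mul, integral_const_mul]
      exact congrArg₂ (· + ·) (congrArg₂ (· + ·) (congrArg _ q1) (congrArg _ q2)) (congrArg _ q3)
    rw [e1, ← integral_third_order hb d hm hn]
    field_simp
    ring
  have iδ : Integrable (fun r => mlEstimate b d m r / n - 1) (sketchLaw b d m n) := by
    refine ((integrable_of_le ((iD.const_mul _).const_mul _) hpt).add iM).congr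
      (Filter.Eventually.of_forall fun r => ?_)
    simp
  have iE : Integrable (mlEstimate b d m) (sketchLaw b d m n) := by
    have : IsProbabilityMeasure (sketchLaw b d m n) := by unfold sketchLaw; infer_instance
    refine ((iδ.add (integrable_const 1)).const_mul n).congr
      (Filter.Eventually.of_forall fun r => ?_)
    simp only [Pi.add_apply, sub_add_cancel]
    field_simp
  refine ⟨iE, ?_⟩
  have hbias : bias b d m n (mlEstimate b d m) =
      n * ∫ r, (mlEstimate b d m r / n - 1) ∂(sketchLaw b d m n) := by
    have : IsProbabilityMeasure (sketchLaw b d m n) := by unfold sketchLaw; infer_instance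
    rw [bias, integral_sub (iE.div_const n) (integrable_const 1), integral_div]
    simp only [integral_const, probReal_univ, smul_eq_mul, mul_one]
    field_simp
  rw [hbias, firstOrderBias_eq hb d hm hn]
  have e2 : n * ∫ r, (mlEstimate b d m r / n - 1) ∂(sketchLaw b d m n) -
      n / m * ((1 / 2 + tau b d) * latticeSum b 3 (tau b d) (scale b m n) /
        latticeSum b 2 (tau b d) (scale b m n) ^ 2) =
      n * ∫ r, (mlEstimate b d m r / n - 1 - main r) ∂(sketchLaw b d m n) := by
    rw [integral_sub iδ iM, jM]
    ring
  rw [e2, abs_mul, abs_of_pos hn, mul_comm n]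
  refine mul_le_mul_of_nonneg_right ?_ hn.le
  refine (abs_integral_le_integral_abs).trans ((integral_mono (iδ.sub iM).abs
    ((iD.const_mul _).const_mul _) hpt).trans ?_)
  rw [integral_const_mul, integral_const_mul]
  calc _ ≤ Cq * ((√m)⁻¹ ^ 3 *
        (Cn * (6 * Real.exp (2 * C₄)) + 2 ^ 7 * (1 + Real.exp (16 * C₅)))) := by gcongr
    _ = _ := by ring

theorem bias_expansion {b : ℝ} (hb : 1 < b) (d : ℕ) {ε : ℝ} (hε : 0 < ε) :
    ∃ M : ℕ, 1 ≤ M ∧ ∀ m : ℕ, M ≤ m → ∀ n : ℝ, 0 < n →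
      Integrable (mlEstimate b d m) (sketchLaw b d m n) ∧
        |bias b d m n (mlEstimate b d m) - firstOrderBias b d m n| ≤ ε * (n / m) ∧
        |bias b d m n (correctedEstimate b d m) -
          (firstOrderBias b d m n - approxBias b d m n)| ≤ ε * (n / m) := by
  obtain ⟨C, hC, h⟩ := exists_bias_expansion hb d
  obtain ⟨i₀, hi₀, hi⟩ := exists_le_latticeSum_two hb (tau_pos hb d).le
  obtain ⟨L, hL, hL3⟩ := (isDamped_kern (p := 3) (by norm_num) (tau_pos hb d).le).exists_tsum_le hb
  have ht := tau_pos hb d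
  set B := (1 / 2 + tau b d) * L / i₀ ^ 2 with hB
  have hB0 : 0 < B := by positivity
  set k := biasConstant b d with hk
  have hk0 : 0 ≤ k := by
    have hz : ∀ s a : ℝ, 0 < a → 0 ≤ hurwitzZeta s a := fun s a ha =>
      tsum_nonneg fun j => by positivity
    have := Real.log_pos hb
    have h1 := hz 3 (1 + tau b d) (by positivity)
    have h2 := hz 2 (1 + tau b d) (by positivity)
    rw [hk, biasConstant]
    positivity
  have hlim : Filter.Tendsto (fun m : ℕ => C * (√(m : ℝ))⁻¹ + (k ^ 2 + (B + C) * k) * (m : ℝ)⁻¹)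
      Filter.atTop (nhds 0) := by
    have h1 : Filter.Tendsto (fun m : ℕ => (m : ℝ)⁻¹) Filter.atTop (nhds 0) :=
      tendsto_inv_atTop_nhds_zero_nat
    have h2 : Filter.Tendsto (fun m : ℕ => (√(m : ℝ))⁻¹) Filter.atTop (nhds 0) :=
      tendsto_inv_atTop_zero.comp (Real.tendsto_sqrt_atTop.comp tendsto_natCast_atTop_atTop)
    simpa using (h2.const_mul C).add (h1.const_mul (k ^ 2 + (B + C) * k))
  obtain ⟨M, hM⟩ := (hlim.eventually (gt_mem_nhds hε)).exists_forall_of_atTop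
  refine ⟨max M 16, by omega, fun m hm n hn => ?_⟩
  have hm16 : 16 ≤ m := (le_max_right _ _).trans hm
  have hm1 : 1 ≤ m := by omega
  have hm0 : (0 : ℝ) < m := by exact_mod_cast hm1
  have hMm := (hM m ((le_max_left _ _).trans hm)).le
  have hs1 : 1 ≤ √(m : ℝ) := Real.one_le_sqrt.2 (by exact_mod_cast hm1)
  have hs0 : 0 < √(m : ℝ) := by linarith
  have hc := scale_pos hb hm1 hn
  obtain ⟨hI, hbias⟩ := h m hm16 n hn
  have e3 : (√(m : ℝ))⁻¹ ^ 3 = (√(m : ℝ))⁻¹ * (m : ℝ)⁻¹ := by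
    rw [pow_succ', inv_pow, Real.sq_sqrt hm0.le]
  set x := bias b d m n (mlEstimate b d m) with hx
  set y := firstOrderBias b d m n with hy
  have hxy : |x - y| ≤ C * (√(m : ℝ))⁻¹ * (n / m) := by
    refine hbias.trans_eq ?_
    rw [e3]; ring
  have hyB : |y| ≤ B * (n / m) := by
    rw [hy, firstOrderBias_eq hb d hm1 hn, abs_mul, abs_of_pos (by positivity), mul_comm]
    refine mul_le_mul_of_nonneg_right ?_ (by positivity)
    have h1 := hi₀.trans_le (hi _ hc)
    have h2 := hi _ hc
    have h3 := hL3 _ hc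
    rw [abs_div, abs_mul, abs_of_pos (a := 1 / 2 + tau b d) (by positivity),
      abs_of_pos (a := _ ^ 2) (by positivity), hB]
    rw [← latticeSum] at h3
    gcongr
  have hxB : |x| ≤ (B + C) * (n / m) := by
    have h1 : |x| ≤ |x - y| + |y| := by simpa using abs_add_le (x - y) y
    have h2 : C * (√(m : ℝ))⁻¹ * (n / m) ≤ C * (n / m) := by
      refine mul_le_mul_of_nonneg_right ?_ (by positivity)
      exact mul_le_of_le_one_right hC.le (inv_le_one_of_one_le₀ hs1)
    linarith
  have hp : 0 ≤ (k ^ 2 + (B + C) * k) * (m : ℝ)⁻¹ := by positivity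
  have hp2 : 0 ≤ C * (√(m : ℝ))⁻¹ := by positivity
  have hnm : 0 ≤ n / m := by positivity
  refine ⟨hI, hxy.trans (mul_le_mul_of_nonneg_right (by linarith) hnm), ?_⟩
  have hq : 0 < 1 + 1 / (m : ℝ) * k := by positivity
  have hcorr : bias b d m n (correctedEstimate b d m) =
      (x + n) * (1 + 1 / (m : ℝ) * k)⁻¹ - n := by
    simp only [bias, correctedEstimate, hx, integral_mul_const, sub_add_cancel, hk]
  -- Dividing by `1 + k / m` subtracts `n k / m`, the approximate bias, up to errors of order `n /
  -- m²` since the bias `x` is itself `O(n / m)`.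
  have e4 : bias b d m n (correctedEstimate b d m) - (y - approxBias b d m n) =
      (x - y) + (n / m * (k ^ 2 * (m : ℝ)⁻¹) - x * (k * (m : ℝ)⁻¹)) *
        (1 + 1 / (m : ℝ) * k)⁻¹ := by
    rw [hcorr, approxBias, ← hk]
    field_simp
    ring
  rw [e4]
  have hq1 : (1 + 1 / (m : ℝ) * k)⁻¹ ≤ 1 :=
    inv_le_one_of_one_le₀ (le_add_of_nonneg_right (by positivity))
  calc _ ≤ |x - y| + |n / m * (k ^ 2 * (m : ℝ)⁻¹) - x * (k * (m : ℝ)⁻¹)| * 1 := by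
        refine (abs_add_le _ _).trans ?_
        rw [abs_mul, abs_of_pos (a := (_)⁻¹) (by positivity)]
        gcongr
    _ ≤ C * (√(m : ℝ))⁻¹ * (n / m) + (n / m * (k ^ 2 * (m : ℝ)⁻¹) +
          (B + C) * (n / m) * (k * (m : ℝ)⁻¹)) := by
        rw [mul_one]
        refine add_le_add hxy ((abs_sub _ _).trans
          (add_le_add (abs_of_nonneg (by positivity)).le ?_))
        rw [abs_mul, abs_of_nonneg (a := k * _) (by positivity)]
        gcongr
    _ = (C * (√(m : ℝ))⁻¹ + (k ^ 2 + (B + C) * k) * (m : ℝ)⁻¹) * (n / m) := by ring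
    _ ≤ _ := by gcongr

/-! ### Poisson summation over the levels -/

/-- The kernel `kern p τ` on a logarithmic scale. -/
def logKern (h : ℝ) (p : ℕ) (τ t : ℝ) : ℂ := (kern p τ (Real.exp (-(h * t))) : ℂ)

theorem continuous_logKern (h : ℝ) (p : ℕ) (τ : ℝ) : Continuous (logKern h p τ) := by
  unfold logKern kern bose
  refine Complex.continuous_ofReal.comp (Continuous.mul (Continuous.mul (by fun_prop) ?_)
    (by fun_prop))
  exact Continuous.inv₀ (by fun_prop) fun t => (exp_sub_one_pos (Real.exp_pos _)).ne'

theorem damp_exp_le (u : ℝ) : damp (Real.exp u) ≤ Real.exp (-(|u| / 2)) := by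
  have hs : √(Real.exp u) = Real.exp (u / 2) := by rw [Real.exp_half]
  rcases le_total 0 u with h | h
  · refine (damp_le_inv_sqrt (Real.exp_pos u)).trans_eq ?_
    rw [hs, ← Real.exp_neg, abs_of_nonneg h]
  · refine (damp_le_sqrt (Real.exp_pos u)).trans_eq ?_
    rw [hs, abs_of_nonpos h]
    ring_nf

/-- On the logarithmic scale damping is exponential decay; exponent `-2` is enough for Poisson
summation. -/
theorem isBigO_logKern {h : ℝ} (hh : 0 < h) {p : ℕ} (hp : 2 ≤ p) {τ : ℝ} (hτ : 0 ≤ τ) :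
    logKern h p τ =O[Filter.cocompact ℝ] fun x : ℝ => |x| ^ (-2 : ℝ) := by
  obtain ⟨C, hC⟩ := isDamped_kern hp hτ
  have hC0 : 0 ≤ C := by
    have h1 := (abs_nonneg _).trans (hC 1 one_pos)
    have h2 : 0 < damp 1 := by unfold damp; norm_num
    exact nonneg_of_mul_nonneg_left h1 h2
  refine Asymptotics.IsBigO.of_bound (C * (8 / h ^ 2)) ?_
  have h0 : ∀ᶠ x : ℝ in Filter.cocompact ℝ, x ∉ ({0} : Set ℝ) :=
    isCompact_singleton.compl_mem_cocompact
  filter_upwards [h0] with t ht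
  have ht0 : 0 < |t| := abs_pos.2 (by simpa using ht)
  have hu : 0 < h * |t| / 2 := by positivity
  have e1 : |-(h * t)| / 2 = h * |t| / 2 := by rw [abs_neg, abs_mul, abs_of_pos hh]
  have e2 := Real.quadratic_le_exp_of_nonneg hu.le
  have e3 : Real.exp (-(h * |t| / 2)) ≤ 8 / h ^ 2 * (|t| ^ 2)⁻¹ := by
    rw [Real.exp_neg]
    have : 8 / h ^ 2 * (|t| ^ 2)⁻¹ = (h ^ 2 * |t| ^ 2 / 8)⁻¹ := by field_simp
    rw [this]
    refine inv_anti₀ (by positivity) ?_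
    nlinarith
  have e4 : ‖(|t| ^ (-2 : ℝ))‖ = (|t| ^ 2)⁻¹ := by
    rw [Real.rpow_neg (abs_nonneg t), Real.norm_of_nonneg (by positivity)]
    norm_cast
  rw [e4, logKern, Complex.norm_real, Real.norm_eq_abs, mul_assoc]
  refine (hC _ (Real.exp_pos _)).trans (mul_le_mul_of_nonneg_left ?_ hC0)
  refine (damp_exp_le _).trans ?_
  rw [e1]
  exact e3

theorem summable_norm_restrict_logKern {h : ℝ} (hh : 0 < h) {p : ℕ} (hp : 2 ≤ p) {τ : ℝ}
    (hτ : 0 ≤ τ) (K : TopologicalSpace.Compacts ℝ) : Summable fun n : ℤ =>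
      ‖((⟨_, continuous_logKern h p τ⟩ : C(ℝ, ℂ)).comp
        (ContinuousMap.addRight (n : ℝ))).restrict K‖ :=
  summable_of_isBigO (Real.summable_abs_int_rpow one_lt_two)
    ((isBigO_norm_restrict_cocompact ⟨_, continuous_logKern h p τ⟩ two_pos
      (isBigO_logKern hh hp hτ) K).comp_tendsto Int.tendsto_coe_cofinite)

theorem latticeSum_eq_tsum_logKern {b : ℝ} (hb : 1 < b) (p : ℕ) (τ : ℝ) {c : ℝ} (hc : 0 < c) :
    (latticeSum b p τ c : ℂ) =
      ∑' k : ℤ, logKern (Real.log b) p τ (-(Real.log c / Real.log b) + k) := by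
  have hl : 0 < Real.log b := Real.log_pos hb
  rw [latticeSum, Complex.ofReal_tsum]
  refine tsum_congr fun k => ?_
  rw [logKern]
  congr 2
  have : -(Real.log b * (-(Real.log c / Real.log b) + k)) = Real.log c - k * Real.log b := by
    field_simp
    ring
  rw [this, Real.exp_sub, Real.exp_log hc, ← Real.log_zpow, Real.exp_log (by positivity)]

-- The substitution `y = exp (-(h * t))` turns the Fourier integral into a Mellin integral on the
-- line `Re s = p`; the power `y ^ p` of the kernel becomes the real part of the argument.
open FourierTransform in
theorem fourier_logKern {h : ℝ} (hh : 0 < h) (p : ℕ) (τ w : ℝ) :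
    𝓕 (logKern h p τ) w = (h : ℂ)⁻¹ *
      mellin (fun y => ((bose y * Real.exp (-(τ * y)) : ℝ) : ℂ))
        (p + (2 * Real.pi * w / h : ℝ) * Complex.I) := by
  rw [mellin_eq_fourier, Real.fourier_real_eq, Real.fourier_real_eq]
  have h1 := Measure.integral_comp_mul_left (fun u : ℝ => Real.fourierChar (-(u * (w / h))) •
    (kern p τ (Real.exp (-u)) : ℂ)) h
  rw [abs_of_pos (inv_pos.2 hh), Complex.real_smul, Complex.ofReal_inv] at h1
  have e : (2 * Real.pi * w / h) / (2 * Real.pi) = w / h := by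
    field_simp
  refine Eq.trans (integral_congr_ae (Filter.Eventually.of_forall fun v => ?_))
    (h1.trans (congrArg _ (integral_congr_ae (Filter.Eventually.of_forall fun v => ?_))))
  · simp only [logKern]
    rw [show h * v * (w / h) = v * w by field_simp]
  · simp only [Complex.add_im, Complex.natCast_im, Complex.mul_im, Complex.ofReal_re,
      Complex.ofReal_im, Complex.I_re, Complex.I_im, mul_one, mul_zero, add_zero,
      zero_add, e, Complex.add_re, Complex.natCast_re, Complex.mul_re, sub_zero]
    congr 1
    rw [kern, Complex.real_smul, ← Complex.ofReal_mul, ← Real.exp_nat_mul]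
    congr 1
    ring_nf

theorem hasSum_bose_mul_exp (τ : ℝ) {y : ℝ} (hy : 0 < y) :
    HasSum (fun k : ℕ => Real.exp (-((k : ℝ) + (1 + τ)) * y)) (bose y * Real.exp (-(τ * y))) := by
  have h1 := (hasSum_geometric_of_lt_one (Real.exp_pos (-y)).le
    (Real.exp_lt_one_iff.2 (by linarith))).mul_left (Real.exp (-(1 + τ) * y))
  have h2 := one_sub_exp_neg_mul_bose hy
  have h3 := one_sub_exp_neg_pos hy
  have h4 : Real.exp (-(1 + τ) * y) * (1 - Real.exp (-y))⁻¹ = bose y * Real.exp (-(τ * y)) := by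
    rw [← div_eq_mul_inv, div_eq_iff h3.ne', mul_right_comm, mul_comm (bose y), h2,
      ← Real.exp_add]
    ring_nf
  rw [← h4]
  refine h1.congr_fun fun k => ?_
  rw [← Real.exp_nat_mul, ← Real.exp_add]
  ring_nf

theorem summable_hurwitz {s a : ℝ} (hs : 1 < s) (ha : 0 < a) :
    Summable fun k : ℕ => ((k : ℝ) + a) ^ (-s) := by
  have := (Real.summable_one_div_nat_add_rpow a s).2 hs
  refine this.congr fun k => ?_
  rw [abs_of_pos (by positivity), Real.rpow_neg (by positivity), one_div]

theorem hurwitzZeta_pos {s a : ℝ} (hs : 1 < s) (ha : 0 < a) : 0 < hurwitzZeta s a :=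
  (summable_hurwitz hs ha).tsum_pos (fun k => by positivity) 0 (by positivity)

theorem hasSum_mellin_bose {τ : ℝ} (hτ : 0 ≤ τ) {s : ℂ} (hs : 1 < s.re) :
    HasSum (fun k : ℕ => Complex.Gamma s / (((k : ℝ) + (1 + τ) : ℝ) : ℂ) ^ s)
      (mellin (fun y => ((bose y * Real.exp (-(τ * y)) : ℝ) : ℂ)) s) := by
  have := hasSum_mellin (a := fun _ : ℕ => (1 : ℂ)) (p := fun k => (k : ℝ) + (1 + τ))
    (F := fun y => ((bose y * Real.exp (-(τ * y)) : ℝ) : ℂ)) (s := s)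
    (fun k => Or.inr (by positivity)) (by linarith) (fun t ht => ?_) ?_
  · simpa using this
  · simpa using Complex.hasSum_ofReal.2 (hasSum_bose_mul_exp τ ht)
  · refine (summable_hurwitz hs (show 0 < 1 + τ by positivity)).congr fun k => ?_
    rw [norm_one, Real.rpow_neg (by positivity), one_div]

/-- `|(k + a) ^ s|` depends on `Re s` only. So every Fourier coefficient carries the same zeta
factor as the mean, and the relative error does not involve `τ`. -/
theorem norm_mellin_bose_le {τ : ℝ} (hτ : 0 ≤ τ) {s : ℂ} (hs : 1 < s.re) :
    ‖mellin (fun y => ((bose y * Real.exp (-(τ * y)) : ℝ) : ℂ)) s‖ ≤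
      ‖Complex.Gamma s‖ * hurwitzZeta s.re (1 + τ) := by
  rw [← (hasSum_mellin_bose hτ hs).tsum_eq, hurwitzZeta, ← tsum_mul_left]
  refine tsum_of_norm_bounded
    ((summable_hurwitz hs (show 0 < 1 + τ by positivity)).mul_left _).hasSum fun k => ?_
  rw [norm_div, Complex.norm_cpow_eq_rpow_re_of_pos (by positivity), Real.rpow_neg (by positivity),
    div_eq_mul_inv]

theorem mellin_bose_nat {τ : ℝ} (hτ : 0 ≤ τ) {p : ℕ} (hp : 2 ≤ p) :
    mellin (fun y => ((bose y * Real.exp (-(τ * y)) : ℝ) : ℂ)) p =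
      (((p - 1).factorial * hurwitzZeta p (1 + τ) : ℝ) : ℂ) := by
  have h1 : 1 < (p : ℂ).re := by rw [Complex.natCast_re]; exact_mod_cast hp
  rw [← (hasSum_mellin_bose hτ h1).tsum_eq, hurwitzZeta, ← tsum_mul_left, Complex.ofReal_tsum]
  refine tsum_congr fun k => ?_
  have hg : Complex.Gamma p = ((p - 1).factorial : ℂ) := by
    obtain ⟨q, rfl⟩ := Nat.exists_eq_add_of_le' (show 1 ≤ p by omega)
    have := Complex.Gamma_nat_eq_factorial q
    push_cast
    simpa using this
  rw [hg, Real.rpow_neg (by positivity), Real.rpow_natCast, Complex.cpow_natCast, div_eq_mul_inv]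
  push_cast
  rfl

open FourierTransform in
/-- The mean of a lattice sum over a period. -/
theorem integral_latticeSum {b : ℝ} (hb : 1 < b) {p : ℕ} (hp : 2 ≤ p) {τ : ℝ} (hτ : 0 ≤ τ) {c : ℝ}
    (hc : 0 < c) : ∫ x in (0 : ℝ)..1, latticeSum b p τ (c * b ^ x) =
      (Real.log b)⁻¹ * ((p - 1).factorial * hurwitzZeta p (1 + τ)) := by
  have hl : 0 < Real.log b := Real.log_pos hb
  have hb0 : 0 < b := by linarith
  have hsum := summable_norm_restrict_logKern hl hp hτ
  have h1 := Real.fourierCoeff_tsum_comp_add hsum 0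
  -- The mean is the zeroth Fourier coefficient of the periodization. The base point is the image of
  -- `x = 1` under `x ↦ -(log c / log b) - x`, so that the substitution maps `[0, 1]` onto the
  -- chosen period.
  rw [fourierCoeff_eq_intervalIntegral _ _ (-(Real.log c / Real.log b) - 1)] at h1
  have hval : ∀ y : ℝ, ((∑' n : ℤ, (⟨_, continuous_logKern (Real.log b) p τ⟩ : C(ℝ, ℂ)).comp
      (ContinuousMap.addRight (n • (1 : ℝ)))) y) = ∑' k : ℤ, logKern (Real.log b) p τ (y + k) := by
    intro y
    have hs : Summable fun n : ℤ => (⟨_, continuous_logKern (Real.log b) p τ⟩ : C(ℝ, ℂ)).comp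
      (ContinuousMap.addRight (n • (1 : ℝ))) := by
      simpa using ContinuousMap.summable_of_locally_summable_norm hsum
    rw [← ContinuousMap.tsum_apply hs]
    simp
  have h2 : ∫ x in (0 : ℝ)..1, (latticeSum b p τ (c * b ^ x) : ℂ) =
      ∫ y in (-(Real.log c / Real.log b) - 1)..(-(Real.log c / Real.log b) - 0),
        ∑' k : ℤ, logKern (Real.log b) p τ (y + k) := by
    rw [← intervalIntegral.integral_comp_sub_left]
    refine intervalIntegral.integral_congr fun x _ => ?_
    have hbx : 0 < b ^ x := Real.rpow_pos_of_pos hb0 x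
    rw [latticeSum_eq_tsum_logKern hb p τ (by positivity), Real.log_mul hc.ne' hbx.ne',
      Real.log_rpow hb0]
    have : -((Real.log c + x * Real.log b) / Real.log b) = -(Real.log c / Real.log b) - x := by
      field_simp
      ring
    rw [this]
  have h3 := h1.trans (fourier_logKern hl p τ ((0 : ℤ) : ℝ))
  rw [show (-(Real.log c / Real.log b) - 1 + 1) = -(Real.log c / Real.log b) - 0 by ring] at h3
  simp only [Int.cast_zero, mul_zero, zero_div, Complex.ofReal_zero, zero_mul, add_zero,
    mellin_bose_nat hτ hp, neg_zero, _root_.fourier_zero, one_smul, div_one,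
    Function.Periodic.lift_coe, hval] at h3
  rw [← h2, intervalIntegral.integral_ofReal] at h3
  exact_mod_cast h3

/-! ### The Gamma function on vertical lines -/

/-- The reflection formula at `v * I`, combined with `conj Γ(1 + i v) = Γ(1 - i v)` and `Γ(1 + i v)
= i v Γ(i v)`. -/
theorem normSq_Gamma_one_add_mul_I {v : ℝ} (hv : 0 < v) :
    ‖Complex.Gamma (1 + v * Complex.I)‖ ^ 2 = Real.pi * v / Real.sinh (Real.pi * v) := by
  have hvI : (v : ℂ) * Complex.I ≠ 0 := by simp [hv.ne']
  have h1 := Complex.Gamma_add_one _ hvI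
  have h2 := Complex.Gamma_mul_Gamma_one_sub (v * Complex.I)
  have h3 : Complex.Gamma (1 - v * Complex.I) =
      (starRingEnd ℂ) (Complex.Gamma (1 + v * Complex.I)) := by
    rw [← Complex.Gamma_conj]
    simp [sub_eq_add_neg]
  have hs : Real.sinh (Real.pi * v) ≠ 0 := (Real.sinh_pos_iff.2 (by positivity)).ne'
  have h4 : Complex.sin (Real.pi * (v * Complex.I)) =
      (Real.sinh (Real.pi * v) : ℂ) * Complex.I := by
    rw [← mul_assoc, Complex.sin_mul_I]
    push_cast
    rfl
  have h5 : ((‖Complex.Gamma (1 + v * Complex.I)‖ ^ 2 : ℝ) : ℂ) =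
      ((Real.pi * v / Real.sinh (Real.pi * v) : ℝ) : ℂ) := by
    rw [Complex.ofReal_pow, ← Complex.mul_conj', ← h3, add_comm (1 : ℂ), h1, mul_assoc, h2, h4]
    have hs' : (Real.sinh (Real.pi * v) : ℂ) ≠ 0 := by exact_mod_cast hs
    have hI := Complex.I_ne_zero
    push_cast at hs' ⊢
    field_simp
  exact_mod_cast h5

theorem norm_add_mul_I_sq (x v : ℝ) : ‖(x : ℂ) + v * Complex.I‖ ^ 2 = x ^ 2 + v ^ 2 := by
  rw [Complex.sq_norm, Complex.normSq_add_mul_I]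

theorem normSq_Gamma_two_add_mul_I {v : ℝ} (hv : 0 < v) :
    ‖Complex.Gamma (2 + v * Complex.I)‖ ^ 2 =
      (1 + v ^ 2) * (Real.pi * v / Real.sinh (Real.pi * v)) := by
  have h0 : (1 : ℂ) + v * Complex.I ≠ 0 := fun h => by
    have := congrArg Complex.re h
    simp at this
  have h1 := Complex.Gamma_add_one _ h0
  have h2 := norm_add_mul_I_sq 1 v
  rw [show (2 : ℂ) + v * Complex.I = 1 + v * Complex.I + 1 by ring, h1, norm_mul, mul_pow,
    normSq_Gamma_one_add_mul_I hv]
  norm_num at h2 ⊢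
  exact Or.inl h2

theorem normSq_Gamma_three_add_mul_I {v : ℝ} (hv : 0 < v) :
    ‖Complex.Gamma (3 + v * Complex.I)‖ ^ 2 =
      (4 + v ^ 2) * ((1 + v ^ 2) * (Real.pi * v / Real.sinh (Real.pi * v))) := by
  have h0 : (2 : ℂ) + v * Complex.I ≠ 0 := fun h => by
    have := congrArg Complex.re h
    simp at this
  have h1 := Complex.Gamma_add_one _ h0
  have h2 := norm_add_mul_I_sq 2 v
  rw [show (3 : ℂ) + v * Complex.I = 2 + v * Complex.I + 1 by ring, h1, norm_mul, mul_pow,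
    normSq_Gamma_two_add_mul_I hv]
  norm_num at h2 ⊢
  exact Or.inl h2

theorem norm_Gamma_abs (x v : ℝ) : ‖Complex.Gamma (x + v * Complex.I)‖ =
    ‖Complex.Gamma (x + (|v| : ℝ) * Complex.I)‖ := by
  rcases le_total 0 v with h | h
  · rw [abs_of_nonneg h]
  · rw [abs_of_nonpos h, ← Complex.norm_conj, ← Complex.Gamma_conj]
    simp

/-- With `v = 9 + u`, `(π - 2) v ≥ 10 + u`, so `exp (π v)` exceeds `exp (2 v)` by `exp 10 * exp u`.
The polynomial is at most `197600 * (1 + u / 9) ^ 5 ≤ 197600 * exp u`, below `25 * 0.49 * 22000 *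
exp u`. -/
theorem gamma_weight_le {v : ℝ} (hv : 9 ≤ v) :
    (4 + v ^ 2) * ((1 + v ^ 2) * (Real.pi * v / Real.sinh (Real.pi * v))) ≤
      25 * Real.exp (-v) ^ 2 := by
  obtain ⟨u, rfl⟩ : ∃ u, v = 9 + u := ⟨v - 9, by ring⟩
  have hu : 0 ≤ u := by linarith
  set v := 9 + u with hvdef
  have hpi := Real.pi_gt_d2
  have hpi' := Real.pi_lt_d2
  have hs : 0 < Real.sinh (Real.pi * v) := Real.sinh_pos_iff.2 (by positivity)
  -- the exponential factors
  have e10 : (22000 : ℝ) ≤ Real.exp 10 := by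
    have h1 : (2.718 : ℝ) ^ 10 ≤ Real.exp 1 ^ 10 :=
      pow_le_pow_left₀ (by norm_num) (by linarith [Real.exp_one_gt_d9]) 10
    rw [← Real.exp_nat_mul] at h1
    norm_num at h1 ⊢
    linarith
  have h1 : Real.exp 10 * Real.exp u * Real.exp (2 * v) ≤ Real.exp (Real.pi * v) := by
    rw [← Real.exp_add, ← Real.exp_add]
    refine Real.exp_le_exp.2 ?_
    nlinarith
  have h2 : 0.49 * Real.exp (Real.pi * v) ≤ Real.sinh (Real.pi * v) := by
    rw [Real.sinh_eq, Real.exp_neg]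
    have h3 : 28 ≤ Real.exp (Real.pi * v) := by
      have := Real.add_one_le_exp (Real.pi * v)
      nlinarith
    have h4 : (Real.exp (Real.pi * v))⁻¹ ≤ 28⁻¹ := inv_anti₀ (by norm_num) h3
    norm_num at h4 ⊢
    linarith
  have h5 : (1 + u / 9) ^ 5 ≤ Real.exp u := by
    have := pow_le_pow_left₀ (by positivity) (show 1 + u / 9 ≤ Real.exp (u / 9) by
      linarith [Real.add_one_le_exp (u / 9)]) 5
    rw [← Real.exp_nat_mul] at this
    refine this.trans (Real.exp_le_exp.2 ?_)
    push_cast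
    linarith
  have h6 : (4 + v ^ 2) * ((1 + v ^ 2) * (Real.pi * v)) ≤ 197600 * (1 + u / 9) ^ 5 := by
    have hv9 : v = 9 * (1 + u / 9) := by rw [hvdef]; ring
    have hw : 1 ≤ 1 + u / 9 := by linarith [div_nonneg hu (by norm_num : (0 : ℝ) ≤ 9)]
    set w := 1 + u / 9
    rw [hv9]
    have hw2 : 1 ≤ w ^ 2 := one_le_pow₀ hw
    calc (4 + (9 * w) ^ 2) * ((1 + (9 * w) ^ 2) * (Real.pi * (9 * w)))
        ≤ (85 * w ^ 2) * ((82 * w ^ 2) * (3.15 * (9 * w))) := by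
          gcongr
          · nlinarith
          · nlinarith
      _ = 197599.5 * w ^ 5 := by ring
      _ ≤ 197600 * w ^ 5 := by gcongr; norm_num
  rw [← mul_div_assoc, ← mul_div_assoc, div_le_iff₀ hs]
  have h7 : Real.exp (-v) ^ 2 * Real.exp (2 * v) = 1 := by
    rw [← Real.exp_nat_mul, ← Real.exp_add]
    simp
  have hE := Real.exp_pos u
  calc (4 + v ^ 2) * ((1 + v ^ 2) * (Real.pi * v))
      ≤ 197600 * Real.exp u := h6.trans (by gcongr)
    _ ≤ 25 * (0.49 * (Real.exp 10 * Real.exp u)) := by nlinarith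
    _ = 25 * Real.exp (-v) ^ 2 * (0.49 * (Real.exp 10 * Real.exp u * Real.exp (2 * v))) := by
        linear_combination (-(25 * 0.49 * Real.exp 10 * Real.exp u)) * h7
    _ ≤ 25 * Real.exp (-v) ^ 2 * Real.sinh (Real.pi * v) := by
        gcongr
        exact (mul_le_mul_of_nonneg_left h1 (by norm_num)).trans h2

theorem norm_Gamma_three_le {v : ℝ} (hv : 9 ≤ |v|) :
    ‖Complex.Gamma (3 + v * Complex.I)‖ ≤ 5 * Real.exp (-|v|) := by
  have h0 := norm_Gamma_abs 3 v
  norm_num at h0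
  rw [h0]
  refine abs_le_of_sq_le_sq' ?_ (by positivity) |>.2
  rw [normSq_Gamma_three_add_mul_I (by linarith), mul_pow]
  norm_num
  simpa using gamma_weight_le hv

/-- The factor `4 + v ^ 2 ≥ 85` is divided out of the bound for `Γ(3 + i v)`, and `25 / 85 < 0.55 ^
2`. -/
theorem norm_Gamma_two_le {v : ℝ} (hv : 9 ≤ |v|) :
    ‖Complex.Gamma (2 + v * Complex.I)‖ ≤ 0.55 * Real.exp (-|v|) := by
  have h0 := norm_Gamma_abs 2 v
  norm_num at h0
  rw [h0]
  refine abs_le_of_sq_le_sq' ?_ (by positivity) |>.2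
  have h1 := gamma_weight_le hv
  rw [← normSq_Gamma_two_add_mul_I (by linarith)] at h1
  have h2 := sq_nonneg ‖Complex.Gamma (2 + (|v| : ℝ) * Complex.I)‖
  have h3 : 81 ≤ |v| ^ 2 := by nlinarith
  rw [mul_pow]
  norm_num
  nlinarith

/-! ### Lattice sums are close to their means -/

/-- The sum of `exp (-(2 * π * |r| / h))` over the nonzero integers `r`. -/
def poissonTail (h : ℝ) : ℝ := 2 * bose (2 * Real.pi / h)

theorem hasSum_pow_natAbs {q : ℝ} (h0 : 0 ≤ q) (h1 : q < 1) :
    HasSum (fun r : ℤ => q ^ r.natAbs) (1 + 2 * (q / (1 - q))) := by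
  have h2 : HasSum (fun n : ℕ => q ^ (n : ℤ).natAbs) (1 - q)⁻¹ := by
    simpa using hasSum_geometric_of_lt_one h0 h1
  have h3 : HasSum (fun n : ℕ => q ^ (-((n : ℤ) + 1)).natAbs) (q * (1 - q)⁻¹) := by
    refine ((hasSum_geometric_of_lt_one h0 h1).mul_left q).congr_fun fun n => ?_
    rw [show (-((n : ℤ) + 1)).natAbs = n + 1 by omega, pow_succ']
  have h4 : 1 + 2 * (q / (1 - q)) = (1 - q)⁻¹ + q * (1 - q)⁻¹ := by
    have hq : 1 - q ≠ 0 := by linarith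
    field_simp
    ring
  rw [h4]
  exact HasSum.of_nat_of_neg_add_one (f := fun r : ℤ => q ^ r.natAbs) h2 h3

open FourierTransform in
theorem abs_latticeSum_sub_le {b : ℝ} (hb : 1 < b) {p : ℕ} (hp : 2 ≤ p) {τ : ℝ} (hτ : 0 ≤ τ)
    {c : ℝ} (hc : 0 < c) {K : ℝ}
    (hK : ∀ v : ℝ, 2 * Real.pi / Real.log b ≤ |v| →
      ‖Complex.Gamma (p + v * Complex.I)‖ ≤ K * Real.exp (-|v|)) :
    |Real.log b * latticeSum b p τ c - (p - 1).factorial * hurwitzZeta p (1 + τ)| ≤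
      K * poissonTail (Real.log b) * hurwitzZeta p (1 + τ) := by
  have hl : 0 < Real.log b := Real.log_pos hb
  set h := Real.log b with hh
  set Z := hurwitzZeta p (1 + τ) with hZ
  have hZ0 : 0 < Z := hurwitzZeta_pos (by exact_mod_cast hp) (by positivity)
  have hv₁ : 0 < 2 * Real.pi / h := by positivity
  set q := Real.exp (-(2 * Real.pi / h)) with hq
  have hq0 : 0 < q := Real.exp_pos _
  have hq1 : q < 1 := Real.exp_lt_one_iff.2 (by linarith)
  -- the Fourier coefficients
  have hF : ∀ r : ℤ, r ≠ 0 → ‖𝓕 (logKern h p τ) r‖ ≤ h⁻¹ * (K * Z) * q ^ r.natAbs := by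
    intro r hr
    have hr1 : (1 : ℝ) ≤ |(r : ℝ)| := by exact_mod_cast Int.one_le_abs hr
    have hv : |2 * Real.pi * r / h| = r.natAbs * (2 * Real.pi / h) := by
      rw [abs_div, abs_mul, abs_of_pos hl, abs_of_pos Real.two_pi_pos, Nat.cast_natAbs,
        Int.cast_abs]
      ring
    have h1 := norm_mellin_bose_le hτ (s := p + (2 * Real.pi * r / h : ℝ) * Complex.I)
      (by
        simp only [Complex.add_re, Complex.natCast_re, Complex.mul_re, Complex.ofReal_re,
          Complex.ofReal_im, Complex.I_re, Complex.I_im, mul_zero, zero_mul, sub_zero, add_zero]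
        exact_mod_cast hp)
    have hre : ((p : ℂ) + (2 * Real.pi * r / h : ℝ) * Complex.I).re = p := by simp
    rw [hre] at h1
    have h2 := hK (2 * Real.pi * r / h) (by
      rw [hv, Nat.cast_natAbs, Int.cast_abs]; exact le_mul_of_one_le_left hv₁.le hr1)
    rw [hv] at h2
    have h3 : Real.exp (-(r.natAbs * (2 * Real.pi / h))) = q ^ r.natAbs := by
      rw [hq, ← Real.exp_nat_mul]
      ring_nf
    rw [h3] at h2
    rw [fourier_logKern hl, norm_mul, norm_inv, Complex.norm_real, Real.norm_of_nonneg hl.le,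
      mul_assoc h⁻¹]
    refine mul_le_mul_of_nonneg_left (h1.trans ?_) (by positivity)
    calc _ ≤ K * q ^ r.natAbs * Z := by gcongr
      _ = _ := by ring
  have hF0 : 𝓕 (logKern h p τ) ((0 : ℤ) : ℝ) = ((h⁻¹ * ((p - 1).factorial * Z) : ℝ) : ℂ) := by
    rw [fourier_logKern hl]
    simp only [Int.cast_zero, mul_zero, zero_div, Complex.ofReal_zero, zero_mul, add_zero,
      mellin_bose_nat hτ hp]
    push_cast
    rfl
  have hgeo := hasSum_pow_natAbs hq0.le hq1
  have hsumF : Summable fun r : ℤ => 𝓕 (logKern h p τ) r := by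
    refine Summable.of_norm_bounded_eventually (hgeo.summable.mul_left (h⁻¹ * (K * Z))) ?_
    filter_upwards [(Set.finite_singleton (0 : ℤ)).compl_mem_cofinite] with r hr
    exact hF r (by simpa using hr)
  have hP := Real.tsum_eq_tsum_fourier_of_rpow_decay_of_summable (continuous_logKern h p τ)
    one_lt_two (isBigO_logKern hl hp hτ) hsumF (-(Real.log c / h))
  rw [← latticeSum_eq_tsum_logKern hb p τ hc] at hP
  set x : UnitAddCircle := ((-(Real.log c / h) : ℝ) : UnitAddCircle)
  have hn1 : ∀ r : ℤ, ‖fourier r x‖ = 1 := fun r => Circle.norm_coe _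
  have hsum2 : Summable fun r : ℤ => 𝓕 (logKern h p τ) r * fourier r x :=
    Summable.of_norm (by simpa only [norm_mul, hn1, mul_one] using hsumF.norm)
  rw [hsum2.tsum_eq_add_tsum_ite 0, hF0, _root_.fourier_zero, mul_one] at hP
  -- The geometric majorant with its term `r = 0` removed, since that coefficient is the mean.
  have hT := hgeo.mul_left (h⁻¹ * (K * Z)) |>.sub (hasSum_ite_eq (0 : ℤ) (h⁻¹ * (K * Z)))
  have hbound : ‖∑' r : ℤ, if r = 0 then 0 else 𝓕 (logKern h p τ) r * fourier r x‖ ≤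
      h⁻¹ * (K * Z) * (1 + 2 * (q / (1 - q))) - h⁻¹ * (K * Z) := by
    refine tsum_of_norm_bounded hT fun r => ?_
    by_cases hr : r = 0
    · simp [hr]
    · simpa only [hr, if_false, norm_mul, hn1, mul_one, sub_zero] using hF r hr
  have hcomb : ‖((latticeSum b p τ c - h⁻¹ * ((p - 1).factorial * Z) : ℝ) : ℂ)‖ ≤
      h⁻¹ * (K * Z) * (1 + 2 * (q / (1 - q))) - h⁻¹ * (K * Z) := by
    refine le_trans (le_of_eq ?_) hbound
    rw [Complex.ofReal_sub, hP, add_sub_cancel_left]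
  rw [Complex.norm_real, Real.norm_eq_abs] at hcomb
  have hqb : q / (1 - q) = bose (2 * Real.pi / h) := by
    have h1 := one_sub_exp_neg_mul_bose hv₁
    rw [div_eq_iff (by linarith), mul_comm, h1]
  have hfin : h * latticeSum b p τ c - (p - 1).factorial * Z =
      h * (latticeSum b p τ c - h⁻¹ * ((p - 1).factorial * Z)) := by field_simp
  rw [hfin, abs_mul, abs_of_pos hl]
  refine (mul_le_mul_of_nonneg_left hcomb hl.le).trans_eq ?_
  rw [hqb, poissonTail]
  field_simp
  ring

/-! ### The relative error of the approximation -/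

theorem poissonTail_nonneg {h : ℝ} (hh : 0 < h) : 0 ≤ poissonTail h :=
  mul_nonneg zero_le_two (bose_pos (by positivity)).le

theorem poissonTail_le {h : ℝ} (hh : 0 < h) : poissonTail h ≤ h / Real.pi := by
  have hv : 0 < 2 * Real.pi / h := by positivity
  rw [poissonTail, bose, ← div_eq_mul_inv, div_le_div_iff₀ (exp_sub_one_pos hv) Real.pi_pos]
  have h1 := Real.add_one_le_exp (2 * Real.pi / h)
  have h2 : h * (2 * Real.pi / h) = 2 * Real.pi := by field_simp
  nlinarith

theorem nine_le_of_base_le_two {b : ℝ} (hb : 1 < b) (hb2 : b ≤ 2) :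
    9 ≤ 2 * Real.pi / Real.log b := by
  have hl : 0 < Real.log b := Real.log_pos hb
  have h1 : Real.log b ≤ Real.log 2 := Real.log_le_log (by linarith) hb2
  rw [le_div_iff₀ hl]
  nlinarith [Real.log_two_lt_d9, Real.pi_gt_d2]

/-- The tail is at most `2 / (exp 9 - 1)`, and `exp 9 > 8001`. -/
theorem poissonTail_le_of_base_le_two {b : ℝ} (hb : 1 < b) (hb2 : b ≤ 2) :
    poissonTail (Real.log b) ≤ 1 / 4000 := by
  have h1 := nine_le_of_base_le_two hb hb2
  have h2 : (2.718 : ℝ) ^ 9 ≤ Real.exp 1 ^ 9 :=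
    pow_le_pow_left₀ (by norm_num) (by linarith [Real.exp_one_gt_d9]) 9
  rw [← Real.exp_nat_mul] at h2
  norm_num at h2
  have h3 := Real.exp_le_exp.2 h1
  rw [poissonTail, bose, ← div_eq_mul_inv, div_le_iff₀ (by linarith)]
  linarith

theorem biasConstant_pos {b : ℝ} (hb : 1 < b) (d : ℕ) : 0 < biasConstant b d := by
  have hτ := tau_pos hb d
  have h1 : 0 < hurwitzZeta 3 (1 + tau b d) := hurwitzZeta_pos (by norm_num) (by positivity)
  have h2 : 0 < hurwitzZeta 2 (1 + tau b d) := hurwitzZeta_pos (by norm_num) (by positivity)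
  have h3 : 0 < Real.log b := Real.log_pos hb
  unfold biasConstant
  positivity

/-- To first order the error is `2.5 + 2 * 0.55 = 3.6` times `E`; the margin up to `4` absorbs
higher orders. `X` and `Y` are the lattice sums divided by their means; `2.5` is `5 / 2!`. -/
theorem abs_div_sq_sub_one_le {X Y E : ℝ} (hE : 0 ≤ E) (hE1 : E ≤ 1 / 4000)
    (hX : |X - 1| ≤ 0.55 * E) (hY : |Y - 1| ≤ 2.5 * E) : |Y / X ^ 2 - 1| ≤ 4 * E := by
  obtain ⟨x1, x2⟩ := abs_le.1 hX
  obtain ⟨y1, y2⟩ := abs_le.1 hY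
  have hX2 : 0.999 ≤ X := by linarith
  have hX3 : X ≤ 1.001 := by linarith
  have hsq : 0 < X ^ 2 := by positivity
  have u1 : X ^ 2 - 1 ≤ 1.2 * E := by nlinarith
  have u2 : -(1.2 * E) ≤ X ^ 2 - 1 := by nlinarith
  have u3 : 0.99 * E ≤ E * X ^ 2 := by nlinarith
  rw [div_sub_one hsq.ne', abs_div, abs_of_pos hsq, div_le_iff₀ hsq, abs_le]
  constructor <;> linarith

theorem abs_firstOrderBias_sub_le {b : ℝ} (hb : 1 < b) (hb2 : b ≤ 2) (d : ℕ) {m : ℕ} (hm : 1 ≤ m)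
    {n : ℝ} (hn : 0 < n) : |firstOrderBias b d m n - approxBias b d m n| ≤
      4 * poissonTail (Real.log b) * approxBias b d m n := by
  have hl : 0 < Real.log b := Real.log_pos hb
  have hτ := tau_pos hb d
  have hc := scale_pos hb hm hn
  have h9 := nine_le_of_base_le_two hb hb2
  have hZ2 : 0 < hurwitzZeta 2 (1 + tau b d) := hurwitzZeta_pos (by norm_num) (by positivity)
  have hZ3 : 0 < hurwitzZeta 3 (1 + tau b d) := hurwitzZeta_pos (by norm_num) (by positivity)
  have e2 := abs_latticeSum_sub_le hb le_rfl hτ.le hc (K := 0.55)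
    fun v hv => by simpa using norm_Gamma_two_le (h9.trans hv)
  have e3 := abs_latticeSum_sub_le hb (p := 3) (by norm_num) hτ.le hc (K := 5)
    fun v hv => by simpa using norm_Gamma_three_le (h9.trans hv)
  have hE := poissonTail_nonneg hl
  have hE1 := poissonTail_le_of_base_le_two hb hb2
  rw [firstOrderBias_eq hb d hm hn, approxBias, biasConstant]
  set E := poissonTail (Real.log b)
  set L₂ := latticeSum b 2 (tau b d) (scale b m n)
  set L₃ := latticeSum b 3 (tau b d) (scale b m n)
  norm_num [Nat.factorial] at e2 e3
  set Z₂ := hurwitzZeta 2 (1 + tau b d)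
  set Z₃ := hurwitzZeta 3 (1 + tau b d)
  set h := Real.log b
  have hX : |h * L₂ / Z₂ - 1| ≤ 0.55 * E := by
    rw [div_sub_one hZ2.ne', abs_div, abs_of_pos hZ2, div_le_iff₀ hZ2]
    norm_num
    exact e2
  have hY : |h * L₃ / (2 * Z₃) - 1| ≤ 2.5 * E := by
    rw [div_sub_one (by positivity), abs_div, abs_of_pos (by positivity : 0 < 2 * Z₃),
      div_le_iff₀ (by positivity)]
    norm_num
    linarith
  have key := abs_div_sq_sub_one_le hE hE1 hX hY
  have hm0 : (0 : ℝ) < m := by exact_mod_cast hm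
  have hL2 : L₂ ≠ 0 := by
    rintro h0
    rw [h0] at hX
    norm_num at hX
    linarith
  have hA : 0 < n / m * (h * (1 + 2 * tau b d) * (Z₃ / Z₂ ^ 2)) := by positivity
  have heq : n / m * ((1 / 2 + tau b d) * L₃ / L₂ ^ 2) -
      n / m * (h * (1 + 2 * tau b d) * (Z₃ / Z₂ ^ 2)) =
      (h * L₃ / (2 * Z₃) / (h * L₂ / Z₂) ^ 2 - 1) *
        (n / m * (h * (1 + 2 * tau b d) * (Z₃ / Z₂ ^ 2))) := by
    field_simp
  rw [heq, abs_mul, abs_of_pos hA]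
  exact mul_le_mul_of_nonneg_right key hA.le

/-! ### Numerical values of the Hurwitz zeta function -/

theorem sum_range_telescope (P : ℝ → ℝ) (A : ℝ) (n : ℕ) :
    ∑ k ∈ Finset.range n, (P ((k : ℝ) + A)⁻¹ - P ((k : ℝ) + A + 1)⁻¹) =
      P A⁻¹ - P ((n : ℝ) + A)⁻¹ := by
  have := Finset.sum_range_sub' (fun k : ℕ => P ((k : ℝ) + A)⁻¹) n
  simp only [Nat.cast_zero, zero_add, Nat.cast_add, Nat.cast_one] at this
  rw [← this]
  refine Finset.sum_congr rfl fun k _ => ?_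
  rw [add_right_comm]

theorem tendsto_telescope {P : ℝ → ℝ} (hP : Continuous P) (h0 : P 0 = 0) (A : ℝ) :
    Filter.Tendsto (fun n : ℕ => P A⁻¹ - P ((n : ℝ) + A)⁻¹) Filter.atTop (nhds (P A⁻¹)) := by
  have h1 : Filter.Tendsto (fun n : ℕ => ((n : ℝ) + A)⁻¹) Filter.atTop (nhds 0) :=
    tendsto_inv_atTop_zero.comp (Filter.tendsto_atTop_add_const_right _ _
      tendsto_natCast_atTop_atTop)
  simpa [h0] using tendsto_const_nhds (x := P A⁻¹) |>.sub ((hP.tendsto 0).comp h1)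

/-- A termwise comparison with a telescoping series; `P` at `1 / x` vanishes at infinity. -/
theorem hurwitzZeta_le_telescope {P : ℝ → ℝ} (hP : Continuous P) (h0 : P 0 = 0) {s A : ℝ}
    (hs : 1 < s) (hA : 0 < A) (h : ∀ x, A ≤ x → x ^ (-s) ≤ P x⁻¹ - P (x + 1)⁻¹) :
    hurwitzZeta s A ≤ P A⁻¹ := by
  refine le_of_tendsto_of_tendsto' (summable_hurwitz hs hA).hasSum.tendsto_sum_nat
    (tendsto_telescope hP h0 A) fun n => ?_
  rw [← sum_range_telescope]
  exact Finset.sum_le_sum fun k _ => h _ (by linarith [Nat.cast_nonneg (α := ℝ) k])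

theorem le_hurwitzZeta_telescope {P : ℝ → ℝ} (hP : Continuous P) (h0 : P 0 = 0) {s A : ℝ}
    (hs : 1 < s) (hA : 0 < A) (h : ∀ x, A ≤ x → P x⁻¹ - P (x + 1)⁻¹ ≤ x ^ (-s)) :
    P A⁻¹ ≤ hurwitzZeta s A := by
  refine le_of_tendsto_of_tendsto' (tendsto_telescope hP h0 A)
    (summable_hurwitz hs hA).hasSum.tendsto_sum_nat fun n => ?_
  rw [← sum_range_telescope]
  exact Finset.sum_le_sum fun k _ => h _ (by linarith [Nat.cast_nonneg (α := ℝ) k])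

theorem hurwitzZeta_eq_sum_add {s a : ℝ} (hs : 1 < s) (ha : 0 < a) (N : ℕ) :
    hurwitzZeta s a = ∑ k ∈ Finset.range N, ((k : ℝ) + a) ^ (-s) + hurwitzZeta s (N + a) := by
  rw [hurwitzZeta, ← (summable_hurwitz hs ha).sum_add_tsum_nat_add N, hurwitzZeta]
  congr 1
  refine tsum_congr fun k => ?_
  push_cast
  rw [add_assoc]

theorem rpow_neg_two' {x : ℝ} (hx : 0 < x) : x ^ (-2 : ℝ) = (x ^ 2)⁻¹ := by
  rw [Real.rpow_neg hx.le]
  norm_cast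

theorem rpow_neg_three' {x : ℝ} (hx : 0 < x) : x ^ (-3 : ℝ) = (x ^ 3)⁻¹ := by
  rw [Real.rpow_neg hx.le]
  norm_cast

/-- `P` is a truncated Euler–Maclaurin expansion of the tail. Cutting it after the next term, with
the opposite sign, gives the lower bound in `le_hurwitzZeta_two`; likewise for exponent `3`. -/
theorem hurwitzZeta_two_le {A : ℝ} (hA : 0 < A) :
    hurwitzZeta 2 A ≤ A⁻¹ + A⁻¹ ^ 2 / 2 + A⁻¹ ^ 3 / 6 := by
  refine hurwitzZeta_le_telescope (P := fun y => y + y ^ 2 / 2 + y ^ 3 / 6) (by fun_prop)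
    (by norm_num) one_lt_two hA fun x hx => ?_
  have hx0 : 0 < x := hA.trans_le hx
  rw [rpow_neg_two' hx0, ← sub_nonneg]
  have : (x⁻¹ + x⁻¹ ^ 2 / 2 + x⁻¹ ^ 3 / 6 - ((x + 1)⁻¹ + (x + 1)⁻¹ ^ 2 / 2 + (x + 1)⁻¹ ^ 3 / 6)) -
      (x ^ 2)⁻¹ = 1 / (6 * x ^ 3 * (x + 1) ^ 3) := by
    field_simp
    ring
  rw [this]
  positivity

theorem le_hurwitzZeta_two {A : ℝ} (hA : 0 < A) :
    A⁻¹ + A⁻¹ ^ 2 / 2 + A⁻¹ ^ 3 / 6 - A⁻¹ ^ 5 / 30 ≤ hurwitzZeta 2 A := by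
  refine le_hurwitzZeta_telescope (P := fun y => y + y ^ 2 / 2 + y ^ 3 / 6 - y ^ 5 / 30)
    (by fun_prop) (by norm_num) one_lt_two hA fun x hx => ?_
  have hx0 : 0 < x := hA.trans_le hx
  rw [rpow_neg_two' hx0, ← sub_nonneg]
  have : (x ^ 2)⁻¹ - (x⁻¹ + x⁻¹ ^ 2 / 2 + x⁻¹ ^ 3 / 6 - x⁻¹ ^ 5 / 30 - ((x + 1)⁻¹ +
      (x + 1)⁻¹ ^ 2 / 2 + (x + 1)⁻¹ ^ 3 / 6 - (x + 1)⁻¹ ^ 5 / 30)) =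
      (5 * x ^ 2 + 5 * x + 1) / (30 * x ^ 5 * (x + 1) ^ 5) := by
    field_simp
    ring
  rw [this]
  positivity

theorem hurwitzZeta_three_le {A : ℝ} (hA : 0 < A) :
    hurwitzZeta 3 A ≤ A⁻¹ ^ 2 / 2 + A⁻¹ ^ 3 / 2 + A⁻¹ ^ 4 / 4 := by
  refine hurwitzZeta_le_telescope (P := fun y => y ^ 2 / 2 + y ^ 3 / 2 + y ^ 4 / 4)
    (by fun_prop) (by norm_num) (by norm_num) hA fun x hx => ?_
  have hx0 : 0 < x := hA.trans_le hx
  rw [rpow_neg_three' hx0, ← sub_nonneg]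
  have : (x⁻¹ ^ 2 / 2 + x⁻¹ ^ 3 / 2 + x⁻¹ ^ 4 / 4 - ((x + 1)⁻¹ ^ 2 / 2 + (x + 1)⁻¹ ^ 3 / 2 +
      (x + 1)⁻¹ ^ 4 / 4)) - (x ^ 3)⁻¹ = (2 * x + 1) / (4 * x ^ 4 * (x + 1) ^ 4) := by
    field_simp
    ring
  rw [this]
  positivity

theorem le_hurwitzZeta_three {A : ℝ} (hA : 0 < A) :
    A⁻¹ ^ 2 / 2 + A⁻¹ ^ 3 / 2 + A⁻¹ ^ 4 / 4 - A⁻¹ ^ 6 / 12 ≤ hurwitzZeta 3 A := by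
  refine le_hurwitzZeta_telescope (P := fun y => y ^ 2 / 2 + y ^ 3 / 2 + y ^ 4 / 4 - y ^ 6 / 12)
    (by fun_prop) (by norm_num) (by norm_num) hA fun x hx => ?_
  have hx0 : 0 < x := hA.trans_le hx
  rw [rpow_neg_three' hx0, ← sub_nonneg]
  have : (x ^ 3)⁻¹ - (x⁻¹ ^ 2 / 2 + x⁻¹ ^ 3 / 2 + x⁻¹ ^ 4 / 4 - x⁻¹ ^ 6 / 12 -
      ((x + 1)⁻¹ ^ 2 / 2 + (x + 1)⁻¹ ^ 3 / 2 + (x + 1)⁻¹ ^ 4 / 4 - (x + 1)⁻¹ ^ 6 / 12)) =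
      (2 * x + 1) ^ 3 / (12 * x ^ 6 * (x + 1) ^ 6) := by
    field_simp
    ring
  rw [this]
  positivity

theorem hurwitzZeta_two_five_quarters :
    1.1973288 ≤ hurwitzZeta 2 (5 / 4) ∧ hurwitzZeta 2 (5 / 4) ≤ 1.1973294 := by
  -- Ten terms are summed exactly, so the expansion is used at `A = 11.25`, where the two bounds
  -- differ by only `A⁻¹ ^ 5 / 30`.
  have h1 := le_hurwitzZeta_two (A := (10 : ℕ) + 5 / 4) (by positivity)
  have h2 := hurwitzZeta_two_le (A := (10 : ℕ) + 5 / 4) (by positivity)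
  have h3 : ∑ k ∈ Finset.range 10, ((k : ℝ) + 5 / 4) ^ (-2 : ℝ) =
      ∑ k ∈ Finset.range 10, (((k : ℝ) + 5 / 4) ^ 2)⁻¹ :=
    Finset.sum_congr rfl fun k _ => rpow_neg_two' (by positivity)
  rw [hurwitzZeta_eq_sum_add one_lt_two (by norm_num) 10, h3]
  simp only [Finset.sum_range_succ, Finset.sum_range_zero]
  norm_num at h1 h2 ⊢
  constructor <;> linarith

theorem hurwitzZeta_three_five_quarters :
    0.6638698 ≤ hurwitzZeta 3 (5 / 4) ∧ hurwitzZeta 3 (5 / 4) ≤ 0.6638701 := by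
  have h1 := le_hurwitzZeta_three (A := (10 : ℕ) + 5 / 4) (by positivity)
  have h2 := hurwitzZeta_three_le (A := (10 : ℕ) + 5 / 4) (by positivity)
  have h3 : ∑ k ∈ Finset.range 10, ((k : ℝ) + 5 / 4) ^ (-3 : ℝ) =
      ∑ k ∈ Finset.range 10, (((k : ℝ) + 5 / 4) ^ 3)⁻¹ :=
    Finset.sum_congr rfl fun k _ => rpow_neg_three' (by positivity)
  rw [hurwitzZeta_eq_sum_add (by norm_num) (by norm_num) 10, h3]
  simp only [Finset.sum_range_succ, Finset.sum_range_zero]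
  norm_num at h1 h2 ⊢
  constructor <;> linarith

theorem abs_ultraLogLog_constant_sub_le :
    |3 * Real.log 2 * hurwitzZeta 3 (5 / 4) / (2 * hurwitzZeta 2 (5 / 4) ^ 2) - 0.48147| ≤
      0.000005 := by
  obtain ⟨a1, a2⟩ := hurwitzZeta_two_five_quarters
  obtain ⟨c1, c2⟩ := hurwitzZeta_three_five_quarters
  have l1 := Real.log_two_gt_d9
  have l2 := Real.log_two_lt_d9
  set Z₂ := hurwitzZeta 2 (5 / 4)
  set Z₃ := hurwitzZeta 3 (5 / 4)
  have hZ : 0 < Z₂ := by linarith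
  have s1 : (1.1973288 : ℝ) ^ 2 ≤ Z₂ ^ 2 := by gcongr
  have s2 : Z₂ ^ 2 ≤ (1.1973294 : ℝ) ^ 2 := by gcongr
  have p1 : (0.6931471803 * 0.6638698 : ℝ) ≤ Real.log 2 * Z₃ := by gcongr
  have p2 : Real.log 2 * Z₃ ≤ (0.6931471808 * 0.6638701 : ℝ) := by gcongr
  norm_num at s1 s2 p1 p2
  rw [abs_le]
  constructor
  · have : (0.481465 : ℝ) ≤ 3 * Real.log 2 * Z₃ / (2 * Z₂ ^ 2) := by
      rw [le_div_iff₀ (by positivity)]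
      linarith
    linarith
  · have : 3 * Real.log 2 * Z₃ / (2 * Z₂ ^ 2) ≤ 0.481475 := by
      rw [div_le_iff₀ (by positivity)]
      linarith
    linarith

/-! ### Periodicity and means of the information and of the bias expectation -/

theorem approxBias_pos {b : ℝ} (hb : 1 < b) (d : ℕ) {m : ℕ} (hm : 1 ≤ m) {n : ℝ} (hn : 0 < n) :
    0 < approxBias b d m n := by
  have hm0 : (0 : ℝ) < m := by exact_mod_cast hm
  exact mul_pos (by positivity) (biasConstant_pos hb d)

theorem sq_mul_fisher {b : ℝ} (hb : 1 < b) (d : ℕ) {m : ℕ} (hm : 1 ≤ m) {n : ℝ} (hn : 0 < n) :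
    n ^ 2 * fisher b d m n = m * latticeSum b 2 (tau b d) (scale b m n) := by
  rw [(integrable_observedInformation hb d hm hn).2, mul_inv_cancel_left₀ (by positivity)]

theorem cube_mul_biasExpectation {b : ℝ} (hb : 1 < b) (d : ℕ) {m : ℕ} (hm : 1 ≤ m) {n : ℝ}
    (hn : 0 < n) : n ^ 3 * biasExpectation b d m n =
      m * ((1 / 2 + tau b d) * latticeSum b 3 (tau b d) (scale b m n)) := by
  rw [(integrable_biasIntegrand hb d hm hn).2, mul_inv_cancel_left₀ (by positivity)]

theorem latticeSum_base_mul {b : ℝ} (hb : 1 < b) (p : ℕ) (τ c : ℝ) :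
    latticeSum b p τ (b * c) = latticeSum b p τ c := by
  have := tsum_lattice_shift hb (kern p τ) c 1
  simpa only [zpow_one, latticeSum, mul_div_assoc] using this

theorem periodic_fisher_biasExpectation {b : ℝ} (hb : 1 < b) (d : ℕ) {m : ℕ} (hm : 1 ≤ m) {n : ℝ}
    (hn : 0 < n) : (b * n) ^ 2 * fisher b d m (b * n) = n ^ 2 * fisher b d m n ∧
      (b * n) ^ 3 * biasExpectation b d m (b * n) = n ^ 3 * biasExpectation b d m n := by
  have hbn : 0 < b * n := by positivity
  rw [sq_mul_fisher hb d hm hbn, sq_mul_fisher hb d hm hn, cube_mul_biasExpectation hb d hm hbn,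
    cube_mul_biasExpectation hb d hm hn, scale_mul, latticeSum_base_mul hb, latticeSum_base_mul hb]
  exact ⟨rfl, rfl⟩

theorem integral_latticeSum_scale {b : ℝ} (hb : 1 < b) {p : ℕ} (hp : 2 ≤ p) {τ : ℝ} (hτ : 0 ≤ τ)
    {m : ℕ} (hm : 1 ≤ m) : ∫ x in (0 : ℝ)..1, latticeSum b p τ (scale b m (b ^ x)) =
      (Real.log b)⁻¹ * ((p - 1).factorial * hurwitzZeta p (1 + τ)) := by
  rw [← integral_latticeSum hb hp hτ (scale_pos hb hm one_pos)]
  refine intervalIntegral.integral_congr fun x _ => ?_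
  rw [mul_comm (scale b m 1), ← scale_mul, mul_one]

theorem integral_fisher {b : ℝ} (hb : 1 < b) (d : ℕ) {m : ℕ} (hm : 1 ≤ m) :
    ∫ x in (0 : ℝ)..1, (b ^ x) ^ 2 * fisher b d m (b ^ x) =
      m / Real.log b * hurwitzZeta 2 (1 + tau b d) := by
  have h1 : ∀ x : ℝ, (b ^ x) ^ 2 * fisher b d m (b ^ x) =
      m * latticeSum b 2 (tau b d) (scale b m (b ^ x)) := fun x =>
    sq_mul_fisher hb d hm (by positivity)
  simp only [h1]
  rw [intervalIntegral.integral_const_mul,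
    integral_latticeSum_scale hb le_rfl (tau_pos hb d).le hm]
  norm_num
  ring

theorem integral_biasExpectation {b : ℝ} (hb : 1 < b) (d : ℕ) {m : ℕ} (hm : 1 ≤ m) :
    ∫ x in (0 : ℝ)..1, (b ^ x) ^ 3 * biasExpectation b d m (b ^ x) =
      m / Real.log b * (1 + 2 * tau b d) * hurwitzZeta 3 (1 + tau b d) := by
  have h1 : ∀ x : ℝ, (b ^ x) ^ 3 * biasExpectation b d m (b ^ x) =
      m * (1 / 2 + tau b d) * latticeSum b 3 (tau b d) (scale b m (b ^ x)) := fun x => by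
    rw [cube_mul_biasExpectation hb d hm (by positivity), mul_assoc]
  simp only [h1]
  rw [intervalIntegral.integral_const_mul,
    integral_latticeSum_scale hb (by norm_num) (tau_pos hb d).le hm]
  norm_num [Nat.factorial]
  ring

end ULL

end

theorem mainTheorem5 :
    (∀ (b : ℝ) (d : ℕ), 1 < b →
      -- the maximum-likelihood estimate exists and is unique
      (∀ m : ℕ, 1 ≤ m → ∀ r : Fin m → ULL.Register d, ∃! x, ULL.IsMLEstimate b d m r x) ∧
      -- the expectations in the first-order bias are finite
      (∀ m : ℕ, 1 ≤ m → ∀ n : ℝ, 0 < n →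
        Integrable (ULL.observedInformation b d m n) (ULL.sketchLaw b d m n) ∧
        Integrable (ULL.biasIntegrand b d m n) (ULL.sketchLaw b d m n)) ∧
      -- first-order expansions of the bias of the estimate and of the corrected estimate,
      -- uniformly in the distinct count
      (∀ ε : ℝ, 0 < ε → ∃ M : ℕ, 1 ≤ M ∧ ∀ m : ℕ, M ≤ m → ∀ n : ℝ, 0 < n →
        Integrable (ULL.mlEstimate b d m) (ULL.sketchLaw b d m n) ∧
        |ULL.bias b d m n (ULL.mlEstimate b d m) - ULL.firstOrderBias b d m n| ≤ ε * (n / m) ∧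
        |ULL.bias b d m n (ULL.correctedEstimate b d m) -
          (ULL.firstOrderBias b d m n - ULL.approxBias b d m n)| ≤ ε * (n / m)) ∧
      -- the two factors of the first-order bias are, after scaling, periodic in `log_b n` with
      -- period 1, and the approximation replaces them by their means over a period
      (∀ m : ℕ, 1 ≤ m →
        (∀ n : ℝ, 0 < n →
          (b * n) ^ 2 * ULL.fisher b d m (b * n) = n ^ 2 * ULL.fisher b d m n ∧
          (b * n) ^ 3 * ULL.biasExpectation b d m (b * n) =
            n ^ 3 * ULL.biasExpectation b d m n) ∧
        (∫ x in (0 : ℝ)..1, (b ^ x) ^ 2 * ULL.fisher b d m (b ^ x)) =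
          m / Real.log b * ULL.hurwitzZeta 2 (1 + ULL.tau b d) ∧
        (∫ x in (0 : ℝ)..1, (b ^ x) ^ 3 * ULL.biasExpectation b d m (b ^ x)) =
          m / Real.log b * (1 + 2 * ULL.tau b d) * ULL.hurwitzZeta 3 (1 + ULL.tau b d) ∧
        (∀ n : ℝ, 0 < n →
          ULL.approxBias b d m n =
            1 / ((∫ x in (0 : ℝ)..1, (b ^ x) ^ 2 * ULL.fisher b d m (b ^ x)) / n ^ 2) ^ 2 *
              ((∫ x in (0 : ℝ)..1, (b ^ x) ^ 3 * ULL.biasExpectation b d m (b ^ x)) / n ^ 3)))) ∧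
    -- relative error of the approximation for bases at most 2
    (∀ (b : ℝ) (d m : ℕ) (n : ℝ), 1 < b → b ≤ 2 → 1 ≤ m → 0 < n →
      |ULL.firstOrderBias b d m n - ULL.approxBias b d m n| ≤
        1 / 1000 * ULL.approxBias b d m n) ∧
    -- the relative error vanishes as `b → 1`, uniformly in the other parameters
    (∀ ε : ℝ, 0 < ε → ∃ b₀ : ℝ, 1 < b₀ ∧ ∀ (b : ℝ) (d m : ℕ) (n : ℝ),
      1 < b → b < b₀ → 1 ≤ m → 0 < n →
        |ULL.firstOrderBias b d m n - ULL.approxBias b d m n| ≤ ε * ULL.approxBias b d m n) ∧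
    -- the case of UltraLogLog, `b = 2` and `d = 2`
    (∀ (m : ℕ) (r : Fin m → ULL.Register 2),
      ULL.correctedEstimate 2 2 m r =
        ULL.mlEstimate 2 2 m r *
          (1 + 1 / m * (3 * Real.log 2 * ULL.hurwitzZeta 3 (5 / 4) /
            (2 * ULL.hurwitzZeta 2 (5 / 4) ^ 2)))⁻¹) ∧
    |3 * Real.log 2 * ULL.hurwitzZeta 3 (5 / 4) / (2 * ULL.hurwitzZeta 2 (5 / 4) ^ 2) - 0.48147| ≤
      0.000005 := by
  refine ⟨fun b d hb => ⟨fun m hm r => ULL.existsUnique_isMLEstimate hb d hm r,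
    fun m hm n hn => ⟨(ULL.integrable_observedInformation hb d hm hn).1,
      (ULL.integrable_biasIntegrand hb d hm hn).1⟩,
    fun ε hε => ULL.bias_expansion hb d hε, fun m hm =>
      ⟨fun n hn => ULL.periodic_fisher_biasExpectation hb d hm hn, ULL.integral_fisher hb d hm,
        ULL.integral_biasExpectation hb d hm, fun n hn => ?_⟩⟩,
    fun b d m n hb hb2 hm hn => ?_, fun ε hε => ?_, fun m r => ?_,
    ULL.abs_ultraLogLog_constant_sub_le⟩
  · rw [ULL.integral_fisher hb d hm, ULL.integral_biasExpectation hb d hm, ULL.approxBias,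
      ULL.biasConstant]
    have hl : 0 < Real.log b := Real.log_pos hb
    have hm0 : (0 : ℝ) < m := by exact_mod_cast hm
    have hZ : 0 < ULL.hurwitzZeta 2 (1 + ULL.tau b d) :=
      ULL.hurwitzZeta_pos one_lt_two (by linarith [ULL.tau_pos hb d])
    field_simp
  · refine (ULL.abs_firstOrderBias_sub_le hb hb2 d hm hn).trans
      (mul_le_mul_of_nonneg_right ?_ (ULL.approxBias_pos hb d hm hn).le)
    linarith [ULL.poissonTail_le_of_base_le_two hb hb2]
  -- The relative error is at most `4 * log b / π ≤ 2 * log b`, which is at most `ε` once `log b ≤ ε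
  -- / 2`; the minimum with `2` keeps the Gamma bounds available.
  · refine ⟨min 2 (Real.exp (ε / 2)), lt_min one_lt_two (Real.one_lt_exp_iff.2 (by positivity)),
      fun b d m n hb hb' hm hn => ?_⟩
    refine (ULL.abs_firstOrderBias_sub_le hb (hb'.le.trans (min_le_left _ _)) d hm hn).trans
      (mul_le_mul_of_nonneg_right ?_ (ULL.approxBias_pos hb d hm hn).le)
    have hl : 0 < Real.log b := Real.log_pos hb
    have h1 : Real.log b ≤ ε / 2 :=
      (Real.log_le_iff_le_exp (by linarith)).2 (hb'.le.trans (min_le_right _ _))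
    have h2 : Real.log b / Real.pi ≤ Real.log b / 2 := by gcongr; exact Real.two_le_pi
    linarith [ULL.poissonTail_le hl]
  · have ht : ULL.tau 2 2 = 1 / 4 := by norm_num [ULL.tau]
    rw [ULL.correctedEstimate, ULL.biasConstant, ht, show (1 : ℝ) + 1 / 4 = 5 / 4 by norm_num]
    congr 4
    ring
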